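/- A co-nondeterministic circuit $D$ on $n$ input variables is a Boolean circuit $C(w,y)$ (gates: constants, $\neg$, binary $\wedge$ and $\vee$, arbitrary fan-out) on the $n$ input variables $w$ and some number $k$ of further variables $y$; we put $D(w)=1$ if $C(w,y)=1$ for all $y\in\{0,1\}^k$, and $D(w)=0$ otherwise. Its size is the number of nodes of $C$ (variables and gates). For a language $L\subseteq\{0,1\}^*$ write $L(w)=1$ if $w\in L$ and $L(w)=0$ otherwise; $\log$ is the logarithm to base $2$. **Lemma.** Let $L\in\mathsf{NP}$. Suppose that there are a deterministic algorithm (Turing machine) $R$ and constants $c,n_0\in\mathbb N$ such that, for every $n\ge n_0$ and every co-nondeterministic circuit $D$ on $n$ input variables of size at most $n^{\log n}$, $R$ on input $1^n$ and the description of $D$ halts within $2^{cn}$ steps and outputs a string $w\in\{0,1\}^n$ such that $D(w)\ne L(w)$. Then for every language $L'\in\mathsf{NP}$ and every constant $\varepsilon>0$ we have $L'\in\mathsf{DTIME}[2^{n^{\varepsilon}}]$, i.e. some deterministic Turing machine decides $L'$ in $O(2^{n^\varepsilon})$ steps on inputs of length $n$. -/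

import Mathlib

/-! ### Turing machines with a step count -/

/-- A deterministic machine with input alphabet `A` and output alphabet `B`: Mathlib's
multi-stack form of the multi-tape Turing machine (finitely many stacks, labels and internal
states), where in addition every stack has a finite alphabet. -/
structure TuringMachine (A B : Type) extends Turing.TM2ComputableAux A B where
  finite_alphabet : ∀ k, Finite (tm.Γ k)

/-- On input `u` the machine `M` halts after at most `t` steps with output `v`. -/
def TuringMachine.OutputsInTime {A B : Type} (M : TuringMachine A B)
    (u : List A) (v : List B) (t : ℕ) : Prop :=
  Nonempty (Turing.TM2OutputsInTime M.tm (u.map M.inputAlphabet.symm)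
    (some (v.map M.outputAlphabet.symm)) t)

/-! ### Complexity classes -/

/-- `L ∈ DTIME[T]`: some machine decides `L` in `O(T(n))` steps on inputs of length `n`. -/
def InDTIME (T : ℕ → ℝ) (L : Language Bool) : Prop :=
  ∃ (M : TuringMachine Bool Bool) (C : ℕ), ∀ x : List Bool, ∃ (b : Bool) (t : ℕ),
    M.OutputsInTime x [b] t ∧ (t : ℝ) ≤ C * T x.length ∧ (b = true ↔ x ∈ L)

/-- A pair of binary strings, written as `x,y` over the alphabet with bits and a comma. -/
def encodePair (x y : List Bool) : List Computability.Γ' :=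
  x.map Computability.Γ'.bit ++ Computability.Γ'.comma :: y.map Computability.Γ'.bit

/-- `L ∈ NP`: membership is witnessed by strings of polynomial length that are checked by a
deterministic machine running in polynomial time. -/
def InNP (L : Language Bool) : Prop :=
  ∃ (V : TuringMachine Computability.Γ' Bool) (f : List Bool → List Bool → Bool)
    (p q : Polynomial ℕ),
    (∀ x y, V.OutputsInTime (encodePair x y) [f x y] (q.eval (encodePair x y).length)) ∧
    ∀ x, x ∈ L ↔ ∃ y : List Bool, y.length ≤ p.eval x.length ∧ f x y = true

/-! ### Co-nondeterministic circuits -/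

/-- A gate of a Boolean circuit whose nodes are listed in topological order. A gate names its
predecessors by position, counted backwards: in a gate, `0` is the node listed immediately before
it, `1` is the one before that, and so on. -/
inductive Gate where
  | const (b : Bool)
  | neg (i : ℕ)
  | conj (i j : ℕ)
  | disj (i j : ℕ)

/-- The predecessors of the gate are among the `m` nodes that precede it. -/
def Gate.Fits (m : ℕ) : Gate → Prop
  | const _ => True
  | neg i => i < m
  | conj i j => i < m ∧ j < m
  | disj i j => i < m ∧ j < m

/-- The value of a gate, given the values of the preceding nodes, latest node first. (The default
value of `getD` is never used when the gate fits.) -/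
def Gate.eval (vals : List Bool) : Gate → Bool
  | const b => b
  | neg i => !(vals.getD i false)
  | conj i j => vals.getD i false && vals.getD j false
  | disj i j => vals.getD i false || vals.getD j false

/-- In a list of gates that comes after `m` other nodes, all predecessors exist. -/
def GatesFit : ℕ → List Gate → Prop
  | _, [] => True
  | m, g :: gs => g.Fits m ∧ GatesFit (m + 1) gs

/-- A co-nondeterministic circuit on `n` input variables: the nodes are the `n` input variables
together with `guess` universally quantified variables, followed by a nonempty list of gates
(constants, negations, binary conjunctions and disjunctions; arbitrary fan-out). The last gate is
the output. -/
structure CoNondetCircuit (n : ℕ) where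
  guess : ℕ
  gates : List Gate
  gates_ne_nil : gates ≠ []
  fit : GatesFit (n + guess) gates

namespace CoNondetCircuit

variable {n : ℕ}

/-- The size of a circuit: its number of nodes (input variables, quantified variables, gates). -/
def size (D : CoNondetCircuit n) : ℕ := n + D.guess + D.gates.length

/-- The value of the output gate for the values `z` of all `n + guess` variables. -/
def output (D : CoNondetCircuit n) (z : List Bool) : Bool :=
  (D.gates.foldl (fun vals g => g.eval vals :: vals) z).headD false

/-- `D(w) = 1`: the output is `1` for every assignment `y` to the quantified variables. -/
def Accepts (D : CoNondetCircuit n) (w : List Bool) : Prop :=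
  ∀ y : List Bool, y.length = D.guess → D.output (w ++ y) = true

end CoNondetCircuit

/-- A number in unary. -/
def encodeUnary (i : ℕ) : List Computability.Γ' :=
  List.replicate i (Computability.Γ'.bit true)

open Computability.Γ' in
/-- A gate is written between brackets, as a two-bit operation code and its arguments. -/
def Gate.encode : Gate → List Computability.Γ'
  | const b => [bra, bit false, bit false, bit b, ket]
  | neg i => [bra, bit false, bit true] ++ encodeUnary i ++ [ket]
  | conj i j => [bra, bit true, bit false] ++ encodeUnary i ++ [comma] ++ encodeUnary j ++ [ket]
  | disj i j => [bra, bit true, bit true] ++ encodeUnary i ++ [comma] ++ encodeUnary j ++ [ket]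

open Computability.Γ' in
/-- The pair `(1ⁿ, D)` as a string: `1ⁿ`, then the description of the circuit `D`. -/
def CoNondetCircuit.encode {n : ℕ} (D : CoNondetCircuit n) : List Computability.Γ' :=
  encodeUnary n ++ [comma] ++ encodeUnary D.guess ++ [comma] ++ D.gates.flatMap Gate.encode

/-! Let `x` be an instance of `L'` of length `k`, and let `n` be about `k^(1/d)` for a large
constant `d`. Consider the co-nondeterministic circuit on `n` inputs that ignores its input, reads
the universal variables as a candidate witness for `x`, and outputs 1 iff the verifier of `L'`
rejects it. It computes the constant `x ∉ L'`. Its size is polynomial in `k`, hence in `n`, hence at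
most `n^(log n)` once `n` exceeds a constant. So `R` finds in time `2^(cn)` a word `w` of length `n`
on which the circuit and `L` differ, which means `w ∈ L` iff `x ∈ L'`. In effect `R` compresses an
instance of `L'` of length `k` to an instance of `L` of length about `k^(1/d)`. Since `L` is in NP,
exhaustive search decides `w ∈ L` in time `2^(O(n^e))`, where `e` does not depend on `d`. For `d`
large compared with `(e+1)/ε` the exponents are `O(k^(ε/2))`, and the polynomial factors are
absorbed in `2^(k^ε)`.

Most of the work is to make the algorithm an actual Turing machine. Programs over finitely many
stacks are compiled to machines (`StackProgram.Runs.outputsInTime`), and machines can be called from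
programs (`StackProgram.runs_call`); this gives composition (`TuringMachine.OutputsInTime.comp`).
The algorithm is a composition of four machines: one that writes `1^n` in front of `x`
(`UnaryRoot.exists_machine`), one that writes the circuit (`LoopExpr.exists_machine`), `R`, and the
search for `L` (`InNP.exists_exponential_time`).

The circuit (`InNP.exists_circuits`) is a Cook–Levin tableau of the verifier, with a first row that
is partly guessed (`StackSimulation.accepts_refuter`). Gates name their predecessors by relative
distance, and every cell takes the same number of gates; therefore all cells of one kind have
literally the same text. The description of the circuit consists of a few such strings, repeated
polynomially often, and nested loops over the input produce it
(`StackSimulation.generable_refuter`). -/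

/-! ### Structured programs over finitely many stacks -/

/-- The contents of a family of stacks, top element first. -/
abbrev StackStore {K : Type} (Γ : K → Type) : Type := ∀ k, List (Γ k)

/-- The instruction attached to a control state `q : Q` of a stack machine. -/
inductive StackAction {K : Type} (Γ : K → Type) (Q : Type) where
  | push (k : K) (a : Γ k) (q : Q)
  | pop (k : K) (next : Option (Γ k) → Q)
  | halt

/-- Structured programs whose only data are the stacks. -/
inductive StackProgram {K : Type} (Γ : K → Type) where
  | skip
  | push (k : K) (a : Γ k)
  | seq (p q : StackProgram Γ)
  | pop (k : K) (next : Option (Γ k) → StackProgram Γ)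
  | loop (k : K) (body : Γ k → StackProgram Γ)

section Machine

variable {K : Type} {Γ : K → Type} {Q : Type} [DecidableEq K]

/-- One step of a stack machine. -/
def stackStep (act : Q → StackAction Γ Q) (c : Q × StackStore Γ) : Option (Q × StackStore Γ) :=
  match act c.1 with
  | .push k a q => some (q, Function.update c.2 k (a :: c.2 k))
  | .pop k next => some (next (c.2 k).head?, Function.update c.2 k (c.2 k).tail)
  | .halt => none

/-- `c'` is reached from `c` in exactly `t` steps. -/
def StackReaches (act : Q → StackAction Γ Q) : ℕ → Q × StackStore Γ → Q × StackStore Γ → Prop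
  | 0, c, c' => c = c'
  | t + 1, c, c' => ∃ c₁, stackStep act c = some c₁ ∧ StackReaches act t c₁ c'

theorem StackReaches.trans {act : Q → StackAction Γ Q} {t₁ t₂ : ℕ} {c₁ c₂ c₃ : Q × StackStore Γ}
    (h₁ : StackReaches act t₁ c₁ c₂) (h₂ : StackReaches act t₂ c₂ c₃) :
    StackReaches act (t₁ + t₂) c₁ c₃ := by
  induction t₁ generalizing c₁ with
  | zero =>
    cases (h₁ : c₁ = c₂)
    simpa using h₂
  | succ t ih =>
    obtain ⟨c, hc, h⟩ := h₁
    rw [Nat.succ_add]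
    exact ⟨c, hc, ih h⟩

end Machine

namespace StackProgram

variable {K : Type} {Γ : K → Type}

/-- The control states inside a program. -/
def Label : StackProgram Γ → Type
  | skip => Empty
  | push _ _ => Unit
  | seq p q => p.Label ⊕ q.Label
  | pop _ next => Option (Σ o, (next o).Label)
  | loop _ body => Option (Σ a, (body a).Label)

/-- The first control state of a program whose labels are embedded by `e` and which is followed
by the state `x`. -/
def entry {Q : Type} : (p : StackProgram Γ) → (p.Label → Q) → Q → Q
  | skip, _, x => x
  | push _ _, e, _ => e ()
  | seq p q, e, x => p.entry (fun l => e (.inl l)) (q.entry (fun l => e (.inr l)) x)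
  | pop _ _, e, _ => e none
  | loop _ _, e, _ => e none

/-- The instructions of a program whose labels are embedded by `e` and which is followed by the
state `x`. -/
def code {Q : Type} : (p : StackProgram Γ) → (p.Label → Q) → Q → p.Label → StackAction Γ Q
  | push k a, _, x, _ => .push k a x
  | seq p q, e, x, .inl l => p.code (fun l => e (.inl l)) (q.entry (fun l => e (.inr l)) x) l
  | seq _ q, e, x, .inr l => q.code (fun l => e (.inr l)) x l
  | pop k next, e, x, none => .pop k fun o => (next o).entry (fun l => e (some ⟨o, l⟩)) x
  | pop _ next, e, x, some ⟨o, l⟩ => (next o).code (fun l => e (some ⟨o, l⟩)) x l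
  | loop k body, e, x, none => .pop k fun o =>
      match o with
      | none => x
      | some a => (body a).entry (fun l => e (some ⟨a, l⟩)) (e none)
  | loop _ body, e, _, some ⟨a, l⟩ => (body a).code (fun l => e (some ⟨a, l⟩)) (e none) l

theorem finite_label [∀ k, Finite (Γ k)] : ∀ p : StackProgram Γ, Finite p.Label
  | skip => inferInstanceAs (Finite Empty)
  | push _ _ => inferInstanceAs (Finite Unit)
  | seq p q => by
    have := finite_label p
    have := finite_label q
    exact inferInstanceAs (Finite (p.Label ⊕ q.Label))
  | pop _ next => by
    have := fun o => finite_label (next o)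
    exact inferInstanceAs (Finite (Option (Σ o, (next o).Label)))
  | loop _ body => by
    have := fun a => finite_label (body a)
    exact inferInstanceAs (Finite (Option (Σ a, (body a).Label)))

variable [DecidableEq K]

/-- The program `p` transforms the stacks `S` to `S'` in at most `t` steps. -/
def Runs (p : StackProgram Γ) (S S' : StackStore Γ) (t : ℕ) : Prop :=
  ∀ (Q : Type) (act : Q → StackAction Γ Q) (e : p.Label → Q) (x : Q),
    (∀ l, act (e l) = p.code e x l) → ∃ t' ≤ t, StackReaches act t' (p.entry e x, S) (x, S')

theorem Runs.mono {p : StackProgram Γ} {S S' : StackStore Γ} {t u : ℕ} (h : p.Runs S S' t)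
    (htu : t ≤ u) : p.Runs S S' u := fun Q act e x hc => by
  obtain ⟨t', ht', h'⟩ := h Q act e x hc
  exact ⟨t', ht'.trans htu, h'⟩

theorem Runs.of_eq {p : StackProgram Γ} {S S' S'' : StackStore Γ} {t : ℕ} (h : p.Runs S S' t)
    (hS : S' = S'') : p.Runs S S'' t := hS ▸ h

theorem runs_skip (S : StackStore Γ) : (skip : StackProgram Γ).Runs S S 0 :=
  fun _ _ _ _ _ => ⟨0, le_rfl, rfl⟩

theorem runs_push (k : K) (a : Γ k) (S : StackStore Γ) :
    (push k a).Runs S (Function.update S k (a :: S k)) 1 := fun Q act e x hc =>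
  ⟨1, le_rfl, _, by simp [stackStep, entry, hc (), code], rfl⟩

/-- `Runs` quantifies over all surrounding machines and exits, so the hypothesis on `p` may be used
with the entry of `q` as the exit. The other constructs are treated alike; the exit of a loop body
is the head of the loop. -/
theorem Runs.seq {p q : StackProgram Γ} {S₁ S₂ S₃ : StackStore Γ} {t₁ t₂ : ℕ}
    (h₁ : p.Runs S₁ S₂ t₁) (h₂ : q.Runs S₂ S₃ t₂) : (p.seq q).Runs S₁ S₃ (t₁ + t₂) :=
  fun Q act e x hc => by
  obtain ⟨u₁, hu₁, r₁⟩ := h₁ Q act (fun l => e (.inl l)) (q.entry (fun l => e (.inr l)) x)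
    fun l => hc (.inl l)
  obtain ⟨u₂, hu₂, r₂⟩ := h₂ Q act (fun l => e (.inr l)) x fun l => hc (.inr l)
  exact ⟨u₁ + u₂, by omega, r₁.trans r₂⟩

theorem Runs.pop {k : K} {next : Option (Γ k) → StackProgram Γ} {S S' : StackStore Γ} {t : ℕ}
    (h : (next (S k).head?).Runs (Function.update S k (S k).tail) S' t) :
    (StackProgram.pop k next).Runs S S' (t + 1) := fun Q act e x hc => by
  obtain ⟨u, hu, r⟩ := h Q act (fun l => e (some ⟨_, l⟩)) x fun l => hc (some ⟨_, l⟩)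
  exact ⟨u + 1, by omega, _, by simp only [stackStep, entry, hc none, code], r⟩

theorem runs_loop_nil {k : K} {body : Γ k → StackProgram Γ} {S : StackStore Γ} (h : S k = []) :
    (loop k body).Runs S S 1 := fun Q act e x hc =>
  ⟨1, le_rfl, (x, S), by
    simp only [stackStep, entry, hc none, code, h, List.head?_nil, List.tail_nil]
    rw [← h, Function.update_eq_self], rfl⟩

theorem Runs.loop_cons {k : K} {body : Γ k → StackProgram Γ} {S S₁ S₂ : StackStore Γ} {a : Γ k}
    {l : List (Γ k)} {t₁ t₂ : ℕ} (h : S k = a :: l)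
    (h₁ : (body a).Runs (Function.update S k l) S₁ t₁) (h₂ : (loop k body).Runs S₁ S₂ t₂) :
    (loop k body).Runs S S₂ (t₁ + t₂ + 1) := fun Q act e x hc => by
  obtain ⟨u₁, hu₁, r₁⟩ := h₁ Q act (fun l => e (some ⟨_, l⟩)) (e none) fun l => hc (some ⟨_, l⟩)
  obtain ⟨u₂, hu₂, r₂⟩ := h₂ Q act e x hc
  exact ⟨u₁ + u₂ + 1, by omega, _, by
    simp only [stackStep, entry, hc none, code, h, List.head?_cons, List.tail_cons], r₁.trans r₂⟩

end StackProgram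

/-! ### Programs as Turing machines -/

section Compile

variable {K : Type} {Γ : K → Type} [DecidableEq K]

/-- The stacks all of which are empty, but for the stack `k`. -/
def singleStack (k : K) (l : List (Γ k)) : StackStore Γ := Function.update (fun _ => []) k l

theorem Turing.initList_eq (tm : Turing.FinTM2) (s : List (tm.Γ tm.k₀)) :
    Turing.initList tm s = ⟨some tm.main, tm.initialState, singleStack tm.k₀ s⟩ := by
  unfold Turing.initList
  congr 1
  funext k
  by_cases h : k = tm.k₀
  · subst h
    simp [singleStack]
  · simp [singleStack, h]

theorem Turing.haltList_eq (tm : Turing.FinTM2) (s : List (tm.Γ tm.k₁)) :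
    Turing.haltList tm s = ⟨none, tm.initialState, singleStack tm.k₁ s⟩ := by
  unfold Turing.haltList
  congr 1
  funext k
  by_cases h : k = tm.k₁
  · subst h
    simp [singleStack]
  · simp [singleStack, h]

/-- A control state of a stack machine as a statement of a `TM2` machine. -/
def StackAction.toStmt {Q : Type} (q₀ : Q) : StackAction Γ Q → Turing.TM2.Stmt Γ Q Q
  | push k a q => .push k (fun _ => a) (.goto fun _ => q)
  | pop k next => .pop k (fun _ o => next o) (.goto id)
  | halt => .load (fun _ => q₀) .halt

/-- The internal state serves only to carry the target of a `pop` to the `goto` in the same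
statement. Between steps its value is irrelevant, hence arbitrary at the start and existential at
the end. -/
theorem StackReaches.iterate {Q : Type} {act : Q → StackAction Γ Q} (q₀ : Q) {t : ℕ}
    {q q' : Q} {S S' : StackStore Γ} (h : StackReaches act t (q, S) (q', S')) (v : Q) :
    ∃ v', (flip bind (Turing.TM2.step fun q => (act q).toStmt q₀))^[t]
      (some ⟨some q, v, S⟩) = some ⟨some q', v', S'⟩ := by
  induction t generalizing q S v with
  | zero =>
    cases (h : (q, S) = (q', S'))
    exact ⟨v, rfl⟩
  | succ t ih =>
    obtain ⟨⟨q₁, S₁⟩, h₁, h⟩ := h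
    have key : ∃ v₁, Turing.TM2.step (fun q => (act q).toStmt q₀) ⟨some q, v, S⟩ =
        some ⟨some q₁, v₁, S₁⟩ := by
      simp only [stackStep] at h₁
      cases hq : act q <;> simp_all [StackAction.toStmt]
    obtain ⟨v₁, key⟩ := key
    obtain ⟨v', hv'⟩ := ih h v₁
    refine ⟨v', ?_⟩
    rw [Function.iterate_succ_apply]
    exact (congrArg _ key).trans hv'

variable [Fintype K] [∀ k, Finite (Γ k)] {A B : Type}

/-- The control of the machine that runs a program and halts. -/
def StackProgram.control (p : StackProgram Γ) : Option p.Label → StackAction Γ (Option p.Label)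
  | none => .halt
  | some l => p.code some none l

/-- The Turing machine that runs a program. -/
noncomputable def StackProgram.toMachine (p : StackProgram Γ) (k₀ k₁ : K) (i : Γ k₀ ≃ A)
    (o : Γ k₁ ≃ B) : TuringMachine A B :=
  haveI := p.finite_label
  haveI : Fintype (Option p.Label) := Fintype.ofFinite _
  haveI : Fintype (Γ k₀) := Fintype.ofFinite _
  { tm :=
      { K := K
        k₀ := k₀
        k₁ := k₁
        Γ := Γ
        Λ := Option p.Label
        main := p.entry some none
        σ := Option p.Label
        initialState := none
        m := fun q => (p.control q).toStmt none }
    inputAlphabet := i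
    outputAlphabet := o
    finite_alphabet := inferInstance }

theorem StackProgram.Runs.outputsInTime {p : StackProgram Γ} {k₀ k₁ : K} {i : Γ k₀ ≃ A}
    {o : Γ k₁ ≃ B} {u : List A} {v : List B} {t : ℕ}
    (h : p.Runs (singleStack k₀ (u.map i.symm)) (singleStack k₁ (v.map o.symm)) t) :
    (p.toMachine k₀ k₁ i o).OutputsInTime u v (t + 1) := by
  obtain ⟨t', ht', r⟩ := h _ p.control some none fun l => rfl
  obtain ⟨v', hv'⟩ := r.iterate none none
  -- The additional step executes `halt`, which also restores the initial internal state, as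
  -- `haltList` demands.
  refine ⟨⟨⟨t' + 1, ?_⟩, Nat.succ_le_succ ht'⟩⟩
  rw [Function.iterate_succ_apply']
  refine (congrArg _ ((congrArg _ (congrArg some (Turing.initList_eq _ _))).trans hv')).trans ?_
  exact (congrArg some (Turing.haltList_eq (p.toMachine k₀ k₁ i o).tm _)).symm

end Compile

/-! ### Calling a Turing machine from a program -/

namespace StackProgram

section Call

variable {K : Type} {Γ : K → Type} {K₀ Λ σ : Type} (e : K₀ → K) (c : K)
  (enc : Λ × σ → Γ c)

/-- The execution of a `TM2` statement from the internal state `v`. The stacks of the machine are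
embedded by `e`; the next label and internal state are pushed on the stack `c`. -/
def ofStmt : Turing.TM2.Stmt (fun k => Γ (e k)) Λ σ → σ → StackProgram Γ
  | .push k f q, v => (push (e k) (f v)).seq (ofStmt q v)
  | .peek k f q, v => pop (e k) fun o =>
      match o with
      | none => ofStmt q (f v none)
      | some a => (push (e k) a).seq (ofStmt q (f v (some a)))
  | .pop k f q, v => pop (e k) fun o => ofStmt q (f v o)
  | .load f q, v => ofStmt q (f v)
  | .branch f q₁ q₂, v => cond (f v) (ofStmt q₁ v) (ofStmt q₂ v)
  | .goto l, v => push c (enc (l v, v))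
  | .halt, _ => skip

/-- A bound for the number of steps of `StackProgram.ofStmt`. -/
def stmtCost {Γ : K₀ → Type} : Turing.TM2.Stmt Γ Λ σ → ℕ
  | .push _ _ q => 1 + stmtCost q
  | .peek _ _ q => 1 + stmtCost q + 1
  | .pop _ _ q => stmtCost q + 1
  | .load _ q => stmtCost q
  | .branch _ q₁ q₂ => stmtCost q₁ + stmtCost q₂
  | .goto _ => 1
  | .halt => 0

/-- The stacks `S` represent the configuration `C` of the embedded machine, and the other stacks
are as in `S₀`. -/
structure Represents (S₀ S : StackStore Γ) (C : Turing.TM2.Cfg (fun k => Γ (e k)) Λ σ) : Prop where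
  stk : ∀ k, S (e k) = C.stk k
  ctrl : S c = (C.l.map fun l => enc (l, C.var)).toList
  frame : ∀ k, (∀ k₀, k ≠ e k₀) → k ≠ c → S k = S₀ k

variable {e c enc} [DecidableEq K] [DecidableEq K₀]

/-- Within a statement the internal state is a parameter of the translation, not data: the program
branches on each popped symbol. Only `goto` writes the state down, next to the label, on `c`; `halt`
leaves `c` empty. -/
theorem runs_ofStmt (he : Function.Injective e) (hc : ∀ k, e k ≠ c) {S₀ : StackStore Γ}
    (q : Turing.TM2.Stmt (fun k => Γ (e k)) Λ σ) (v : σ) (S : StackStore Γ)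
    (T : StackStore fun k => Γ (e k)) (hS : ∀ k, S (e k) = T k) (hSc : S c = [])
    (hf : ∀ k, (∀ k₀, k ≠ e k₀) → k ≠ c → S k = S₀ k) :
    ∃ S', (ofStmt e c enc q v).Runs S S' (stmtCost q) ∧
      Represents e c enc S₀ S' (Turing.TM2.stepAux q v T) := by
  have upd : ∀ (S : StackStore Γ) (T : StackStore fun k => Γ (e k)) k (l : List (Γ (e k))),
      (∀ k, S (e k) = T k) → S c = [] → (∀ k, (∀ k₀, k ≠ e k₀) → k ≠ c → S k = S₀ k) →
      (∀ j, Function.update S (e k) l (e j) = Function.update T k l j) ∧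
      Function.update S (e k) l c = [] ∧
      (∀ j, (∀ k₀, j ≠ e k₀) → j ≠ c → Function.update S (e k) l j = S₀ j) := by
    intro S T k l h₁ h₂ h₃
    refine ⟨fun j => ?_, ?_, fun j hj hjc => ?_⟩
    · by_cases h : j = k
      · subst h
        simp
      · simp [h, he.ne h, h₁]
    · simp [(hc k).symm, h₂]
    · simp [hj k, h₃ j hj hjc]
  induction q generalizing v S T with
  | push k f q ih =>
    obtain ⟨h₁, h₂, h₃⟩ := upd S T k (f v :: S (e k)) hS hSc hf
    rw [hS k] at h₁
    obtain ⟨S', hr, hR⟩ := ih v _ _ h₁ (hS k ▸ h₂) (hS k ▸ h₃)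
    refine ⟨S', (runs_push _ _ _).seq (hS k ▸ hr), hR⟩
  | peek k f q ih =>
    obtain ⟨S', hr, hR⟩ := ih (f v (T k).head?) S T hS hSc hf
    refine ⟨S', Runs.pop ?_, hR⟩
    rw [hS k]
    rcases hT : T k with _ | ⟨a, l⟩
    · have : Function.update S (e k) [] = S := by rw [← hT, ← hS k, Function.update_eq_self]
      simp only [List.head?_nil, List.tail_nil, this]
      simp only [hT] at hr
      exact hr.mono (by omega)
    · simp only [List.head?_cons, List.tail_cons]
      simp only [hT] at hr
      refine (runs_push _ _ _).seq ?_
      have : Function.update (Function.update S (e k) l) (e k)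
          (a :: Function.update S (e k) l (e k)) = S := by
        rw [Function.update_idem, Function.update_self, ← hT, ← hS k, Function.update_eq_self]
      rw [this]
      exact hr
  | pop k f q ih =>
    obtain ⟨h₁, h₂, h₃⟩ := upd S T k (T k).tail hS hSc hf
    obtain ⟨S', hr, hR⟩ := ih (f v (T k).head?) _ _ h₁ h₂ h₃
    exact ⟨S', Runs.pop (by rw [hS k]; exact hr), hR⟩
  | load f q ih => exact ih (f v) S T hS hSc hf
  | branch f q₁ q₂ ih₁ ih₂ =>
    simp only [ofStmt, Turing.TM2.stepAux]
    cases f v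
    · obtain ⟨S', hr, hR⟩ := ih₂ v S T hS hSc hf
      exact ⟨S', hr.mono (Nat.le_add_left _ _), hR⟩
    · obtain ⟨S', hr, hR⟩ := ih₁ v S T hS hSc hf
      exact ⟨S', hr.mono (Nat.le_add_right _ _), hR⟩
  | goto l =>
    refine ⟨_, runs_push _ _ _, ?_, ?_, ?_⟩
    · intro k
      simp [hc k, hS]
    · simp [hSc]
    · intro k hk hkc
      simp [hkc, hf k hk hkc]
  | halt => exact ⟨S, runs_skip S, hS, by simpa using hSc, hf⟩

variable (e c enc)

/-- The execution of a `TM2` machine until it halts. -/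
def call (dec : Γ c → Λ × σ) (m : Λ → Turing.TM2.Stmt (fun k => Γ (e k)) Λ σ) (main : Λ)
    (init : σ) : StackProgram Γ :=
  (push c (enc (main, init))).seq (loop c fun s => ofStmt e c enc (m (dec s).1) (dec s).2)

variable {e c enc}

/-- One round of the loop performs one step of the machine, and the loop ends when `c` is empty,
that is, when the machine has halted. -/
theorem runs_call_loop (he : Function.Injective e) (hc : ∀ k, e k ≠ c) {dec : Γ c → Λ × σ}
    (hd : ∀ s, dec (enc s) = s) {m : Λ → Turing.TM2.Stmt (fun k => Γ (e k)) Λ σ} {A : ℕ}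
    (hA : ∀ l, stmtCost (m l) ≤ A) {S₀ : StackStore Γ} {t : ℕ} :
    ∀ {S : StackStore Γ} {C C' : Turing.TM2.Cfg (fun k => Γ (e k)) Λ σ}, C'.l = none →
    (flip bind (Turing.TM2.step m))^[t] (some C) = some C' → Represents e c enc S₀ S C →
    ∃ S', (loop c fun s => ofStmt e c enc (m (dec s).1) (dec s).2).Runs S S' ((A + 1) * t + 1) ∧
      Represents e c enc S₀ S' C' := by
  induction t with
  | zero =>
    intro S C C' hC' h hS
    cases h
    exact ⟨S, (runs_loop_nil (by rw [hS.ctrl, hC']; rfl)).mono (by omega), hS⟩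
  | succ t ih =>
    intro S C C' hC' h hS
    rw [Function.iterate_succ_apply] at h
    obtain ⟨_ | l, v, T⟩ := C
    -- A halted configuration has no successor, so further iteration could only give `none`, against
    -- `h`.
    · have : ∀ t, (flip bind (Turing.TM2.step m))^[t]
          (none : Option (Turing.TM2.Cfg (fun k => Γ (e k)) Λ σ)) = none := by
        intro t
        induction t with
        | zero => rfl
        | succ t ih => rw [Function.iterate_succ_apply]; exact ih
      have h' := (this t).symm.trans h
      cases h'
    · replace h : (flip bind (Turing.TM2.step m))^[t] (some (Turing.TM2.stepAux (m l) v T)) =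
        some C' := h
      obtain ⟨S₁, h₁, hR₁⟩ := runs_ofStmt (S₀ := S₀) (enc := enc) he hc (m l) v
        (Function.update S c []) T (fun k => by simp [hc k, hS.stk]) (by simp)
        (fun k hk hkc => by simp [hkc, hS.frame k hk hkc])
      obtain ⟨S', h₂, hR⟩ := ih hC' h hR₁
      refine ⟨S', (Runs.loop_cons (a := enc (l, v)) (l := []) (by simp [hS.ctrl])
        (by simpa only [hd] using h₁) h₂).mono ?_, hR⟩
      have := hA l
      rw [Nat.mul_succ]
      omega

/-- By convention a machine that halts with an output has emptied all its other stacks. The call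
therefore has a clean effect: input consumed, output written, everything else untouched. The two
extra steps are the initial push on `c` and the final test of the loop. -/
theorem runs_call (he : Function.Injective e) (hc : ∀ k, e k ≠ c) {dec : Γ c → Λ × σ}
    (hd : ∀ s, dec (enc s) = s) {m : Λ → Turing.TM2.Stmt (fun k => Γ (e k)) Λ σ} {A : ℕ}
    (hA : ∀ l, stmtCost (m l) ≤ A) {main : Λ} {init : σ} {k₀ k₁ : K₀} {u : List (Γ (e k₀))}
    {v : List (Γ (e k₁))} {t : ℕ}
    (h : (flip bind (Turing.TM2.step m))^[t] (some ⟨some main, init, singleStack k₀ u⟩) =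
      some ⟨none, init, singleStack k₁ v⟩) {S : StackStore Γ} (hS₀ : S (e k₀) = u)
    (hS : ∀ k, k ≠ k₀ → S (e k) = []) (hSc : S c = []) :
    (call e c enc dec m main init).Runs S
      (Function.update (Function.update S (e k₀) []) (e k₁) v) ((A + 1) * t + 2) := by
  obtain ⟨S', hr, hR⟩ := runs_call_loop (S₀ := S) he hc hd hA rfl h
    (S := Function.update S c [enc (main, init)])
    ⟨fun k => by
      by_cases hk : k = k₀
      · subst hk
        simp [hc, singleStack, hS₀]
      · simp [hc, singleStack, hk, hS], by simp, fun k _ hkc => by simp [hkc]⟩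
  have : S' = Function.update (Function.update S (e k₀) []) (e k₁) v := by
    funext k
    by_cases hk : ∃ j, k = e j
    · obtain ⟨j, rfl⟩ := hk
      rw [hR.stk]
      by_cases hj : j = k₁
      · subst hj
        simp [singleStack]
      · by_cases hj' : j = k₀
        · subst hj'
          simp [singleStack, hj, he.ne hj]
        · simp [singleStack, hj, hj', he.ne hj, he.ne hj', hS]
    · push Not at hk
      by_cases hkc : k = c
      · subst hkc
        rw [hR.ctrl]
        simp [hk, hSc]
      · rw [hR.frame k hk hkc]
        simp [hk]
  rw [← this]
  exact ((runs_push _ _ _).seq (by simpa only [hSc] using hr)).mono (by omega)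

end Call

end StackProgram

/-- A number that bounds the cost of every statement of a Turing machine. -/
def TuringMachine.stmtCost {A B : Type} (M : TuringMachine A B) : ℕ :=
  haveI := M.tm.ΛFin
  ∑ l, StackProgram.stmtCost (M.tm.m l)

theorem TuringMachine.le_stmtCost {A B : Type} (M : TuringMachine A B) (l : M.tm.Λ) :
    StackProgram.stmtCost (M.tm.m l) ≤ M.stmtCost := by
  exact Finset.single_le_sum (f := fun l => StackProgram.stmtCost (M.tm.m l))
    (fun _ _ => Nat.zero_le _) (@Finset.mem_univ _ M.tm.ΛFin l)

theorem TuringMachine.OutputsInTime.exists_iterate {A B : Type} {M : TuringMachine A B}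
    {u : List A} {v : List B} {t : ℕ} (h : M.OutputsInTime u v t) :
    ∃ t' ≤ t, (flip bind (Turing.TM2.step M.tm.m))^[t']
      (some ⟨some M.tm.main, M.tm.initialState, singleStack M.tm.k₀ (u.map M.inputAlphabet.symm)⟩) =
      some ⟨none, M.tm.initialState, singleStack M.tm.k₁ (v.map M.outputAlphabet.symm)⟩ := by
  obtain ⟨⟨⟨t', h⟩, ht'⟩⟩ := h
  refine ⟨t', ht', ?_⟩
  refine ((congrArg _ (congrArg some (Turing.initList_eq M.tm _))).symm.trans h).trans ?_
  exact congrArg some (Turing.haltList_eq M.tm _)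

/-! ### Moving symbols between stacks -/

section SingleStack

variable {K : Type} {Γ : K → Type} [DecidableEq K]

@[simp]
theorem singleStack_self (k : K) (l : List (Γ k)) : singleStack k l k = l := by
  simp [singleStack]

theorem singleStack_of_ne {k j : K} (l : List (Γ k)) (h : j ≠ k) : singleStack k l j = [] := by
  simp [singleStack, h]

@[simp]
theorem update_update_singleStack (k k' : K) (l : List (Γ k)) (l' : List (Γ k')) :
    Function.update (Function.update (singleStack k l) k []) k' l' = singleStack k' l' := by
  funext j
  by_cases h : j = k'
  · subst h
    simp
  · by_cases h' : j = k
    · subst h'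
      simp [h, singleStack_of_ne]
    · simp [h, h', singleStack_of_ne]

end SingleStack

namespace StackProgram

variable {K : Type} {Γ : K → Type}

/-- Push the symbols of a list one after the other. -/
def pushAll (k : K) : List (Γ k) → StackProgram Γ
  | [] => skip
  | a :: l => (push k a).seq (pushAll k l)

/-- Empty the stack `k` and push `f a` on `k'` for every symbol `a` met. -/
def transfer (k k' : K) (f : Γ k → List (Γ k')) : StackProgram Γ :=
  loop k fun a => pushAll k' (f a)

variable [DecidableEq K]

theorem runs_pushAll (k : K) (l : List (Γ k)) (S : StackStore Γ) :
    (pushAll k l).Runs S (Function.update S k (l.reverse ++ S k)) l.length := by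
  induction l generalizing S with
  | nil => simpa [pushAll] using runs_skip S
  | cons a l ih =>
    refine (((runs_push k a S).seq (ih _)).mono (by simp [Nat.add_comm])).of_eq ?_
    simp

theorem runs_transfer {k k' : K} (hk : k ≠ k') (f : Γ k → List (Γ k')) (S : StackStore Γ)
    (l : List (Γ k)) (hl : S k = l) :
    (transfer k k' f).Runs S
      (Function.update (Function.update S k []) k' ((l.flatMap f).reverse ++ S k'))
      (l.length + (l.flatMap f).length + 1) := by
  induction l generalizing S with
  | nil =>
    refine (runs_loop_nil hl).mono (by simp) |>.of_eq ?_
    simp only [List.flatMap_nil, List.reverse_nil, List.nil_append]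
    rw [← hl, Function.update_eq_self, Function.update_eq_self]
  | cons a l ih =>
    refine ((Runs.loop_cons hl (runs_pushAll k' (f a) _) (ih _ ?_)).mono ?_).of_eq ?_
    · simp [hk]
    · simp only [List.flatMap_cons, List.length_append, List.length_cons]
      omega
    · simp only [Function.update_self, Function.update_of_ne hk.symm, List.flatMap_cons,
        List.reverse_append, List.append_assoc]
      rw [Function.update_comm hk, Function.update_idem, Function.update_comm hk.symm,
        Function.update_idem]

end StackProgram

/-! ### Composition of Turing machines -/

namespace TuringMachine

variable {A B C : Type}

/-- The auxiliary stacks of a composed machine. -/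
inductive CompAux where
  | fstControl
  | sndControl
  | buffer
  deriving DecidableEq

instance : Fintype CompAux where
  elems := {.fstControl, .sndControl, .buffer}
  complete := by
    rintro (_ | _ | _) <;> decide

/-- The stacks of a composed machine. -/
abbrev CompStack (M : TuringMachine A B) (N : TuringMachine B C) : Type :=
  M.tm.K ⊕ (N.tm.K ⊕ CompAux)

/-- The stack alphabets of a composed machine. -/
abbrev compAlphabet (M : TuringMachine A B) (N : TuringMachine B C) : CompStack M N → Type :=
  Sum.elim M.tm.Γ (Sum.elim N.tm.Γ fun
    | .fstControl => M.tm.Λ × M.tm.σ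
    | .sndControl => N.tm.Λ × N.tm.σ
    | .buffer => B)

instance finite_compAlphabet (M : TuringMachine A B) (N : TuringMachine B C) :
    ∀ k, Finite (compAlphabet M N k) := by
  have := M.tm.ΛFin
  have := M.tm.σFin
  have := N.tm.ΛFin
  have := N.tm.σFin
  rintro (k | k | _ | _ | _)
  · exact M.finite_alphabet k
  · exact N.finite_alphabet k
  · exact inferInstanceAs (Finite (M.tm.Λ × M.tm.σ))
  · exact inferInstanceAs (Finite (N.tm.Λ × N.tm.σ))
  · have := M.finite_alphabet M.tm.k₁
    exact Finite.of_equiv _ M.outputAlphabet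

instance (M : TuringMachine A B) : Fintype M.tm.K := M.tm.kFin

/-- The program that runs `M`, and then `N` on the output. -/
def compProgram (M : TuringMachine A B) (N : TuringMachine B C) :
    StackProgram (compAlphabet M N) :=
  (StackProgram.call (K₀ := M.tm.K) Sum.inl (.inr (.inr .fstControl)) id id M.tm.m M.tm.main
      M.tm.initialState).seq <|
    (StackProgram.transfer (.inl M.tm.k₁) (.inr (.inr .buffer)) fun a => [M.outputAlphabet a]).seq <|
    (StackProgram.transfer (.inr (.inr .buffer)) (.inr (.inl N.tm.k₀))
      fun a => [N.inputAlphabet.symm a]).seq <|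
    StackProgram.call (K₀ := N.tm.K) (fun k => Sum.inr (.inl k)) (.inr (.inr .sndControl)) id id
      N.tm.m N.tm.main N.tm.initialState

/-- The machine that runs `M`, and then `N` on the output. -/
noncomputable def comp (M : TuringMachine A B) (N : TuringMachine B C) : TuringMachine A C :=
  (compProgram M N).toMachine (.inl M.tm.k₀) (.inr (.inl N.tm.k₁)) M.inputAlphabet N.outputAlphabet

theorem OutputsInTime.mono {M : TuringMachine A B} {u : List A} {v : List B} {t t' : ℕ}
    (h : M.OutputsInTime u v t) (htt' : t ≤ t') : M.OutputsInTime u v t' := by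
  obtain ⟨⟨h, ht⟩⟩ := h
  exact ⟨⟨h, ht.trans htt'⟩⟩

/-- Moving a stack reverses it, so the intermediate string passes through a buffer and is moved
twice. Each move takes `2|v| + 1` steps; the calls add 2 each and the final halt 1. -/
theorem OutputsInTime.comp {M : TuringMachine A B} {N : TuringMachine B C} {u : List A}
    {v : List B} {w : List C} {t₁ t₂ : ℕ} (h₁ : M.OutputsInTime u v t₁)
    (h₂ : N.OutputsInTime v w t₂) :
    (M.comp N).OutputsInTime u w
      ((M.stmtCost + 1) * t₁ + (N.stmtCost + 1) * t₂ + 4 * v.length + 7) := by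
  obtain ⟨s₁, hs₁, i₁⟩ := h₁.exists_iterate
  obtain ⟨s₂, hs₂, i₂⟩ := h₂.exists_iterate
  have e₂ : (List.flatMap (fun a => [M.outputAlphabet a])
      (v.map M.outputAlphabet.symm)).reverse ++ [] = v.reverse := by
    simp [← List.map_eq_flatMap, Function.comp_def]
  have e₃ : (List.flatMap (fun a => [N.inputAlphabet.symm a]) v.reverse).reverse ++ [] =
      v.map N.inputAlphabet.symm := by
    simp [← List.map_eq_flatMap, List.map_reverse]
  have l₂ : (List.flatMap (fun a => [M.outputAlphabet a])
      (v.map M.outputAlphabet.symm)).length = v.length := by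
    simp [← List.map_eq_flatMap]
  have l₃ : (List.flatMap (fun a => [N.inputAlphabet.symm a]) v.reverse).length = v.length := by
    simp
  have r₁ := (StackProgram.runs_call (Γ := compAlphabet M N) (K₀ := M.tm.K) (e := Sum.inl)
    (c := .inr (.inr .fstControl)) (enc := id) (dec := id) Sum.inl_injective (by simp)
    (fun _ => rfl) (fun l => M.le_stmtCost l) i₁
    (S := singleStack (.inl M.tm.k₀) (u.map M.inputAlphabet.symm)) (singleStack_self _ _)
    (fun k hk => singleStack_of_ne _ (by simpa using hk)) (singleStack_of_ne _ (by simp))).of_eq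
    (update_update_singleStack (Γ := compAlphabet M N) _ (.inl M.tm.k₁) _ _)
  have r₂ := (StackProgram.runs_transfer (Γ := compAlphabet M N) (k := .inl M.tm.k₁)
    (k' := .inr (.inr .buffer)) (by simp) (fun a => [M.outputAlphabet a])
    (singleStack (.inl M.tm.k₁) (v.map M.outputAlphabet.symm)) _ (singleStack_self _ _)).of_eq
    ((update_update_singleStack _ _ _ _).trans (congrArg _ e₂)) |>.mono
    (u := v.length + v.length + 1) (le_of_eq (congrArg₂ (fun a b => a + b + 1) (List.length_map _) l₂))
  have r₃ := (StackProgram.runs_transfer (Γ := compAlphabet M N) (k := .inr (.inr .buffer))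
    (k' := .inr (.inl N.tm.k₀)) (by simp) (fun a => [N.inputAlphabet.symm a])
    (singleStack (.inr (.inr .buffer)) v.reverse) _ (singleStack_self _ _)).of_eq
    ((update_update_singleStack _ _ _ _).trans (congrArg _ e₃)) |>.mono
    (u := v.length + v.length + 1) 
    (le_of_eq (congrArg₂ (fun a b => a + b + 1) List.length_reverse l₃))
  have r₄ := (StackProgram.runs_call (Γ := compAlphabet M N) (K₀ := N.tm.K)
    (e := fun k => Sum.inr (.inl k))
    (c := .inr (.inr .sndControl)) (enc := id) (dec := id)
    (fun a b h => by simpa using h) (by simp)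
    (fun _ => rfl) (fun l => N.le_stmtCost l) i₂
    (S := singleStack (.inr (.inl N.tm.k₀)) (v.map N.inputAlphabet.symm)) (singleStack_self _ _)
    (fun k hk => singleStack_of_ne _ (by simpa using hk)) (singleStack_of_ne _ (by simp))).of_eq
    (update_update_singleStack (Γ := compAlphabet M N) _ (.inr (.inl N.tm.k₁)) _ _)
  refine (StackProgram.Runs.outputsInTime (r₁.seq (r₂.seq (r₃.seq r₄)))).mono ?_
  have m₁ := Nat.mul_le_mul_left (M.stmtCost + 1) hs₁
  have m₂ := Nat.mul_le_mul_left (N.stmtCost + 1) hs₂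
  omega

end TuringMachine

/-! ### Nested-loop transducers -/

namespace StackProgram

variable {K : Type} {Γ : K → Type} {ι : Type}

/-- Run the programs `p i` one after the other. -/
def seqAll (p : ι → StackProgram Γ) : List ι → StackProgram Γ
  | [] => skip
  | i :: l => (p i).seq (seqAll p l)

/-- This treats a family of stacks of variable size: each program changes only its own component, so
the changes take place independently. -/
theorem runs_seqAll [DecidableEq K] [DecidableEq ι] {α : Type} (st : (ι → α) → StackStore Γ)
    (p : ι → StackProgram Γ) (f : α → α) (P : α → Prop) (T : ℕ)
    (h : ∀ i x, P (x i) → (p i).Runs (st x) (st (Function.update x i (f (x i)))) T) (l : List ι)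
    (hl : l.Nodup) (x : ι → α) (hx : ∀ i, P (x i)) :
    (seqAll p l).Runs (st x) (st fun i => if i ∈ l then f (x i) else x i) (l.length * T) := by
  suffices ∀ x : ι → α, (∀ i ∈ l, P (x i)) →
      (seqAll p l).Runs (st x) (st fun i => if i ∈ l then f (x i) else x i) (l.length * T) from
    this x fun i _ => hx i
  clear hx x
  induction l with
  | nil =>
    intro x _
    simpa [seqAll] using runs_skip (st x)
  | cons i l ih =>
    intro x hx
    rw [List.nodup_cons] at hl
    refine (((h i x (hx i (by simp))).seq (ih hl.2 (Function.update x i (f (x i)))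
      fun j hj => ?_)).mono ?_).of_eq ?_
    · rw [Function.update_of_ne (by rintro rfl; exact hl.1 hj)]
      exact hx j (by simp [hj])
    · rw [List.length_cons, Nat.add_mul]
      omega
    · congr 1
      funext j
      by_cases hj : j = i
      · subst hj
        simp [hl.1]
      · simp [hj]

theorem runs_clear [DecidableEq K] (k : K) (S : StackStore Γ) (l : List (Γ k)) (hl : S k = l) :
    (loop k fun _ => skip).Runs S (Function.update S k []) (l.length + 1) := by
  induction l generalizing S with
  | nil =>
    refine ((runs_loop_nil hl).mono (by simp)).of_eq ?_
    rw [← hl, Function.update_eq_self]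
  | cons a l ih =>
    refine ((Runs.loop_cons hl (runs_skip _) (ih _ (by simp))).mono ?_).of_eq (by simp)
    simp

end StackProgram

/-- Expressions for string functions: the source string may be scanned in nested loops. -/
inductive LoopExpr (A B : Type) where
  | nil
  | sym (b : B)
  | append (g h : LoopExpr A B)
  | forEach (f : A → LoopExpr A B)

namespace LoopExpr

variable {A B : Type}

/-- The string that an expression denotes for the source `s`. -/
def out (s : List A) : LoopExpr A B → List B
  | nil => []
  | sym b => [b]
  | append g h => g.out s ++ h.out s
  | forEach f => s.flatMap fun a => (f a).out s

/-- The nesting depth of the loops. -/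
def depth [Fintype A] : LoopExpr A B → ℕ
  | nil => 0
  | sym _ => 0
  | append g h => max g.depth h.depth
  | forEach f => Finset.univ.sup (fun a => (f a).depth) + 1

/-- A bound for the time to produce the output on sources of length `m`. -/
def cost [Fintype A] (m : ℕ) : LoopExpr A B → ℕ
  | nil => 0
  | sym _ => 1
  | append g h => g.cost m + h.cost m
  | forEach f => m * (∑ a, (f a).cost m + 2) + 1 + (m + m + 1)

theorem length_out_le_cost [Fintype A] (s : List A) (g : LoopExpr A B) :
    (g.out s).length ≤ g.cost s.length := by
  induction g with
  | nil => simp [out]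
  | sym b => simp [out, cost]
  | append g h ihg ihh => simp only [out, cost, List.length_append]; omega
  | forEach f ih =>
    have : ∀ l : List A, (l.flatMap fun a => (f a).out s).length ≤
        l.length * (∑ a, (f a).cost s.length + 2) := by
      intro l
      induction l with
      | nil => simp
      | cons a l ihl =>
        have := (ih a).trans (Finset.single_le_sum (f := fun a => (f a).cost s.length)
          (fun _ _ => Nat.zero_le _) (Finset.mem_univ a))
        simp only [List.flatMap_cons, List.length_append, List.length_cons, Nat.add_mul]
        omega
    simp only [out, cost]
    have := this s
    omega

/-- A fixed expression has bounded nesting, and each loop contributes one factor `m`. Sums over the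
alphabet stand in for maxima, both in the coefficients and in the exponents. -/
theorem exists_cost_le [Fintype A] (g : LoopExpr A B) :
    ∃ C d : ℕ, ∀ m, g.cost m ≤ C * (m + 1) ^ d := by
  induction g with
  | nil => exact ⟨0, 0, by simp [cost]⟩
  | sym b => exact ⟨1, 0, by simp [cost]⟩
  | append g h ihg ihh =>
    obtain ⟨C₁, d₁, h₁⟩ := ihg
    obtain ⟨C₂, d₂, h₂⟩ := ihh
    refine ⟨C₁ + C₂, d₁ + d₂, fun m => ?_⟩
    have e₁ : (m + 1) ^ d₁ ≤ (m + 1) ^ (d₁ + d₂) := Nat.pow_le_pow_right (by omega) (by omega)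
    have e₂ : (m + 1) ^ d₂ ≤ (m + 1) ^ (d₁ + d₂) := Nat.pow_le_pow_right (by omega) (by omega)
    calc g.cost m + h.cost m ≤ C₁ * (m + 1) ^ d₁ + C₂ * (m + 1) ^ d₂ := add_le_add (h₁ m) (h₂ m)
      _ ≤ C₁ * (m + 1) ^ (d₁ + d₂) + C₂ * (m + 1) ^ (d₁ + d₂) := by gcongr
      _ = _ := by ring
  | forEach f ih =>
    choose C d h using ih
    refine ⟨∑ a, C a + 6, ∑ a, d a + 1, fun m => ?_⟩
    have key : ∑ a, (f a).cost m ≤ (∑ a, C a) * (m + 1) ^ (∑ a, d a) := by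
      rw [Finset.sum_mul]
      refine Finset.sum_le_sum fun a _ => (h a m).trans ?_
      gcongr
      · omega
      · exact Finset.single_le_sum (f := d) (fun _ _ => Nat.zero_le _) (Finset.mem_univ a)
    have hp : 1 ≤ (m + 1) ^ (∑ a, d a) := Nat.one_le_pow _ _ (by omega)
    calc (forEach f).cost m = m * (∑ a, (f a).cost m + 2) + 1 + (m + m + 1) := rfl
      _ ≤ m * ((∑ a, C a) * (m + 1) ^ (∑ a, d a) + 2) + 1 + (m + m + 1) := by gcongr
      _ ≤ (∑ a, C a + 6) * ((m + 1) ^ (∑ a, d a) * (m + 1)) := by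
        nlinarith [Nat.zero_le ((∑ a, C a) * (m + 1) ^ (∑ a, d a)), Nat.mul_le_mul_right m hp]
      _ = _ := by rw [pow_succ]

/-- The stacks of the machine that evaluates an expression. -/
inductive EvalStack (N : ℕ) where
  | input
  | buffer
  | output
  | copy (i : Fin (N + 1))
  | spare (i : Fin (N + 1))
  deriving DecidableEq

instance (N : ℕ) : Finite (EvalStack N) := by
  refine Finite.of_injective (β := Fin 5 × Fin (N + 1)) (fun
    | .input => (0, 0)
    | .buffer => (1, 0)
    | .output => (2, 0)
    | .copy i => (3, i)
    | .spare i => (4, i)) ?_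
  rintro (_ | _ | _ | i | i) (_ | _ | _ | j | j) h <;> simp_all

noncomputable instance (N : ℕ) : Fintype (EvalStack N) := Fintype.ofFinite _

/-- The alphabets of the machine that evaluates an expression. -/
abbrev EvalStack.Symbol (A B : Type) {N : ℕ} : EvalStack N → Type
  | buffer => B
  | output => B
  | _ => A

instance [Finite A] [Finite B] {N : ℕ} (k : EvalStack N) : Finite (k.Symbol A B) := by
  cases k <;> simp only [EvalStack.Symbol] <;> infer_instance

open StackProgram EvalStack

variable {N : ℕ}

/-- The stacks of the machine that evaluates an expression, listed. -/
def evalStore (inp : List A) (buf outp : List B) (x : Fin (N + 1) → List A × List A) :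
    StackStore (Symbol A B (N := N))
  | input => inp
  | buffer => buf
  | output => outp
  | copy i => (x i).1
  | spare i => (x i).2

section Update

variable (inp : List A) (buf outp : List B) (x : Fin (N + 1) → List A × List A)

theorem update_evalStore_input (l : List A) :
    Function.update (evalStore inp buf outp x) input l = evalStore l buf outp x := by
  funext k
  cases k <;> simp [evalStore]

theorem update_evalStore_buffer (l : List B) :
    Function.update (evalStore inp buf outp x) buffer l = evalStore inp l outp x := by
  funext k
  cases k <;> simp [evalStore]

theorem update_evalStore_output (l : List B) :
    Function.update (evalStore inp buf outp x) output l = evalStore inp buf l x := by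
  funext k
  cases k <;> simp [evalStore]

theorem update_evalStore_copy (i : Fin (N + 1)) (l : List A) :
    Function.update (evalStore inp buf outp x) (copy i) l =
      evalStore inp buf outp (Function.update x i (l, (x i).2)) := by
  funext k
  rcases k with _ | _ | _ | j | j
  iterate 3 simp [evalStore]
  all_goals
    by_cases h : j = i
    · subst h
      simp [evalStore]
    · simp [evalStore, h]

theorem update_evalStore_spare (i : Fin (N + 1)) (l : List A) :
    Function.update (evalStore inp buf outp x) (spare i) l =
      evalStore inp buf outp (Function.update x i ((x i).1, l)) := by
  funext k
  rcases k with _ | _ | _ | j | j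
  iterate 3 simp [evalStore]
  all_goals
    by_cases h : j = i
    · subst h
      simp [evalStore]
    · simp [evalStore, h]

end Update

/-- The program that pushes the value of an expression on the stack `buffer`, the loops being
controlled by the copies of the source from number `i` on. -/
def program (N : ℕ) : ℕ → LoopExpr A B → StackProgram (Symbol A B (N := N))
  | _, nil => skip
  | _, sym b => push buffer b
  | i, append g h => (program N i g).seq (program N i h)
  | i, forEach f =>
    (loop (copy (Fin.ofNat (N + 1) i)) fun a =>
      (push (spare (Fin.ofNat (N + 1) i)) a).seq (program N (i + 1) (f a))).seq
    (transfer (spare (Fin.ofNat (N + 1) i)) (copy (Fin.ofNat (N + 1) i)) fun a => [a])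

/-- A loop at level `i` consumes copy `i` of the source, saves the symbols on spare stack `i`, and
restores the copy at the end. The loops inside it use only copies beyond `i`, so it does not matter
that copy `i` is incomplete meanwhile. -/
theorem runs_program [Fintype A] (s inp : List A) (outp : List B) (g : LoopExpr A B) (i : ℕ)
    (hi : i + g.depth ≤ N + 1) (x : Fin (N + 1) → List A × List A)
    (hx : ∀ j : Fin (N + 1), i ≤ j → x j = (s, [])) (buf : List B) :
    (program N i g).Runs (evalStore inp buf outp x)
      (evalStore inp ((g.out s).reverse ++ buf) outp x) (g.cost s.length) := by
  induction g generalizing i x buf with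
  | nil => exact runs_skip _
  | sym b =>
    exact (runs_push _ _ _).of_eq (update_evalStore_buffer _ _ _ _ _)
  | append g h ihg ihh =>
    simp only [depth] at hi
    refine ((ihg i (by omega) x hx buf).seq (ihh i (by omega) x hx _)).of_eq ?_
    simp [out]
  | forEach f ih =>
    simp only [depth] at hi
    set c := Fin.ofNat (N + 1) i with hc
    have hcv : (c : ℕ) = i := by
      simp [hc, Nat.mod_eq_of_lt (show i < N + 1 by omega)]
    have hloop : ∀ (l r : List A) (buf : List B),
        (loop (copy c) fun a => (push (spare c) a).seq (program N (i + 1) (f a))).Runs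
          (evalStore inp buf outp (Function.update x c (l, r)))
          (evalStore inp ((l.flatMap fun a => (f a).out s).reverse ++ buf) outp
            (Function.update x c ([], l.reverse ++ r)))
          (l.length * (∑ a, (f a).cost s.length + 2) + 1) := by
      intro l
      induction l with
      | nil =>
        intro r buf
        exact (runs_loop_nil (by simp [evalStore])).mono (by simp)
      | cons a l ihl =>
        intro r buf
        have hd : (f a).depth ≤ Finset.univ.sup fun a => (f a).depth :=
          Finset.le_sup (f := fun a => (f a).depth) (Finset.mem_univ a)
        have hcost : (f a).cost s.length ≤ ∑ a, (f a).cost s.length :=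
          Finset.single_le_sum (f := fun a => (f a).cost s.length)
            (fun _ _ => Nat.zero_le _) (Finset.mem_univ a)
        have h₁ := runs_push (spare c) a (evalStore (N := N) inp buf outp
          (Function.update x c (l, r)))
        rw [update_evalStore_spare] at h₁
        simp only [evalStore, Function.update_self, Function.update_idem] at h₁
        have h₂ := ih a (i + 1) (by omega) (Function.update x c (l, a :: r)) (fun j hj => by
          rw [Function.update_of_ne, hx j (by omega)]
          rintro rfl
          omega) buf
        have hb : ((push (spare c) a).seq (program N (i + 1) (f a))).Runs
            (Function.update (evalStore inp buf outp (Function.update x c (a :: l, r))) (copy c) l)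
            (evalStore inp ((out s (f a)).reverse ++ buf) outp (Function.update x c (l, a :: r)))
            (1 + (f a).cost s.length) := by
          rw [update_evalStore_copy]
          simp only [Function.update_self, Function.update_idem]
          exact h₁.seq h₂
        refine ((Runs.loop_cons (a := a) (l := l) (by simp [evalStore]) hb
          (ihl (a :: r) _)).mono ?_).of_eq ?_
        · simp only [List.length_cons, Nat.add_mul]
          omega
        · simp
    have h₁ := hloop s [] buf
    have h₂ := runs_transfer (k := spare c) (k' := copy c) (by simp) (fun a => [a])
      (evalStore inp ((s.flatMap fun a => (f a).out s).reverse ++ buf) outp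
            (Function.update x c ([], s.reverse ++ []))) s.reverse (by simp [evalStore])
    rw [update_evalStore_spare, update_evalStore_copy] at h₂
    have hxc : x c = (s, []) := hx c (by omega)
    rw [← hxc, Function.update_eq_self] at h₁
    refine ((h₁.seq h₂).mono ?_).of_eq ?_
    · simp only [cost, ← List.map_eq_flatMap, List.length_map, List.length_reverse]
      omega
    · simp [out, evalStore]
      rw [← hxc, Function.update_eq_self]

/-- The program that evaluates an expression. -/
def mainProgram (N : ℕ) (g : LoopExpr A B) : StackProgram (Symbol A B (N := N)) :=
  (loop input fun a => seqAll (fun i => push (spare i) a) (List.finRange (N + 1))).seq <|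
  (seqAll (fun i => transfer (spare i) (copy i) fun a => [a]) (List.finRange (N + 1))).seq <|
  (program N 0 g).seq <|
  (seqAll (fun i => loop (copy i) fun _ => skip) (List.finRange (N + 1))).seq <|
  transfer buffer output fun b => [b]

/-- The source arrives reversed on every spare stack; the transfers to the copies, which come next
in `mainProgram`, turn it round. -/
theorem runs_distribute (s r : List A) (buf outp : List B) :
    (loop input fun a => seqAll (fun i => push (spare i) a) (List.finRange (N + 1))).Runs
      (evalStore (N := N) s buf outp fun _ => ([], r))
      (evalStore [] buf outp fun _ => ([], s.reverse ++ r)) (s.length * (N + 2) + 1) := by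
  induction s generalizing r with
  | nil => exact (runs_loop_nil rfl).mono (by simp)
  | cons a s ih =>
    have h := runs_seqAll (evalStore (N := N) s buf outp) (fun i => push (spare i) a)
      (fun p => (p.1, a :: p.2)) (fun _ => True) 1 (fun i x _ => by
        have := runs_push (spare i) a (evalStore (N := N) s buf outp x)
        rw [update_evalStore_spare] at this
        exact this) (List.finRange (N + 1)) (List.nodup_finRange _) (fun _ => ([], r))
        (fun _ => trivial)
    simp only [List.mem_finRange, if_true, List.length_finRange] at h
    rw [← update_evalStore_input (a :: s) buf outp (fun _ => ([], r)) s] at h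
    refine ((Runs.loop_cons (a := a) (l := s) rfl h (ih (a :: r))).mono ?_).of_eq ?_
    · simp only [List.length_cons, Nat.add_mul]
      omega
    · simp

theorem runs_mainProgram [Fintype A] (g : LoopExpr A B) (s : List A) :
    (mainProgram g.depth g).Runs (singleStack input s) (singleStack output (g.out s))
      ((g.depth + 10) * (s.length + 1) * 4 + 4 * g.cost s.length) := by
  have e₀ : singleStack (Γ := Symbol A B (N := g.depth)) input s =
      evalStore s [] [] fun _ => ([], []) := by
    funext k
    cases k <;> rfl
  have e₁ : singleStack (Γ := Symbol A B (N := g.depth)) output (g.out s) =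
      evalStore [] [] (g.out s) fun _ => ([], []) := by
    funext k
    cases k <;> rfl
  have r₁ := runs_distribute (N := g.depth) s [] ([] : List B) []
  have r₂ := runs_seqAll (evalStore (N := g.depth) [] ([] : List B) [])
    (fun i => transfer (spare i) (copy i) fun a => [a]) (fun _ => (s, []))
    (fun p => p = ([], s.reverse ++ [])) (s.length + s.length + 1) (fun i x hx => by
      have := runs_transfer (k := spare i) (k' := copy i) (by simp) (fun a => [a])
        (evalStore (N := g.depth) [] ([] : List B) [] x) s.reverse (by simp [evalStore, hx])
      rw [update_evalStore_spare, update_evalStore_copy] at this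
      simpa [evalStore, hx] using this) (List.finRange (g.depth + 1)) (List.nodup_finRange _)
      (fun _ => ([], s.reverse ++ [])) (fun _ => rfl)
  have r₃ := runs_program (N := g.depth) s [] [] g 0 (by omega) (fun _ => (s, [])) (fun _ _ => rfl) []
  have r₄ := runs_seqAll (evalStore (N := g.depth) [] ((g.out s).reverse ++ []) [])
    (fun i => loop (copy i) fun _ => skip) (fun _ => ([], []))
    (fun p => p = (s, [])) (s.length + 1) (fun i x hx => by
      have := runs_clear (copy i)
        (evalStore (N := g.depth) [] ((g.out s).reverse ++ []) [] x) s (by simp [evalStore, hx])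
      rw [update_evalStore_copy] at this
      simpa [hx] using this) (List.finRange (g.depth + 1)) (List.nodup_finRange _)
      (fun _ => (s, [])) (fun _ => rfl)
  have r₅ := runs_transfer (k := buffer) (k' := output) (by simp) (fun b => [b])
    (evalStore (N := g.depth) ([] : List A) ((g.out s).reverse ++ []) [] fun _ => ([], []))
    (g.out s).reverse (by simp [evalStore])
  rw [update_evalStore_buffer, update_evalStore_output] at r₅
  simp only [List.mem_finRange, if_true, List.length_finRange] at r₂ r₄
  rw [e₀, e₁]
  refine ((r₁.seq (r₂.seq (r₃.seq (r₄.seq r₅)))).mono ?_).of_eq ?_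
  · have := g.length_out_le_cost s
    simp only [← List.map_eq_flatMap, List.length_map, List.length_reverse]
    nlinarith
  · simp [evalStore]

/-- The Turing machine that evaluates an expression. -/
noncomputable def machine [Fintype A] [Finite B] (g : LoopExpr A B) : TuringMachine A B :=
  (mainProgram g.depth g).toMachine input output (Equiv.refl A) (Equiv.refl B)

theorem exists_machine [Fintype A] [Finite B] (g : LoopExpr A B) :
    ∃ (M : TuringMachine A B) (C d : ℕ), ∀ s : List A, (g.out s).length ≤ C * (s.length + 1) ^ d ∧
      M.OutputsInTime s (g.out s) (C * (s.length + 1) ^ d) := by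
  obtain ⟨C, d, h⟩ := g.exists_cost_le
  refine ⟨g.machine, 4 * C + 4 * (g.depth + 10) + 1, d + 1, fun s => ?_⟩
  have hp : 1 ≤ (s.length + 1) ^ d := Nat.one_le_pow _ _ (by omega)
  have hs := h s.length
  have ho := g.length_out_le_cost s
  have hC : C * (s.length + 1) ^ d ≤ C * (s.length + 1) ^ (d + 1) := by
    gcongr <;> omega
  have h1 : s.length + 1 ≤ (s.length + 1) ^ (d + 1) := by
    rw [pow_succ]
    exact Nat.le_mul_of_pos_left _ hp
  have h2 := Nat.mul_le_mul_left (g.depth + 10) h1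
  have h3 : 1 ≤ (s.length + 1) ^ (d + 1) := Nat.one_le_pow _ _ (by omega)
  have hr := StackProgram.Runs.outputsInTime (p := mainProgram g.depth g) (k₀ := input)
    (k₁ := output) (i := Equiv.refl A) (o := Equiv.refl B) (u := s) (v := g.out s)
    (by simpa using g.runs_mainProgram s)
  refine ⟨?_, hr.mono ?_⟩
  · rw [add_mul, add_mul]
    nlinarith
  · rw [add_mul, add_mul]
    nlinarith

end LoopExpr

/-! ### Roots in unary -/

namespace UnaryRoot

/-- The stacks of the machine that computes a root of the input length. -/
inductive Stack where
  | input
  | bits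
  | count
  | spareCount
  | root
  | spareRoot
  | output
  deriving DecidableEq

instance : Finite Stack := by
  refine Finite.of_injective (β := Fin 7) (fun
    | .input => 0 | .bits => 1 | .count => 2 | .spareCount => 3 | .root => 4 | .spareRoot => 5
    | .output => 6) ?_
  rintro (_ | _ | _ | _ | _ | _ | _) (_ | _ | _ | _ | _ | _ | _) h <;> simp_all

noncomputable instance : Fintype Stack := Fintype.ofFinite _

/-- The alphabets of the machine that computes a root of the input length. -/
abbrev Stack.Symbol : Stack → Type
  | input => Bool
  | bits => Bool
  | output => Option Bool
  | _ => Unit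

instance (k : Stack) : Finite k.Symbol := by
  cases k <;> simp only [Stack.Symbol] <;> infer_instance

open StackProgram Stack

/-- The stacks of the machine that computes a root of the input length, listed. -/
def store (inp bts : List Bool) (m m' n n' : ℕ) (outp : List (Option Bool)) : StackStore Symbol
  | input => inp
  | bits => bts
  | count => List.replicate m ()
  | spareCount => List.replicate m' ()
  | root => List.replicate n ()
  | spareRoot => List.replicate n' ()
  | output => outp

section Update

variable (inp bts : List Bool) (m m' n n' : ℕ) (outp : List (Option Bool))

theorem update_store_input (l : List Bool) :
    Function.update (store inp bts m m' n n' outp) input l = store l bts m m' n n' outp := by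
  funext k
  cases k <;> simp [store]

theorem update_store_bits (l : List Bool) :
    Function.update (store inp bts m m' n n' outp) bits l = store inp l m m' n n' outp := by
  funext k
  cases k <;> simp [store]

theorem update_store_count (l : List Unit) :
    Function.update (store inp bts m m' n n' outp) count l =
      store inp bts l.length m' n n' outp := by
  funext k
  cases k <;> simp [store, List.eq_replicate_iff]

theorem update_store_spareCount (l : List Unit) :
    Function.update (store inp bts m m' n n' outp) spareCount l =
      store inp bts m l.length n n' outp := by
  funext k
  cases k <;> simp [store, List.eq_replicate_iff]

theorem update_store_root (l : List Unit) :
    Function.update (store inp bts m m' n n' outp) root l =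
      store inp bts m m' l.length n' outp := by
  funext k
  cases k <;> simp [store, List.eq_replicate_iff]

theorem update_store_spareRoot (l : List Unit) :
    Function.update (store inp bts m m' n n' outp) spareRoot l =
      store inp bts m m' n l.length outp := by
  funext k
  cases k <;> simp [store, List.eq_replicate_iff]

theorem update_store_output (l : List (Option Bool)) :
    Function.update (store inp bts m m' n n' outp) output l = store inp bts m m' n n' l := by
  funext k
  cases k <;> simp [store]

end Update

/-- Remove `j` symbols from `count`. -/
def dropCount : ℕ → StackProgram Symbol
  | 0 => skip
  | j + 1 => pop count fun _ => dropCount j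

/-- Divide `count` by `κ`, rounding up. -/
def divide (κ : ℕ) : StackProgram Symbol :=
  (loop count fun _ => (dropCount (κ - 1)).seq (push spareCount ())).seq
    (transfer spareCount count fun a => [a])

/-- Double `root`. -/
def double : StackProgram Symbol :=
  (transfer root spareRoot fun a => [a, a]).seq (transfer spareRoot root fun a => [a])

/-- The program that computes a root of the input length. -/
def program (κ b : ℕ) : StackProgram Symbol :=
  (loop input fun a => (push bits a).seq (push count ())).seq <|
  (push root ()).seq <|
  (loop count fun _ => (divide κ).seq double).seq <|
  (pushAll root (List.replicate b ())).seq <|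
  (transfer bits output fun a => [some a]).seq <|
  transfer root output fun _ => [none]

variable (bts : List Bool) (m n : ℕ)

theorem runs_dropCount (j m' : ℕ) :
    (dropCount j).Runs (store [] bts m m' n 0 []) (store [] bts (m - j) m' n 0 []) j := by
  induction j generalizing m with
  | zero => exact runs_skip _
  | succ j ih =>
    refine Runs.pop ?_
    rw [update_store_count, Nat.add_comm j, ← Nat.sub_sub]
    simpa [store] using ih (m - 1)

/-- A round removes `κ` symbols, one by the loop test and `κ - 1` by `dropCount`. Popping an empty
stack is harmless, so an incomplete last group still counts, which rounds the quotient up. -/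
theorem runs_divide_loop (κ m' : ℕ) (hκ : 1 ≤ κ) :
    (loop count fun _ => (dropCount (κ - 1)).seq (push spareCount ())).Runs
      (store [] bts m m' n 0 []) (store [] bts 0 (m' + (m + κ - 1) / κ) n 0 [])
      (m * (κ + 1) + 1) := by
  induction m using Nat.strong_induction_on generalizing m' with
  | _ m ih =>
    rcases m with _ | m
    · refine ((runs_loop_nil rfl).mono (by simp)).of_eq ?_
      rw [Nat.div_eq_of_lt (by omega)]
      rfl
    · have h₁ := (runs_dropCount bts m n (κ - 1) m').seq (runs_push spareCount () _)
      rw [update_store_spareCount] at h₁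
      have h₂ := ih (m - (κ - 1)) (by omega) (m' + 1)
      refine ((Runs.loop_cons (a := ()) (l := List.replicate m ()) rfl
        (S₁ := store [] bts (m - (κ - 1)) (m' + 1) n 0 []) (t₁ := κ - 1 + 1) ?_ h₂).mono ?_).of_eq ?_
      · rw [update_store_count]
        simpa [store] using h₁
      · have := Nat.mul_le_mul_right (κ + 1) (Nat.sub_le m (κ - 1))
        rw [Nat.add_mul]
        omega
      · congr 1
        by_cases hm : κ - 1 ≤ m
        · rw [show m + 1 + κ - 1 = m + κ by omega, Nat.add_div_right _ (by omega),
            show m - (κ - 1) + κ - 1 = m by omega]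
          omega
        · rw [Nat.div_eq_of_lt (by omega), show m + 1 + κ - 1 = m + κ by omega,
            Nat.add_div_right _ (by omega), Nat.div_eq_of_lt (by omega)]

theorem runs_divide (κ : ℕ) (hκ : 1 ≤ κ) :
    (divide κ).Runs (store [] bts m 0 n 0 []) (store [] bts ((m + κ - 1) / κ) 0 n 0 [])
      (m * (κ + 1) + 2 * m + 2) := by
  have h₁ := runs_divide_loop bts m n κ 0 hκ
  have h₂ := runs_transfer (k := spareCount) (k' := count) (by simp) (fun a => [a])
    (store [] bts 0 (0 + (m + κ - 1) / κ) n 0 []) _ rfl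
  rw [update_store_spareCount, update_store_count] at h₂
  refine ((h₁.seq h₂).mono ?_).of_eq (by simp [store])
  have : (m + κ - 1) / κ ≤ m := by
    rcases Nat.eq_zero_or_pos m with rfl | hm
    · rw [Nat.div_eq_of_lt (by omega)]
    · rw [Nat.div_le_iff_le_mul_add_pred (by omega)]
      have := Nat.le_mul_of_pos_left m hκ
      omega
  simp [store]
  omega

theorem runs_double :
    double.Runs (store [] bts m 0 n 0 []) (store [] bts m 0 (2 * n) 0 []) (7 * n + 2) := by
  have h₁ := runs_transfer (k := root) (k' := spareRoot) (by simp) (fun a => [a, a])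
    (store [] bts m 0 n 0 []) _ rfl
  rw [update_store_root, update_store_spareRoot] at h₁
  have h₂ := runs_transfer (k := spareRoot) (k' := root) (by simp) (fun a => [a])
    (store [] bts m 0 0 (2 * n) []) _ rfl
  rw [update_store_spareRoot, update_store_root] at h₂
  have e : ∀ n, (List.flatMap (fun a => [a, a]) (List.replicate n ())).length = 2 * n := by
    intro n
    simp [Nat.mul_comm]
  refine (((h₁.of_eq ?_).seq h₂).mono ?_).of_eq ?_
  · simp [store, e, Nat.mul_comm]
  · simp only [store, e]
    simp
    omega
  · simp [store]

/-- Each round replaces `m` by `⌈(m - 1) / κ⌉` and doubles the root, so the number `j` of rounds is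
a logarithm of `m` to base `κ`, up to rounding. The upper bound `κ ^ 2 * (m - 1) + κ` is shaped so
that it reproduces itself under this recursion; the clause for `m = 0` covers the case where the
truncated `m - 1` would lose information. -/
theorem runs_loop (κ : ℕ) (hκ : 2 ≤ κ) :
    ∃ j, (loop count fun _ => (divide κ).seq double).Runs (store [] bts m 0 n 0 [])
      (store [] bts 0 0 (n * 2 ^ j) 0 []) (m * ((κ + 14) * (m + n * 2 ^ j + 1)) + 1) ∧
      m + 1 ≤ κ ^ j ∧ κ ^ j ≤ κ ^ 2 * (m - 1) + κ ∧ (m = 0 → j = 0) := by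
  induction m using Nat.strong_induction_on generalizing n with
  | _ m ih =>
    rcases m with _ | m
    · exact ⟨0, by simpa using runs_loop_nil rfl, by simp, by simp; omega, fun _ => rfl⟩
    · have hlt : (m + κ - 1) / κ < m + 1 := by
        have := Nat.le_mul_of_pos_right m (show 0 < κ by omega)
        rw [Nat.div_lt_iff_lt_mul (by omega), Nat.add_mul]
        omega
      obtain ⟨j, h, hj₁, hj₂, hj₃⟩ := ih _ hlt (2 * n)
      have h₁ := (runs_divide bts m n κ (by omega)).seq (runs_double bts ((m + κ - 1) / κ) n)
      have hdiv := Nat.div_add_mod (m + κ - 1) κ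
      have hmod := Nat.mod_lt (m + κ - 1) (show 0 < κ by omega)
      set q := (m + κ - 1) / κ with hq
      have hn : 2 * n * 2 ^ j = n * 2 ^ (j + 1) := by ring
      rw [hn] at h
      refine ⟨j + 1, (Runs.loop_cons (a := ()) (l := List.replicate m ()) rfl
        (by rw [update_store_count]; simpa using h₁) h).mono ?_, ?_, ?_, by simp⟩
      · set F := n * 2 ^ (j + 1) with hF
        have hnF : n ≤ F := Nat.le_mul_of_pos_right _ (by positivity)
        have hqm : q * ((κ + 14) * (q + F + 1)) ≤ m * ((κ + 14) * (m + 1 + F + 1)) := by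
          gcongr
          omega
        have e : (m + 1) * ((κ + 14) * (m + 1 + F + 1)) =
            m * ((κ + 14) * (m + 1 + F + 1)) + (m * (κ + 14) + (κ + 14) * F + (κ + 14) * 2) := by
          ring
        have e₂ : 14 * F ≤ (κ + 14) * F := Nat.mul_le_mul_right _ (by omega)
        have e₃ : m * (κ + 1) + 2 * m ≤ m * (κ + 14) := by nlinarith
        rw [e]
        omega
      · rw [pow_succ]
        have : κ * (q + 1) ≤ κ ^ j * κ := by
          rw [Nat.mul_comm]
          exact Nat.mul_le_mul_right _ hj₁
        rw [Nat.mul_add] at this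
        omega
      · rcases Nat.eq_zero_or_pos m with rfl | hm
        · have hq0 : q = 0 := by
            rw [hq, Nat.div_eq_of_lt (by omega)]
          simp [hj₃ hq0]
        · have hq1 : 1 ≤ q := by
            rw [hq, Nat.le_div_iff_mul_le (by omega)]
            omega
          clear_value q
          obtain ⟨p, rfl⟩ : ∃ p, q = p + 1 := ⟨q - 1, by omega⟩
          have hpm : κ * p + 1 ≤ m := by
            rw [Nat.mul_add] at hdiv
            omega
          -- With the new count `q = p + 1`, rounding up gives `κ * p + 1 ≤ m`, which is exactly
          -- what the bound for `q`, multiplied by `κ`, requires.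
          simp only [Nat.add_sub_cancel] at hj₂ ⊢
          calc κ ^ (j + 1) = κ ^ j * κ := pow_succ _ _
            _ ≤ (κ ^ 2 * p + κ) * κ := Nat.mul_le_mul_right _ hj₂
            _ = κ ^ 2 * (κ * p + 1) := by ring
            _ ≤ κ ^ 2 * m := Nat.mul_le_mul_left _ hpm
            _ ≤ _ := Nat.le_add_right _ _

theorem runs_input (inp bts : List Bool) (m : ℕ) :
    (loop input fun a => (push bits a).seq (push count ())).Runs (store inp bts m 0 0 0 [])
      (store [] (inp.reverse ++ bts) (inp.length + m) 0 0 0 []) (3 * inp.length + 1) := by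
  induction inp generalizing bts m with
  | nil => exact ((runs_loop_nil rfl).mono (by simp)).of_eq (by simp)
  | cons a l ih =>
    have h := (runs_push bits a (store l bts m 0 0 0 [])).seq (runs_push count () _)
    rw [update_store_bits, update_store_count] at h
    refine ((Runs.loop_cons (a := a) (l := l) rfl (S₁ := store l (a :: bts) (m + 1) 0 0 0 [])
      (t₁ := 1 + 1) ?_ (ih _ _)).mono ?_).of_eq ?_
    · rw [update_store_input]
      simpa [store] using h
    · simp only [List.length_cons]
      omega
    · simp [Nat.add_assoc, Nat.add_comm 1]

theorem runs_program (κ b : ℕ) (hκ : 2 ≤ κ) (x : List Bool) :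
    ∃ j, (program κ b).Runs (singleStack input x)
      (singleStack output (List.replicate (2 ^ j + b) none ++ x.map some))
      ((κ + 40 + 3 * b) * ((x.length + 1) * (x.length + 2 ^ j + 1))) ∧
      x.length + 1 ≤ κ ^ j ∧ κ ^ j ≤ κ ^ 2 * (x.length + 1) := by
  have e₀ : singleStack (Γ := Symbol) input x = store x [] 0 0 0 0 [] := by
    funext k
    cases k <;> rfl
  have e₁ : ∀ y, singleStack (Γ := Symbol) output y = store [] [] 0 0 0 0 y := by
    intro y
    funext k
    cases k <;> rfl
  obtain ⟨j, r₃, hj₁, hj₂, -⟩ := runs_loop (x.reverse ++ []) (x.length + 0) 1 κ hκ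
  have r₁ := runs_input x [] 0
  have r₂ := runs_push root () (store [] (x.reverse ++ []) (x.length + 0) 0 0 0 [])
  rw [update_store_root] at r₂
  have r₄ := runs_pushAll root (List.replicate b ())
    (store [] (x.reverse ++ []) 0 0 (1 * 2 ^ j) 0 [])
  rw [update_store_root] at r₄
  have r₅ := runs_transfer (k := bits) (k' := output) (by simp) (fun a => [some a])
    (store [] x.reverse 0 0 (2 ^ j + b) 0 []) _ rfl
  rw [update_store_bits, update_store_output] at r₅
  have r₆ := runs_transfer (k := root) (k' := output) (by simp) (fun a => [none])
    (store [] [] 0 0 (2 ^ j + b) 0 (x.map some)) _ rfl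
  rw [update_store_root, update_store_output] at r₆
  refine ⟨j, ?_, by simpa using hj₁, hj₂.trans ?_⟩
  · rw [e₀, e₁]
    refine ((r₁.seq (r₂.seq (r₃.seq ((r₄.of_eq ?_).seq ((r₅.of_eq ?_).seq r₆))))).mono ?_).of_eq ?_
    · simp [store, Nat.add_comm]
    · simp [store, ← List.map_eq_flatMap, List.map_reverse]
    · simp only [← List.map_eq_flatMap, List.length_map, List.length_replicate, List.length_reverse,
        store, Nat.add_zero, Nat.one_mul]
      generalize x.length = m
      generalize 2 ^ j = F
      have : (κ + 40 + 3 * b) * ((m + 1) * (m + F + 1)) = m * ((κ + 14) * (m + F + 1)) +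
        26 * (m * (m + F)) + 3 * b * (m * (m + F)) + 26 * m + 3 * b * m + (κ + 40) * (m + F + 1)
          + 3 * b * (m + F) + 3 * b := by ring
      rw [this]
      have : 40 * (m + F + 1) ≤ (κ + 40) * (m + F + 1) := Nat.mul_le_mul_right _ (by omega)
      generalize m * ((κ + 14) * (m + F + 1)) = z at *
      omega
    · simp [store, ← List.map_eq_flatMap]
  · rw [Nat.mul_add]
    have := Nat.mul_le_mul_left (κ ^ 2) (Nat.sub_le x.length 1)
    have : κ ≤ κ ^ 2 := Nat.le_self_pow (by omega) _
    simp only [Nat.add_zero] at *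
    omega

/-- Take `κ = 2 ^ d` and `r = 2 ^ j`: then `κ ^ j = r ^ d` and `κ ^ 2 = 4 ^ d`. An exact root is not
needed; `r` of the order of `(|x| + 1)^(1/d)` suffices, and powers of 2 are easy to produce in
unary. -/
theorem exists_machine (d b : ℕ) (hd : 1 ≤ d) :
    ∃ (M : TuringMachine Bool (Option Bool)) (C : ℕ), ∀ x : List Bool, ∃ r : ℕ,
      x.length + 1 ≤ r ^ d ∧ r ^ d ≤ 4 ^ d * (x.length + 1) ∧
      M.OutputsInTime x (List.replicate (r + b) none ++ x.map some) (C * (x.length + 1) ^ 2) := by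
  refine ⟨(program (2 ^ d) b).toMachine input output (Equiv.refl _) (Equiv.refl _),
    (2 ^ d + 40 + 3 * b) * 5 + 1, fun x => ?_⟩
  have hκ : 2 ≤ 2 ^ d := Nat.le_self_pow (by omega) 2
  obtain ⟨j, hr, h₁, h₂⟩ := runs_program (2 ^ d) b hκ x
  have hp : (2 ^ d) ^ j = (2 ^ j) ^ d := by rw [← pow_mul, ← pow_mul, Nat.mul_comm]
  have hp' : (2 ^ d) ^ 2 = 4 ^ d := by rw [← pow_mul, Nat.mul_comm, pow_mul]; rfl
  rw [hp] at h₁ h₂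
  rw [hp'] at h₂
  refine ⟨2 ^ j, h₁, h₂, (StackProgram.Runs.outputsInTime (i := Equiv.refl _) (o := Equiv.refl _)
    (u := x) (v := List.replicate (2 ^ j + b) none ++ x.map some) (by
      simpa using hr)).mono ?_⟩
  -- Otherwise `(2 ^ j) ^ d > 4 ^ d * (|x| + 1) ^ d ≥ 4 ^ d * (|x| + 1)`. The root is thus at most
  -- linear and the time quadratic.
  have hle : 2 ^ j ≤ 4 * (x.length + 1) := by
    by_contra! hlt
    have := Nat.pow_lt_pow_left hlt (show d ≠ 0 by omega)
    rw [mul_pow] at this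
    have h3 : x.length + 1 ≤ (x.length + 1) ^ d := Nat.le_self_pow (by omega) _
    have := Nat.mul_le_mul_left (4 ^ d) h3
    omega
  have h4 : x.length + 2 ^ j + 1 ≤ 5 * (x.length + 1) := by omega
  calc _ ≤ (2 ^ d + 40 + 3 * b) * ((x.length + 1) * (5 * (x.length + 1))) + 1 := by gcongr
    _ = (2 ^ d + 40 + 3 * b) * 5 * (x.length + 1) ^ 2 + 1 := by ring
    _ ≤ (2 ^ d + 40 + 3 * b) * 5 * (x.length + 1) ^ 2 + 1 * (x.length + 1) ^ 2 := by
      have : 1 ≤ (x.length + 1) ^ 2 := Nat.one_le_pow _ _ (by omega)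
      omega
    _ = _ := by ring

end UnaryRoot

/-! ### Exhaustive search -/

namespace ExhaustiveSearch

/-- The number written in base 3 by a list of digits, least significant digit first. -/
def value : List (Option Bool) → ℕ
  | [] => 0
  | none :: l => 3 * value l
  | some false :: l => 3 * value l + 1
  | some true :: l => 3 * value l + 2

/-- Add one to a list of digits, if there is no overflow. -/
def increment : List (Option Bool) → Option (List (Option Bool))
  | [] => none
  | none :: l => some (some false :: l)
  | some false :: l => some (some true :: l)
  | some true :: l => (increment l).map (none :: ·)

theorem value_lt (l : List (Option Bool)) : value l < 3 ^ l.length := by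
  induction l with
  | nil => simp [value]
  | cons a l ih =>
    rw [List.length_cons, pow_succ]
    rcases a with _ | _ | _ <;> simp only [value] <;> omega

theorem value_injective {l l' : List (Option Bool)} (hl : l.length = l'.length)
    (h : value l = value l') : l = l' := by
  induction l generalizing l' with
  | nil => exact (List.length_eq_zero_iff.1 hl.symm).symm
  | cons a l ih =>
    rcases l' with _ | ⟨a', l'⟩
    · simp at hl
    · simp only [List.length_cons, Nat.add_right_cancel_iff] at hl
      rcases a with _ | _ | _ <;> rcases a' with _ | _ | _ <;> simp only [value] at h <;>
        first
        | omega
        | rw [ih hl (by omega)]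

theorem value_increment {l l' : List (Option Bool)} (h : increment l = some l') :
    l'.length = l.length ∧ value l' = value l + 1 := by
  induction l generalizing l' with
  | nil => simp [increment] at h
  | cons a l ih =>
    rcases a with _ | _ | _ <;> simp only [increment, Option.some.injEq, Option.map_eq_some_iff] at h
    · subst h; simp [value]
    · subst h; simp [value]
    · obtain ⟨l₁, h₁, rfl⟩ := h
      obtain ⟨h₂, h₃⟩ := ih h₁
      simp only [List.length_cons, value]
      omega

theorem value_of_increment_eq_none {l : List (Option Bool)} (h : increment l = none) :
    value l + 1 = 3 ^ l.length := by
  induction l with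
  | nil => simp [value]
  | cons a l ih =>
    rcases a with _ | _ | _ <;> simp only [increment, reduceCtorEq, Option.map_eq_none_iff] at h
    have := ih h
    simp only [value, List.length_cons, pow_succ]
    omega

/-- The stacks of the search machine, besides those of the verifier. -/
inductive Aux where
  | control
  | input
  | word
  | spareWord
  | digits
  | spareDigits
  | go
  | carry
  | output
  deriving DecidableEq

instance : Finite Aux := by
  refine Finite.of_injective (β := Fin 9) (fun
    | .control => 0 | .input => 1 | .word => 2 | .spareWord => 3 | .digits => 4
    | .spareDigits => 5 | .go => 6 | .carry => 7 | .output => 8) ?_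
  rintro (_ | _ | _ | _ | _ | _ | _ | _ | _) (_ | _ | _ | _ | _ | _ | _ | _ | _) h <;> simp_all

noncomputable instance : Fintype Aux := Fintype.ofFinite _

variable (V : TuringMachine Computability.Γ' Bool)

/-- The alphabets of the search machine. -/
abbrev Symbol : V.tm.K ⊕ Aux → Type
  | .inl k => V.tm.Γ k
  | .inr .control => V.tm.Λ × V.tm.σ
  | .inr .input => Option Bool
  | .inr .word => Bool
  | .inr .spareWord => Bool
  | .inr .digits => Option Bool
  | .inr .spareDigits => Option Bool
  | .inr .go => Unit
  | .inr .carry => Unit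
  | .inr .output => Bool

instance finite_symbol (k : V.tm.K ⊕ Aux) : Finite (Symbol V k) := by
  have := V.tm.ΛFin
  have := V.tm.σFin
  rcases k with k | k
  · exact V.finite_alphabet k
  · cases k <;> simp only [Symbol] <;> infer_instance

/-- The stacks of the search machine, listed. -/
def store (S : StackStore V.tm.Γ) (c : List (V.tm.Λ × V.tm.σ)) (inp : List (Option Bool))
    (w w' : List Bool) (d d' : List (Option Bool)) (g r : List Unit) (o : List Bool) :
    StackStore (Symbol V)
  | .inl k => S k
  | .inr .control => c
  | .inr .input => inp
  | .inr .word => w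
  | .inr .spareWord => w'
  | .inr .digits => d
  | .inr .spareDigits => d'
  | .inr .go => g
  | .inr .carry => r
  | .inr .output => o

section Update

variable (S : StackStore V.tm.Γ) (c : List (V.tm.Λ × V.tm.σ)) (inp : List (Option Bool))
    (w w' : List Bool) (d d' : List (Option Bool)) (g r : List Unit) (o : List Bool)

theorem update_store_inl (k : V.tm.K) (l : List (V.tm.Γ k)) :
    Function.update (store V S c inp w w' d d' g r o) (.inl k) l =
      store V (Function.update S k l) c inp w w' d d' g r o := by
  funext j
  rcases j with j | j
  · by_cases h : j = k
    · subst h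
      simp [store]
    · simp [store, h]
  · cases j <;> simp [store]

theorem update_store_input (l : List (Option Bool)) :
    Function.update (store V S c inp w w' d d' g r o) (.inr .input) l =
      store V S c l w w' d d' g r o := by
  funext j
  rcases j with j | j
  · simp [store]
  · cases j <;> simp [store]

theorem update_store_word (l : List Bool) :
    Function.update (store V S c inp w w' d d' g r o) (.inr .word) l =
      store V S c inp l w' d d' g r o := by
  funext j
  rcases j with j | j
  · simp [store]
  · cases j <;> simp [store]

theorem update_store_spareWord (l : List Bool) :
    Function.update (store V S c inp w w' d d' g r o) (.inr .spareWord) l =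
      store V S c inp w l d d' g r o := by
  funext j
  rcases j with j | j
  · simp [store]
  · cases j <;> simp [store]

theorem update_store_digits (l : List (Option Bool)) :
    Function.update (store V S c inp w w' d d' g r o) (.inr .digits) l =
      store V S c inp w w' l d' g r o := by
  funext j
  rcases j with j | j
  · simp [store]
  · cases j <;> simp [store]

theorem update_store_spareDigits (l : List (Option Bool)) :
    Function.update (store V S c inp w w' d d' g r o) (.inr .spareDigits) l =
      store V S c inp w w' d l g r o := by
  funext j
  rcases j with j | j
  · simp [store]
  · cases j <;> simp [store]

theorem update_store_go (l : List Unit) :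
    Function.update (store V S c inp w w' d d' g r o) (.inr .go) l =
      store V S c inp w w' d d' l r o := by
  funext j
  rcases j with j | j
  · simp [store]
  · cases j <;> simp [store]

theorem update_store_carry (l : List Unit) :
    Function.update (store V S c inp w w' d d' g r o) (.inr .carry) l =
      store V S c inp w w' d d' g l o := by
  funext j
  rcases j with j | j
  · simp [store]
  · cases j <;> simp [store]

theorem update_store_output (l : List Bool) :
    Function.update (store V S c inp w w' d d' g r o) (.inr .output) l =
      store V S c inp w w' d d' g r l := by
  funext j
  rcases j with j | j
  · simp [store]
  · cases j <;> simp [store]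

end Update

open StackProgram Computability

/-- Split the input into the word and the digits. -/
def split : StackProgram (Symbol V) :=
  loop (.inr .input) fun
    | some b => push (.inr .word) b
    | none => push (.inr .digits) none

/-- Write the candidate witness on the input stack of the verifier. -/
def writeDigits : StackProgram (Symbol V) :=
  loop (.inr .digits) fun d => (push (.inr .spareDigits) d).seq <|
    match d with
    | some b => push (.inl V.tm.k₀) (V.inputAlphabet.symm (Γ'.bit b))
    | none => skip

/-- Write the word on the input stack of the verifier. -/
def writeWord : StackProgram (Symbol V) :=
  loop (.inr .word) fun b =>
    (push (.inr .spareWord) b).seq (push (.inl V.tm.k₀) (V.inputAlphabet.symm (Γ'.bit b)))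

/-- Add the carry to one digit. -/
def addCarry : Option (Option Bool) → StackProgram (Symbol V)
  | none => skip
  | some none => (push (.inr .digits) (some false)).seq (push (.inr .go) ())
  | some (some false) => (push (.inr .digits) (some true)).seq (push (.inr .go) ())
  | some (some true) => (push (.inr .digits) none).seq (push (.inr .carry) ())

/-- Add one to the number whose digits are on the stack `spareDigits` and move it to `digits`. If
there is no overflow, put a mark on the stack `go`. -/
def advance : StackProgram (Symbol V) :=
  (push (.inr .carry) ()).seq <|
  (loop (.inr .carry) fun _ => pop (.inr .spareDigits) (addCarry V)).seq <|
  transfer (.inr .spareDigits) (.inr .digits) fun a => [a]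

/-- Check one candidate witness. -/
def check : StackProgram (Symbol V) :=
  (writeDigits V).seq <|
  (push (.inl V.tm.k₀) (V.inputAlphabet.symm Γ'.comma)).seq <|
  (writeWord V).seq <|
  (transfer (.inr .spareWord) (.inr .word) fun a => [a]).seq <|
  (call (K₀ := V.tm.K) Sum.inl (.inr .control) id id V.tm.m V.tm.main V.tm.initialState).seq <|
  pop (.inl V.tm.k₁) fun a =>
    if a.map V.outputAlphabet = some true then push (.inr .output) true else advance V

/-- The search program. -/
def program : StackProgram (Symbol V) :=
  (split V).seq <|
  (push (.inr .go) ()).seq <|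
  (loop (.inr .go) fun _ => check V).seq <|
  (loop (.inr .word) fun _ => skip).seq <|
  (loop (.inr .digits) fun _ => skip).seq <|
  (loop (.inr .spareDigits) fun _ => skip).seq <|
  pop (.inr .output) fun a => push (.inr .output) (decide (a = some true))

theorem runs_split (w₀ : List Bool) (d₀ : List (Option Bool)) (w : List Bool) (m : ℕ) :
    (split V).Runs
      (store V (fun _ => []) [] (w.map some ++ List.replicate m none) w₀ [] d₀ [] [] [] [])
      (store V (fun _ => []) [] [] (w.reverse ++ w₀) [] (List.replicate m none ++ d₀) [] [] [] [])
      (2 * (w.length + m) + 1) := by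
  induction w generalizing w₀ with
  | nil =>
    induction m generalizing d₀ with
    | zero => exact (runs_loop_nil rfl).mono (by simp)
    | succ m ih =>
      have h := runs_push (Γ := Symbol V) (.inr .digits) none
        (store V (fun _ => []) [] (List.replicate m none) w₀ [] d₀ [] [] [] [])
      rw [update_store_digits] at h
      refine ((Runs.loop_cons (a := none) (l := List.replicate m none) (by
        simp [store, List.replicate_succ]) (t₁ := 1)
        (S₁ := store V (fun _ => []) [] (List.replicate m none) w₀ [] (none :: d₀) [] [] [] []) ?_
        (ih (none :: d₀))).mono ?_).of_eq ?_
      · rw [update_store_input]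
        exact h
      · simp only [List.length_nil]
        omega
      · rw [List.append_cons, ← List.replicate_succ']
  | cons a w ih =>
    have h := runs_push (Γ := Symbol V) (.inr .word) a
      (store V (fun _ => []) [] (w.map some ++ List.replicate m none) w₀ [] d₀ [] [] [] [])
    rw [update_store_word] at h
    refine ((Runs.loop_cons (a := some a) (l := w.map some ++ List.replicate m none) rfl (t₁ := 1)
        (S₁ := store V (fun _ => []) [] (w.map some ++ List.replicate m none) (a :: w₀) [] d₀
          [] [] [] []) ?_ (ih (a :: w₀))).mono ?_).of_eq ?_
    · rw [update_store_input]
      exact h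
    · simp only [List.length_cons]
      omega
    · simp

theorem runs_writeDigits (w : List Bool) (d d' : List (Option Bool)) (u : List Γ') :
    (writeDigits V).Runs
      (store V (singleStack V.tm.k₀ (u.map V.inputAlphabet.symm)) [] [] w [] d d' [] [] [])
      (store V (singleStack V.tm.k₀ (((d.reverse.filterMap id).map Γ'.bit ++ u).map
        V.inputAlphabet.symm)) [] [] w [] [] (d.reverse ++ d') [] [] []) (3 * d.length + 1) := by
  induction d generalizing d' u with
  | nil => exact (runs_loop_nil rfl).mono (by simp)
  | cons a d ih =>
    have h := runs_push (Γ := Symbol V) (.inr .spareDigits) a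
      (store V (singleStack V.tm.k₀ (u.map V.inputAlphabet.symm)) [] [] w [] d d' [] [] [])
    rw [update_store_spareDigits] at h
    rcases a with _ | b
    · refine ((Runs.loop_cons (a := none) (l := d) rfl (t₁ := 1 + 0)
        (S₁ := store V (singleStack V.tm.k₀ (u.map V.inputAlphabet.symm)) [] [] w [] d (none :: d')
          [] [] []) ?_ (ih (none :: d') u)).mono ?_).of_eq ?_
      · rw [update_store_digits]
        exact h.seq (runs_skip _)
      · simp only [List.length_cons]
        omega
      · simp
    · have h' := h.seq (runs_push (Γ := Symbol V) (.inl V.tm.k₀)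
        (V.inputAlphabet.symm (Γ'.bit b)) _)
      rw [update_store_inl] at h'
      refine ((Runs.loop_cons (a := some b) (l := d) rfl (t₁ := 1 + 1)
        (S₁ := store V (singleStack V.tm.k₀ ((Γ'.bit b :: u).map V.inputAlphabet.symm)) [] [] w []
          d (some b :: d') [] [] []) ?_ (ih (some b :: d') (Γ'.bit b :: u))).mono ?_).of_eq ?_
      · rw [update_store_digits]
        refine h'.of_eq ?_
        simp [store, singleStack]
      · simp only [List.length_cons]
        omega
      · simp

theorem runs_writeWord (w w' : List Bool) (d' : List (Option Bool)) (u : List Γ') :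
    (writeWord V).Runs
      (store V (singleStack V.tm.k₀ (u.map V.inputAlphabet.symm)) [] [] w w' [] d' [] [] [])
      (store V (singleStack V.tm.k₀ ((w.reverse.map Γ'.bit ++ u).map
        V.inputAlphabet.symm)) [] [] [] (w.reverse ++ w') [] d' [] [] []) (3 * w.length + 1) := by
  induction w generalizing w' u with
  | nil => exact (runs_loop_nil rfl).mono (by simp)
  | cons b w ih =>
    have h := (runs_push (Γ := Symbol V) (.inr .spareWord) b
      (store V (singleStack V.tm.k₀ (u.map V.inputAlphabet.symm)) [] [] w w' [] d' [] [] [])).seq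
        (runs_push (Γ := Symbol V) (.inl V.tm.k₀) (V.inputAlphabet.symm (Γ'.bit b)) _)
    rw [update_store_spareWord, update_store_inl] at h
    refine ((Runs.loop_cons (a := b) (l := w) rfl (t₁ := 1 + 1)
        (S₁ := store V (singleStack V.tm.k₀ ((Γ'.bit b :: u).map V.inputAlphabet.symm)) [] [] w
          (b :: w') [] d' [] [] []) ?_ (ih (b :: w') (Γ'.bit b :: u))).mono ?_).of_eq ?_
    · rw [update_store_word]
      refine h.of_eq ?_
      simp [store, singleStack]
    · simp only [List.length_cons]
      omega
    · simp

/-- The state of the stacks `digits` and `go` after an increment of the number on `spareDigits`. -/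
theorem runs_carry (w : List Bool) (d d' : List (Option Bool)) :
    ∃ l₁ l₂, l₁.length + l₂.length = d'.length ∧
      (loop (.inr .carry) fun _ => pop (.inr .spareDigits) (addCarry V)).Runs
      (store V (fun _ => []) [] [] w [] d d' [] [()] [])
      (store V (fun _ => []) [] [] w [] (l₁ ++ d) l₂ (if (increment d').isSome then [()] else [])
        [] []) (4 * d'.length + 5) ∧ ∀ e, increment d' = some e → l₁.reverse ++ l₂ = e := by
  induction d' generalizing d with
  | nil =>
    refine ⟨[], [], rfl, ((Runs.loop_cons (a := ()) (l := []) rfl (Runs.pop ?_)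
      (runs_loop_nil (S := store V (fun _ => []) [] [] w [] d [] [] [] []) rfl)).mono
      (t := 0 + 1 + 1 + 1) (by simp)).of_eq (by simp [increment]), by simp [increment]⟩
    rw [update_store_carry, update_store_spareDigits]
    exact runs_skip _
  | cons a d' ih =>
    have key : ∀ b : Option Bool,
        ((push (.inr .digits) b).seq (push (.inr .go) ()) : StackProgram (Symbol V)).Runs
          (store V (fun _ => []) [] [] w [] d d' [] [] [])
          (store V (fun _ => []) [] [] w [] (b :: d) d' [()] [] []) 2 := by
      intro b
      have h := (runs_push (Γ := Symbol V) (.inr .digits) b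
        (store V (fun _ => []) [] [] w [] d d' [] [] [])).seq (runs_push (.inr .go) () _)
      rw [update_store_digits, update_store_go] at h
      exact h
    rcases a with _ | _ | _
    · refine ⟨[some false], d', by simp [Nat.add_comm], ((Runs.loop_cons (a := ()) (l := []) rfl
        (Runs.pop ?_) (runs_loop_nil (S := store V (fun _ => []) [] [] w [] (some false :: d) d'
          [()] [] []) rfl)).mono (t := 2 + 1 + 1 + 1) (by simp)).of_eq (by simp [increment]),
        by simp [increment]⟩
      rw [update_store_carry, update_store_spareDigits]
      exact key (some false)
    · refine ⟨[some true], d', by simp [Nat.add_comm], ((Runs.loop_cons (a := ()) (l := []) rfl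
        (Runs.pop ?_) (runs_loop_nil (S := store V (fun _ => []) [] [] w [] (some true :: d) d'
          [()] [] []) rfl)).mono (t := 2 + 1 + 1 + 1) (by simp)).of_eq (by simp [increment]),
        by simp [increment]⟩
      rw [update_store_carry, update_store_spareDigits]
      exact key (some true)
    · obtain ⟨l₁, l₂, hl, h, he⟩ := ih (none :: d)
      refine ⟨l₁ ++ [none], l₂, by simp; omega, ((Runs.loop_cons (a := ()) (l := []) rfl
        (Runs.pop ?_) h).mono (t := 2 + 1 + (4 * d'.length + 5) + 1) (by simp; omega)).of_eq
        (by simp [increment]), ?_⟩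
      · rw [update_store_carry, update_store_spareDigits]
        have h := (runs_push (Γ := Symbol V) (.inr .digits) none
          (store V (fun _ => []) [] [] w [] d d' [] [] [])).seq (runs_push (.inr .carry) () _)
        rw [update_store_digits, update_store_carry] at h
        exact h
      · intro e h
        simp only [increment, Option.map_eq_some_iff] at h
        obtain ⟨e', he', rfl⟩ := h
        simp [← he e' he']

/-- The digits passed by the carry lie reversed on `digits`; the others stay on `spareDigits` until
the transfer puts them on top. After an overflow the digits no longer matter, only their number, for
the cleaning up. -/
theorem runs_advance (w : List Bool) (d : List (Option Bool)) :
    ∃ d' : List (Option Bool), d'.length = d.length ∧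
      (advance V).Runs (store V (fun _ => []) [] [] w [] [] d [] [] [])
      (store V (fun _ => []) [] [] w [] d'.reverse [] (if (increment d).isSome then [()] else [])
        [] []) (6 * d.length + 7) ∧ ∀ e, increment d = some e → d' = e := by
  obtain ⟨l₁, l₂, hl, h, he⟩ := runs_carry V w [] d
  have h₀ := runs_push (Γ := Symbol V) (.inr .carry) () (store V (fun _ => []) [] [] w [] [] d [] [] [])
  rw [update_store_carry] at h₀
  have h₂ := runs_transfer (Γ := Symbol V) (k := .inr .spareDigits) (k' := .inr .digits) (by simp)
    (fun a => [a]) (store V (fun _ => []) [] [] w [] (l₁ ++ []) l₂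
      (if (increment d).isSome then [()] else []) [] []) _ rfl
  rw [update_store_spareDigits, update_store_digits] at h₂
  refine ⟨l₁.reverse ++ l₂, by simpa using hl, ((h₀.seq (h.seq h₂)).mono ?_).of_eq ?_, he⟩
  · simp [store]
    omega
  · simp [store]

/-- The stack `go` is refilled precisely if the search has to continue: the candidate failed and
there is a next one. In the other cases the contents of the digit stacks are left open. -/
theorem runs_check (w : List Bool) (d : List (Option Bool)) (b : Bool) (T : ℕ)
    (hV : V.OutputsInTime (encodePair w (d.filterMap id)) [b] T) :
    ∃ d₁ d₂ : List (Option Bool), d₁.length + d₂.length = d.length ∧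
      (check V).Runs (store V (fun _ => []) [] [] w.reverse [] d.reverse [] [] [] [])
        (store V (fun _ => []) [] [] w.reverse [] d₁ d₂
          (if b = false ∧ (increment d).isSome then [()] else []) [] (if b then [true] else []))
        ((V.stmtCost + 1) * T + 15 * d.length + 5 * w.length + 25) ∧
      (b = false → ∀ e, increment d = some e → d₁ = e.reverse ∧ d₂ = []) := by
  obtain ⟨T', hT', hi⟩ := hV.exists_iterate
  have e₀ : (fun _ => []) = singleStack (Γ := V.tm.Γ) V.tm.k₀
      (([] : List Γ').map V.inputAlphabet.symm) := by
    funext k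
    simp [singleStack]
  have r₁ := runs_writeDigits V w.reverse d.reverse [] []
  rw [← e₀] at r₁
  have r₂ := runs_push (Γ := Symbol V) (.inl V.tm.k₀) (V.inputAlphabet.symm Γ'.comma)
    (store V (singleStack V.tm.k₀ (((d.reverse.reverse.filterMap id).map Γ'.bit ++ []).map
        V.inputAlphabet.symm)) [] [] w.reverse [] [] (d.reverse.reverse ++ []) [] [] [])
  rw [update_store_inl] at r₂
  have r₃ := runs_writeWord V w.reverse [] d (Γ'.comma :: (d.filterMap id).map Γ'.bit)
  have r₄ := runs_transfer (Γ := Symbol V) (k := .inr .spareWord) (k' := .inr .word) (by simp)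
    (fun a => [a]) (store V (singleStack V.tm.k₀ ((encodePair w (d.filterMap id)).map
        V.inputAlphabet.symm)) [] [] [] w [] d [] [] []) _ rfl
  rw [update_store_spareWord, update_store_word] at r₄
  have r₅ := runs_call (Γ := Symbol V) (K₀ := V.tm.K) (e := Sum.inl)
    (c := .inr .control) (enc := id) (dec := id) Sum.inl_injective (by simp)
    (fun _ => rfl) (fun l => V.le_stmtCost l) hi
    (S := store V (singleStack V.tm.k₀ ((encodePair w (d.filterMap id)).map
        V.inputAlphabet.symm)) [] [] w.reverse [] [] d [] [] []) (singleStack_self _ _)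
    (fun k hk => singleStack_of_ne _ hk) rfl
  rw [update_store_inl, update_store_inl, update_update_singleStack] at r₅
  have hpre' : ∀ (S : StackStore (Symbol V)) (t : ℕ), t ≤ 6 * d.length + 9 →
      StackProgram.Runs (if b = true then push (.inr .output) true else advance V)
        (store V (fun _ => []) [] [] w.reverse [] [] d [] [] []) S t →
      (check V).Runs (store V (fun _ => []) [] [] w.reverse [] d.reverse [] [] [] []) S
        ((V.stmtCost + 1) * T + 15 * d.length + 5 * w.length + 25) := by
    intro S t ht h
    have hp : (pop (.inl V.tm.k₁) fun a =>
        if a.map V.outputAlphabet = some true then push (.inr .output) true else advance V).Runs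
        (store V (singleStack V.tm.k₁ ([b].map V.outputAlphabet.symm)) [] [] w.reverse [] [] d
          [] [] []) S (t + 1) := by
      refine Runs.pop ?_
      rw [update_store_inl]
      simpa [store, singleStack] using h
    refine StackProgram.Runs.mono
      (r₁.seq ((r₂.of_eq ?_).seq ((r₃.of_eq ?_).seq ((r₄.of_eq ?_).seq (r₅.seq hp))))) ?_
    · simp [store, singleStack]
    · simp [encodePair]
    · simp [store]
    · have := Nat.mul_le_mul_left (V.stmtCost + 1) hT'
      simp only [store, ← List.map_eq_flatMap, List.length_map, List.length_reverse]
      omega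
  rcases b with _ | _
  · obtain ⟨d', hd', h, he⟩ := runs_advance V w.reverse d
    refine ⟨d'.reverse, [], by simpa using hd', (hpre' _ _ (by omega) h).of_eq (by simp), ?_⟩
    rintro - e h
    exact ⟨by rw [he e h], rfl⟩
  · have h := runs_push (Γ := Symbol V) (.inr .output) true
      (store V (fun _ => []) [] [] w.reverse [] [] d [] [] [])
    rw [update_store_output] at h
    exact ⟨[], d, by simp, (hpre' _ _ (by omega) h).of_eq (by simp [store]), by simp⟩

open Classical in
-- The digit `none` is a blank, skipped when the candidate is written for the verifier; hence `m`
-- digits to base 3 represent all strings of length at most `m`, some of them repeatedly. The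
-- induction is on the number `j` of candidates left, including the present one.
theorem runs_search (w : List Bool) (f : List Bool → Bool) (T m : ℕ)
    (hV : ∀ y : List Bool, y.length ≤ m → V.OutputsInTime (encodePair w y) [f y] T)
    (d : List (Option Bool)) (hd : d.length = m) (j : ℕ) (hj : value d + j = 3 ^ m) :
    ∃ d₁ d₂ : List (Option Bool), d₁.length + d₂.length = m ∧
      (loop (.inr .go) fun _ => check V).Runs
        (store V (fun _ => []) [] [] w.reverse [] d.reverse [] [()] [] [])
        (store V (fun _ => []) [] [] w.reverse [] d₁ d₂ [] []
          (if ∃ e : List (Option Bool), e.length = m ∧ value d ≤ value e ∧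
            f (e.filterMap id) = true then [true] else []))
        (j * ((V.stmtCost + 1) * T + 15 * m + 5 * w.length + 26) + 1) := by
  induction j generalizing d with
  | zero =>
    have := value_lt d
    rw [hd] at this
    omega
  | succ j ih =>
    have hlen : (d.filterMap id).length ≤ m := hd ▸ List.length_filterMap_le _ _
    obtain ⟨d₁, d₂, hl, h, he⟩ := runs_check V w d _ T (hV _ hlen)
    have hstart : Function.update (store V (fun _ => []) [] [] w.reverse [] d.reverse [] [()] [] [])
        (.inr .go) [] = store V (fun _ => []) [] [] w.reverse [] d.reverse [] [] [] [] :=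
      update_store_go _ _ _ _ _ _ _ _ _ _ _ _
    rw [← hstart] at h
    by_cases hc : f (d.filterMap id) = false ∧ (increment d).isSome
    · obtain ⟨hf, hs⟩ := hc
      obtain ⟨e, hie⟩ := Option.isSome_iff_exists.1 hs
      obtain ⟨rfl, rfl⟩ := he hf e hie
      obtain ⟨hel, hev⟩ := value_increment hie
      obtain ⟨d₁, d₂, hl', h'⟩ := ih e (hel.trans hd) (by omega)
      rw [if_pos ⟨hf, hs⟩, if_neg (by rw [hf]; simp)] at h
      refine ⟨d₁, d₂, hl', ((Runs.loop_cons rfl h h').mono ?_).of_eq ?_⟩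
      · rw [Nat.add_mul j 1]
        omega
      · congr 2
        simp only [eq_iff_iff]
        constructor
        · rintro ⟨e', h₁, h₂, h₃⟩
          exact ⟨e', h₁, by omega, h₃⟩
        · rintro ⟨e', h₁, h₂, h₃⟩
          refine ⟨e', h₁, ?_, h₃⟩
          rcases h₂.eq_or_lt with h₂ | h₂
          · rw [value_injective (hd.trans h₁.symm) h₂, h₃] at hf
            simp at hf
          · omega
    · rw [if_neg hc] at h
      refine ⟨d₁, d₂, hl.trans hd, ((Runs.loop_cons rfl h (runs_loop_nil rfl)).mono ?_).of_eq ?_⟩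
      · rw [Nat.add_mul j 1]
        omega
      · congr 2
        simp only [eq_iff_iff]
        refine ⟨fun hf => ⟨d, hd, le_rfl, hf⟩, ?_⟩
        rintro ⟨e', h₁, h₂, h₃⟩
        by_contra hf
        have hf' : f (d.filterMap id) = false := by simpa using hf
        have hn : increment d = none := by
          rw [← Option.not_isSome_iff_eq_none]
          exact fun hs => hc ⟨hf', hs⟩
        have h4 := value_of_increment_eq_none hn
        have h5 := value_lt e'
        rw [hd] at h4
        rw [h₁] at h5
        rw [value_injective (hd.trans h₁.symm) (by omega)] at hf
        exact hf h₃

open Classical in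
theorem runs_program (w : List Bool) (f : List Bool → Bool) (T m : ℕ)
    (hV : ∀ y : List Bool, y.length ≤ m → V.OutputsInTime (encodePair w y) [f y] T) :
    (program V).Runs (singleStack (.inr .input) (w.map some ++ List.replicate m none))
      (singleStack (.inr .output) [decide (∃ y : List Bool, y.length ≤ m ∧ f y = true)])
      (3 ^ m * ((V.stmtCost + 1) * T + 15 * m + 5 * w.length + 26) + 5 * (w.length + m) + 20) := by
  have e₀ : ∀ x, singleStack (Γ := Symbol V) (.inr .input) x =
      store V (fun _ => []) [] x [] [] [] [] [] [] [] := by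
    intro x
    funext k
    rcases k with k | k
    · rfl
    · cases k <;> rfl
  have e₁ : ∀ x, singleStack (Γ := Symbol V) (.inr .output) x =
      store V (fun _ => []) [] [] [] [] [] [] [] [] x := by
    intro x
    funext k
    rcases k with k | k
    · rfl
    · cases k <;> rfl
  have hval : ∀ m, value (List.replicate m none) = 0 := by
    intro m
    induction m with
    | zero => rfl
    | succ m ih => simp [List.replicate_succ, value, ih]
  obtain ⟨d₁, d₂, hl, r₃⟩ := runs_search V w f T m hV (List.replicate m none) (by simp) (3 ^ m)
    (by simp [hval])
  have r₁ := runs_split V [] [] w m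
  have r₂ := runs_push (Γ := Symbol V) (.inr .go) ()
    (store V (fun _ => []) [] [] w.reverse [] (List.replicate m none) [] [] [] [])
  rw [update_store_go] at r₂
  rw [List.reverse_replicate] at r₃
  have hiff : (∃ e : List (Option Bool), e.length = m ∧ value (List.replicate m none) ≤ value e ∧
      f (e.filterMap id) = true) ↔ ∃ y : List Bool, y.length ≤ m ∧ f y = true := by
    rw [hval]
    constructor
    · rintro ⟨e, h₁, -, h₂⟩
      exact ⟨_, h₁ ▸ List.length_filterMap_le _ _, h₂⟩
    · rintro ⟨y, h₁, h₂⟩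
      -- A short witness is padded with blanks.
      refine ⟨y.map some ++ List.replicate (m - y.length) none, by simp; omega, Nat.zero_le _, ?_⟩
      rw [← h₂]
      congr 1
      simp [List.filterMap_append]
  simp only [hiff] at r₃
  set o : List Bool := if ∃ y : List Bool, y.length ≤ m ∧ f y = true then [true] else [] with ho
  have r₄ := runs_clear (Γ := Symbol V) (.inr .word)
    (store V (fun _ => []) [] [] w.reverse [] d₁ d₂ [] [] o) _ rfl
  rw [update_store_word] at r₄
  have r₅ := runs_clear (Γ := Symbol V) (.inr .digits)
    (store V (fun _ => []) [] [] [] [] d₁ d₂ [] [] o) _ rfl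
  rw [update_store_digits] at r₅
  have r₆ := runs_clear (Γ := Symbol V) (.inr .spareDigits)
    (store V (fun _ => []) [] [] [] [] [] d₂ [] [] o) _ rfl
  rw [update_store_spareDigits] at r₆
  have r₇ : (pop (.inr .output) fun a => push (.inr .output) (decide (a = some true)) :
      StackProgram (Symbol V)).Runs (store V (fun _ => []) [] [] [] [] [] [] [] [] o)
      (store V (fun _ => []) [] [] [] [] [] [] [] []
        [decide (∃ y : List Bool, y.length ≤ m ∧ f y = true)]) (1 + 1) := by
    refine Runs.pop ((runs_push _ _ _).of_eq ?_)
    rw [update_store_output, update_store_output]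
    by_cases h : ∃ y : List Bool, y.length ≤ m ∧ f y = true
    · simp [ho, store, h]
    · simp [ho, store, h]
  rw [e₀, e₁]
  refine (r₁.of_eq ?_).seq (r₂.seq (r₃.seq (r₄.seq (r₅.seq (r₆.seq r₇))))) |>.mono ?_
  · simp
  · simp only [store, List.length_reverse]
    omega

/-- The machine that searches for a witness. -/
noncomputable def machine : TuringMachine (Option Bool) Bool :=
  (program V).toMachine (.inr .input) (.inr .output) (Equiv.refl _) (Equiv.refl _)

open Classical in
theorem machine_outputsInTime (w : List Bool) (f : List Bool → Bool) (T m : ℕ)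
    (hV : ∀ y : List Bool, y.length ≤ m → V.OutputsInTime (encodePair w y) [f y] T) :
    (machine V).OutputsInTime (w.map some ++ List.replicate m none)
      [decide (∃ y : List Bool, y.length ≤ m ∧ f y = true)]
      (3 ^ m * ((V.stmtCost + 1) * T + 15 * m + 5 * w.length + 26) + 5 * (w.length + m) + 21) :=
  StackProgram.Runs.outputsInTime (p := program V) (k₀ := .inr .input) (k₁ := .inr .output)
    (i := Equiv.refl _) (o := Equiv.refl _) (by simpa using runs_program V w f T m hV)

end ExhaustiveSearch

/-! ### Boolean expressions as circuits -/

/-- Boolean expressions over the variables `V`. -/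
inductive BoolExpr (V : Type) where
  | const (b : Bool)
  | var (v : V)
  | neg (φ : BoolExpr V)
  | and (φ ψ : BoolExpr V)
  | or (φ ψ : BoolExpr V)

/-- The values of all nodes, latest first, after the gates `gs`. -/
def runGates (gs : List Gate) (vals : List Bool) : List Bool :=
  gs.foldl (fun vals g => g.eval vals :: vals) vals

theorem runGates_append (gs hs : List Gate) (vals : List Bool) :
    runGates (gs ++ hs) vals = runGates hs (runGates gs vals) :=
  List.foldl_append

theorem gatesFit_append {m : ℕ} {gs hs : List Gate} (hg : GatesFit m gs)
    (hh : GatesFit (m + gs.length) hs) : GatesFit m (gs ++ hs) := by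
  induction gs generalizing m with
  | nil => exact hh
  | cons g gs ih =>
    refine ⟨hg.1, ih hg.2 ?_⟩
    rwa [List.length_cons, Nat.add_comm gs.length, ← Nat.add_assoc] at hh

/-- What is substituted for a variable: a constant, or the node at a given distance. -/
inductive Wire where
  | const (b : Bool)
  | node (i : ℕ)

namespace Wire

/-- The value of a wire. -/
def val (vals : List Bool) : Wire → Bool
  | const b => b
  | node i => vals.getD i false

/-- A gate that copies a wire, after `off` further nodes. -/
def gate (off : ℕ) : Wire → Gate
  | const b => .const b
  | node i => .disj (i + off) (i + off)

/-- The wire refers to one of `m` nodes. -/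
def Fits (m : ℕ) : Wire → Prop
  | const _ => True
  | node i => i < m

end Wire

namespace BoolExpr

variable {V : Type}

/-- The value of an expression. -/
def eval (x : V → Bool) : BoolExpr V → Bool
  | const b => b
  | var v => x v
  | neg φ => !(φ.eval x)
  | and φ ψ => φ.eval x && ψ.eval x
  | or φ ψ => φ.eval x || ψ.eval x

/-- Shannon expansion: `f` is `v ∧ f[v := 1]` or `¬v ∧ f[v := 0]`, and the two restrictions depend
on one variable less. -/
theorem exists_eval_eq [Finite V] (f : (V → Bool) → Bool) :
    ∃ φ : BoolExpr V, ∀ x, φ.eval x = f x := by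
  classical
  have := Fintype.ofFinite V
  -- For the induction, `f` is only assumed to depend on the variables in a list.
  suffices ∀ (l : List V) (f : (V → Bool) → Bool),
      (∀ x y : V → Bool, (∀ v ∈ l, x v = y v) → f x = f y) →
      ∃ φ : BoolExpr V, ∀ x, φ.eval x = f x from
    this Finset.univ.toList f fun x y h => congrArg f (funext fun v => h v (by simp))
  intro l
  induction l with
  | nil => exact fun f hf => ⟨const (f fun _ => false), fun x => hf _ _ (by simp)⟩
  | cons v l ih =>
    intro f hf
    have h : ∀ b, ∃ φ : BoolExpr V, ∀ x, φ.eval x = f (Function.update x v b) := fun b =>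
      ih _ fun x y hxy => hf _ _ fun w hw => by
        by_cases hv : w = v
        · subst hv
          simp
        · simpa [hv] using hxy w (by simpa [hv] using hw)
    obtain ⟨φ, hφ⟩ := h true
    obtain ⟨ψ, hψ⟩ := h false
    refine ⟨or (and (var v) φ) (and (neg (var v)) ψ), fun x => ?_⟩
    simp only [eval, hφ, hψ]
    have e := Function.update_eq_self v x
    cases hx : x v
    · rw [hx] at e
      simp [e]
    · rw [hx] at e
      simp [e]

/-- The number of gates of an expression. -/
def size : BoolExpr V → ℕ
  | const _ => 1
  | var _ => 1
  | neg φ => φ.size + 1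
  | and φ ψ => φ.size + ψ.size + 1
  | or φ ψ => φ.size + ψ.size + 1

/-- The gates of an expression, the variables being replaced by the wires `ℓ`, as seen before the
preceding `off` nodes. -/
def gates (ℓ : V → Wire) : ℕ → BoolExpr V → List Gate
  | _, const b => [.const b]
  | off, var v => [(ℓ v).gate off]
  | off, neg φ => φ.gates ℓ off ++ [.neg 0]
  | off, and φ ψ => φ.gates ℓ off ++ ψ.gates ℓ (off + φ.size) ++ [.conj 0 ψ.size]
  | off, or φ ψ => φ.gates ℓ off ++ ψ.gates ℓ (off + φ.size) ++ [.disj 0 ψ.size]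

theorem length_gates (ℓ : V → Wire) (φ : BoolExpr V) (off : ℕ) :
    (φ.gates ℓ off).length = φ.size := by
  induction φ generalizing off with
  | const b => rfl
  | var v => rfl
  | neg φ ih => simp [gates, size, ih]
  | and φ ψ ih₁ ih₂ => simp [gates, size, ih₁, ih₂, Nat.add_assoc]
  | or φ ψ ih₁ ih₂ => simp [gates, size, ih₁, ih₂, Nat.add_assoc]

theorem size_pos (φ : BoolExpr V) : 0 < φ.size := by
  cases φ <;> simp [size]

theorem gates_fit {ℓ : V → Wire} {m : ℕ} (h : ∀ v, (ℓ v).Fits m) (φ : BoolExpr V) (off : ℕ) :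
    GatesFit (m + off) (φ.gates ℓ off) := by
  induction φ generalizing off with
  | const b => exact ⟨trivial, trivial⟩
  | var v =>
    refine ⟨?_, trivial⟩
    have := h v
    cases hv : ℓ v with
    | const b => trivial
    | node i =>
      rw [hv] at this
      have : i < m := this
      exact ⟨by omega, by omega⟩
  | neg φ ih =>
    have := φ.size_pos
    exact gatesFit_append (ih off) ⟨by rw [length_gates]; exact (by omega : 0 < m + off + φ.size), trivial⟩
  | and φ ψ ih₁ ih₂ | or φ ψ ih₁ ih₂ =>
    refine gatesFit_append (gatesFit_append (ih₁ off) ?_) ⟨?_, trivial⟩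
    · rw [length_gates, Nat.add_assoc]
      exact ih₂ _
    · have := φ.size_pos
      have := ψ.size_pos
      simp only [List.length_append, length_gates]
      exact ⟨by omega, by omega⟩

/-- Wires are distances as seen from `vals`. The nodes `pre` created since then shift every distance
by their number, which is the offset in `gates`. -/
theorem runGates_gates (ℓ : V → Wire) (φ : BoolExpr V) (pre vals : List Bool) :
    ∃ new : List Bool, new.length = φ.size ∧
      runGates (φ.gates ℓ pre.length) (pre ++ vals) = new ++ (pre ++ vals) ∧
      new.getD 0 false = φ.eval fun v => (ℓ v).val vals := by
  induction φ generalizing pre with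
  | const b => exact ⟨[b], rfl, rfl, rfl⟩
  | var v =>
    refine ⟨[(ℓ v).val vals], rfl, ?_, rfl⟩
    cases hv : ℓ v with
    | const b => simp [gates, hv, runGates, Wire.gate, Wire.val, Gate.eval]
    | node i =>
      simp only [gates, hv, runGates, Wire.gate, Wire.val, Gate.eval, List.foldl_cons,
        List.foldl_nil]
      rw [List.getD_append_right _ _ _ _ (by omega)]
      simp
  | neg φ ih =>
    obtain ⟨new, h₁, h₂, h₃⟩ := ih pre
    have := φ.size_pos
    refine ⟨(!(new.getD 0 false)) :: new, by simp [size, h₁], ?_, by simp [eval, ← h₃]⟩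
    rw [gates, runGates_append, h₂]
    simp only [runGates, Gate.eval, List.foldl_cons, List.foldl_nil]
    rw [List.getD_append _ _ _ _ (by omega)]
    rfl
  | and φ ψ ih₁ ih₂ =>
    obtain ⟨new₁, h₁, r₁, e₁⟩ := ih₁ pre
    obtain ⟨new₂, h₂, r₂, e₂⟩ := ih₂ (new₁ ++ pre)
    have := φ.size_pos
    have := ψ.size_pos
    rw [List.length_append, h₁, Nat.add_comm φ.size, List.append_assoc] at r₂
    refine ⟨(and φ ψ).eval (fun v => (ℓ v).val vals) :: (new₂ ++ new₁), by simp [size, h₁, h₂]; omega,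
      ?_, rfl⟩
    rw [gates, runGates_append, runGates_append, r₁, r₂]
    simp only [runGates, Gate.eval, List.foldl_cons, List.foldl_nil, List.cons_append,
      List.append_assoc, eval]
    -- The output of `ψ` is the latest node and that of `φ` lies `ψ.size` nodes before it, so the
    -- gate takes its arguments in the opposite order.
    rw [List.getD_append _ _ _ _ (by omega), List.getD_append_right _ _ _ _ (by omega), h₂,
      Nat.sub_self, List.getD_append _ _ _ _ (by omega), e₁, e₂, Bool.and_comm]
  | or φ ψ ih₁ ih₂ =>
    obtain ⟨new₁, h₁, r₁, e₁⟩ := ih₁ pre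
    obtain ⟨new₂, h₂, r₂, e₂⟩ := ih₂ (new₁ ++ pre)
    have := φ.size_pos
    have := ψ.size_pos
    rw [List.length_append, h₁, Nat.add_comm φ.size, List.append_assoc] at r₂
    refine ⟨(or φ ψ).eval (fun v => (ℓ v).val vals) :: (new₂ ++ new₁), by simp [size, h₁, h₂]; omega,
      ?_, rfl⟩
    rw [gates, runGates_append, runGates_append, r₁, r₂]
    simp only [runGates, Gate.eval, List.foldl_cons, List.foldl_nil, List.cons_append,
      List.append_assoc, eval]
    rw [List.getD_append _ _ _ _ (by omega), List.getD_append_right _ _ _ _ (by omega), h₂,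
      Nat.sub_self, List.getD_append _ _ _ _ (by omega), e₁, e₂, Bool.or_comm]

end BoolExpr

/-! ### Blocks of gates -/

section Block

variable {V ι : Type} (φ : ι → BoolExpr V)

/-- The number of gates of a block. -/
def blockSize (l : List ι) : ℕ := (l.map fun i => (φ i).size).sum

/-- The gates of a block that computes the expressions `φ i`. -/
def blockGates (ℓ : V → Wire) : ℕ → List ι → List Gate
  | _, [] => []
  | off, i :: l => (φ i).gates ℓ off ++ blockGates ℓ (off + (φ i).size) l

/-- The distance of the node for `φ j` from the end of the block. -/
def blockPos [DecidableEq ι] : List ι → ι → ℕ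
  | [], _ => 0
  | i :: l, j => if j ∈ l then blockPos l j else if j = i then blockSize φ l else 0

theorem length_blockGates (ℓ : V → Wire) (off : ℕ) (l : List ι) :
    (blockGates φ ℓ off l).length = blockSize φ l := by
  induction l generalizing off with
  | nil => rfl
  | cons i l ih => simp [blockGates, blockSize, BoolExpr.length_gates, ih]

theorem length_le_blockSize (l : List ι) : l.length ≤ blockSize φ l := by
  induction l with
  | nil => simp
  | cons i l ih =>
    have := (φ i).size_pos
    simp only [blockSize, List.map_cons, List.sum_cons, List.length_cons] at *
    omega

theorem blockGates_fit {ℓ : V → Wire} {m : ℕ} (h : ∀ v, (ℓ v).Fits m) (off : ℕ) (l : List ι) :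
    GatesFit (m + off) (blockGates φ ℓ off l) := by
  induction l generalizing off with
  | nil => trivial
  | cons i l ih =>
    refine gatesFit_append (BoolExpr.gates_fit h _ _) ?_
    rw [BoolExpr.length_gates, Nat.add_assoc]
    exact ih _

variable [DecidableEq ι]

theorem blockPos_lt {l : List ι} {j : ι} (hj : j ∈ l) : blockPos φ l j < blockSize φ l := by
  induction l with
  | nil => simp at hj
  | cons i l ih =>
    have := (φ i).size_pos
    simp only [blockPos, blockSize, List.map_cons, List.sum_cons]
    split_ifs with h₁ h₂
    · have := ih h₁
      unfold blockSize at this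
      omega
    · omega
    · omega

theorem runGates_blockGates (ℓ : V → Wire) (l : List ι) (pre vals : List Bool) :
    ∃ new : List Bool, new.length = blockSize φ l ∧
      runGates (blockGates φ ℓ pre.length l) (pre ++ vals) = new ++ (pre ++ vals) ∧
      ∀ j ∈ l, new.getD (blockPos φ l j) false = (φ j).eval fun v => (ℓ v).val vals := by
  induction l generalizing pre with
  | nil => exact ⟨[], rfl, rfl, by simp⟩
  | cons i l ih =>
    obtain ⟨new₁, h₁, r₁, e₁⟩ := (φ i).runGates_gates ℓ pre vals
    obtain ⟨new₂, h₂, r₂, e₂⟩ := ih (new₁ ++ pre)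
    rw [List.length_append, h₁, Nat.add_comm (φ i).size, List.append_assoc] at r₂
    refine ⟨new₂ ++ new₁, by simp [blockSize, h₁, h₂, Nat.add_comm], ?_, ?_⟩
    · rw [blockGates, runGates_append, r₁, r₂, List.append_assoc]
    · intro j hj
      simp only [blockPos]
      split_ifs with hjl hji
      · rw [List.getD_append _ _ _ _ (h₂ ▸ blockPos_lt φ hjl)]
        exact e₂ j hjl
      · subst hji
        rw [List.getD_append_right _ _ _ _ (by omega), h₂, Nat.sub_self, e₁]
      · simp [hjl, hji] at hj

end Block

/-! ### Circuits for cellular rules -/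

/-- The variables of a block of gates that computes one cell. -/
inductive CellVar (C : Type) where
  | isStep
  | isGuess
  | const (c : C)
  | neighbour (k : Fin 4) (c : C)
  | guess (k : Bool)

instance {C : Type} [Finite C] : Finite (CellVar C) := by
  refine Finite.of_injective (β := Option (Option (C ⊕ (Fin 4 × C) ⊕ Bool))) (fun
    | .isStep => none
    | .isGuess => some none
    | .const c => some (some (.inl c))
    | .neighbour k c => some (some (.inr (.inl (k, c))))
    | .guess k => some (some (.inr (.inr k)))) ?_
  rintro (_ | _ | c | ⟨k, c⟩ | k) (_ | _ | c' | ⟨k', c'⟩ | k') h <;> simp_all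

/-- The kinds of cells: constants, cells determined by the cell before and two guessed bits, and
cells determined by the cell before and three cells of the row before. -/
inductive CellBlock (C : Type) where
  | const (c : C)
  | guess
  | step

/-- Local rules for the cells. -/
structure CellRule (C : Type) where
  step : C → C → C → C → C
  guess : C → Bool → Bool → C

namespace CellRule

variable {C : Type}

open Classical in
/-- A cell as a string of bits. -/
noncomputable def encodeCell (c : C) : C → Bool := fun c' => decide (c' = c)

theorem encodeCell_injective : Function.Injective (encodeCell (C := C)) := by
  intro c c' h
  have := congrFun h c
  simpa [encodeCell] using this

/-- All cells. -/
noncomputable def cells (C : Type) [Finite C] : List C :=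
  (@Finset.univ C (Fintype.ofFinite C)).toList

theorem mem_cells [Finite C] (c : C) : c ∈ cells C := by simp [cells]

section Decode

variable [Nonempty C]

/-- The cell that is represented by a string of bits. -/
noncomputable def decodeCell (x : C → Bool) : C := Function.invFun encodeCell x

@[simp]
theorem decodeCell_encodeCell (c : C) : decodeCell (encodeCell c) = c :=
  Function.leftInverse_invFun encodeCell_injective c

variable (R : CellRule C)

/-- The cell that a block computes. -/
noncomputable def value (x : CellVar C → Bool) : C :=
  if x .isStep then
    R.step (decodeCell fun c => x (.neighbour 0 c)) (decodeCell fun c => x (.neighbour 1 c))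
      (decodeCell fun c => x (.neighbour 2 c)) (decodeCell fun c => x (.neighbour 3 c))
  else if x .isGuess then
    R.guess (decodeCell fun c => x (.neighbour 0 c)) (x (.guess false)) (x (.guess true))
  else decodeCell fun c => x (.const c)

variable [Finite C]

/-- One expression serves all three kinds of blocks, the kind being signalled by constant wires. All
blocks therefore have the same width, depending only on the rule, and the distance between two cells
is a multiple of it. -/
theorem exists_expr (c : C) :
    ∃ φ : BoolExpr (CellVar C), ∀ x, φ.eval x = encodeCell (R.value x) c :=
  BoolExpr.exists_eval_eq _

/-- An expression for one bit of the cell that a block computes. -/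
noncomputable def expr (c : C) : BoolExpr (CellVar C) := (R.exists_expr c).choose

theorem eval_expr (c : C) (x : CellVar C → Bool) :
    (R.expr c).eval x = encodeCell (R.value x) c := (R.exists_expr c).choose_spec x

/-- The number of gates for one cell. -/
noncomputable def width : ℕ := blockSize R.expr (cells C)

open Classical in
/-- The positions of the bits of a cell, counted from the end of its block. -/
noncomputable def pos (c : C) : ℕ := blockPos R.expr (cells C) c

theorem pos_lt (c : C) : R.pos c < R.width := by
  classical
  exact blockPos_lt _ (mem_cells c)

theorem two_le_width [Nontrivial C] : 2 ≤ R.width := by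
  refine le_trans ?_ (length_le_blockSize _ _)
  rw [cells, Finset.length_toList]
  exact (@Fintype.one_lt_card _ (Fintype.ofFinite C) _)

/-- The wires of a block. Rows have `s + 2` cells, and `gi` is the distance to the guessed bits. -/
noncomputable def wire (s gi : ℕ) : CellBlock C → CellVar C → Wire
  | .step, .isStep => .const true
  | .step, .neighbour 0 c => .node (R.pos c)
  | .step, .neighbour 1 c => .node ((s + 2) * R.width + R.pos c)
  | .step, .neighbour 2 c => .node ((s + 1) * R.width + R.pos c)
  | .step, .neighbour 3 c => .node (s * R.width + R.pos c)
  | .guess, .isGuess => .const true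
  | .guess, .neighbour 0 c => .node (R.pos c)
  | .guess, .guess false => .node gi
  | .guess, .guess true => .node (gi + 1)
  | .const c, .const c' => .const (encodeCell c c')
  | _, _ => .const false

/-- The gates of a block. -/
noncomputable def gates (s gi : ℕ) (b : CellBlock C) : List Gate :=
  blockGates R.expr (R.wire s gi b) 0 (cells C)

theorem length_gates (s gi : ℕ) (b : CellBlock C) : (R.gates s gi b).length = R.width :=
  length_blockGates _ _ _ _

/-- The cell that is read from the bits at a given distance. -/
noncomputable def readCell (vals : List Bool) (i : ℕ) : C :=
  decodeCell fun c => vals.getD (i + R.pos c) false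

/-- The next cell after the cells `acc`, latest cell first, where `z` are the values of the
variables. -/
noncomputable def next (s gi : ℕ) (z : List Bool) (acc : List C) : CellBlock C → C
  | .const c => c
  | .guess => R.guess (acc.getD 0 (R.readCell z 0)) (z.getD (gi - acc.length * R.width) false)
      (z.getD (gi + 1 - acc.length * R.width) false)
  | .step => R.step (acc.getD 0 (R.readCell z 0)) (acc.getD (s + 2) (R.readCell z 0))
      (acc.getD (s + 1) (R.readCell z 0)) (acc.getD s (R.readCell z 0))

/-- All cells, latest cell first. -/
noncomputable def run (s gi : ℕ) (z : List Bool) (bs : List (CellBlock C)) (acc : List C) : List C :=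
  bs.foldl (fun acc b => R.next s gi z acc b :: acc) acc

theorem length_run (s gi : ℕ) (z : List Bool) (bs : List (CellBlock C)) (acc : List C) :
    (R.run s gi z bs acc).length = acc.length + bs.length := by
  induction bs generalizing acc with
  | nil => rfl
  | cons b bs ih =>
    refine (ih _).trans ?_
    simp only [List.length_cons]
    omega

/-- The list `vals` of node values represents the cells `acc`. -/
def Represents (z vals : List Bool) (acc : List C) : Prop :=
  ∃ new : List Bool, vals = new ++ z ∧ new.length = acc.length * R.width ∧
    ∀ (j : ℕ) (hj : j < acc.length) (c : C),
      new.getD (j * R.width + R.pos c) false = encodeCell acc[j] c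

/-- There are enough nodes for the wires of a block, if it comes after `j` other blocks and `N`
variables. -/
def BlockValid (s gi N j : ℕ) : CellBlock C → Prop
  | .const _ => True
  | .guess => j * R.width ≤ gi ∧ gi + 1 < N + j * R.width
  | .step => s + 2 ≤ j

/-- There are enough nodes for the wires of a list of blocks. -/
def BlocksValid (s gi N : ℕ) : ℕ → List (CellBlock C) → Prop
  | _, [] => True
  | j, b :: bs => R.BlockValid s gi N j b ∧ BlocksValid s gi N (j + 1) bs

theorem blocksValid_append {s gi N j : ℕ} {bs bs' : List (CellBlock C)}
    (h : R.BlocksValid s gi N j bs) (h' : R.BlocksValid s gi N (j + bs.length) bs') :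
    R.BlocksValid s gi N j (bs ++ bs') := by
  induction bs generalizing j with
  | nil => exact h'
  | cons b bs ih =>
    refine ⟨h.1, ih h.2 ?_⟩
    rwa [List.length_cons, Nat.add_comm bs.length, ← Nat.add_assoc] at h'

/-- A block may refer to a cell just before the first one, whose bits would lie among the variables;
`hN` provides nodes for such a reference. -/
theorem wire_fits {s gi N j : ℕ} (hN : R.width ≤ N) {b : CellBlock C}
    (hb : R.BlockValid s gi N j b) (v : CellVar C) :
    (R.wire s gi b v).Fits (N + j * R.width) := by
  have hp := R.pos_lt
  rcases b with c | _ | _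
  · rcases v with _ | _ | c' | ⟨k, c'⟩ | k <;> exact trivial
  · obtain ⟨h₁, h₂⟩ := hb
    rcases v with _ | _ | c' | ⟨k, c'⟩ | k
    · trivial
    · trivial
    · trivial
    · have := hp c'
      fin_cases k
      · exact (by omega : R.pos c' < N + j * R.width)
      all_goals trivial
    · cases k
      · exact (by omega : gi < N + j * R.width)
      · exact h₂
  · have hb : s + 2 ≤ j := hb
    have h₀ := Nat.mul_le_mul_right R.width hb
    have h₁ := Nat.mul_le_mul_right R.width (show s + 1 ≤ j by omega)
    have h₂ := Nat.mul_le_mul_right R.width (show s ≤ j by omega)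
    rcases v with _ | _ | c' | ⟨k, c'⟩ | k
    · trivial
    · trivial
    · trivial
    · have := hp c'
      fin_cases k
      · exact (by omega : R.pos c' < N + j * R.width)
      · exact (by omega : (s + 2) * R.width + R.pos c' < N + j * R.width)
      · exact (by omega : (s + 1) * R.width + R.pos c' < N + j * R.width)
      · exact (by omega : s * R.width + R.pos c' < N + j * R.width)
    · trivial

theorem gates_fit {s gi N : ℕ} (hN : R.width ≤ N) {j : ℕ} {bs : List (CellBlock C)}
    (h : R.BlocksValid s gi N j bs) :
    GatesFit (N + j * R.width) (bs.flatMap (R.gates s gi)) := by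
  induction bs generalizing j with
  | nil => trivial
  | cons b bs ih =>
    rw [List.flatMap_cons]
    refine gatesFit_append (blockGates_fit _ (R.wire_fits hN h.1) 0 _) ?_
    rw [R.length_gates, Nat.add_assoc, ← Nat.succ_mul]
    exact ih h.2

variable {R}

/-- The case `j = acc.length` is included: the wires then reach past all cells into the variables,
and read there the meaningless but definite cell `readCell z 0`. This is why `next` uses it as its
default value. -/
theorem Represents.readCell {z vals : List Bool} {acc : List C} (h : R.Represents z vals acc)
    {j : ℕ} (hj : j ≤ acc.length) :
    R.readCell vals (j * R.width) = acc.getD j (R.readCell z 0) := by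
  obtain ⟨new, rfl, hl, h⟩ := h
  have hp := R.pos_lt
  rcases hj.lt_or_eq with hj | rfl
  · have : (fun c => (new ++ z).getD (j * R.width + R.pos c) false) = encodeCell acc[j] := by
      funext c
      rw [List.getD_append _ _ _ _ ?_, h j hj c]
      rw [hl]
      have := hp c
      have := Nat.mul_le_mul_right R.width hj
      rw [Nat.succ_mul] at this
      omega
    rw [CellRule.readCell, this, decodeCell_encodeCell]
    simp [hj]
  · rw [List.getD_eq_default _ _ le_rfl, CellRule.readCell, CellRule.readCell]
    congr 1
    funext c
    rw [List.getD_append_right _ _ _ _ (by omega), hl]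
    congr 1
    omega

theorem Represents.value {z vals : List Bool} {acc : List C} (h : R.Represents z vals acc)
    {s gi N : ℕ} {b : CellBlock C} (hb : R.BlockValid s gi N acc.length b) :
    R.value (fun v => (R.wire s gi b v).val vals) = R.next s gi z acc b := by
  have hr := fun j => h.readCell (j := j)
  obtain ⟨new, rfl, hl, -⟩ := h
  rcases b with c | _ | _
  · simp only [CellRule.value, wire, Wire.val, Bool.false_eq_true, if_false, next]
    exact decodeCell_encodeCell c
  · obtain ⟨h₁, h₂⟩ := hb
    have h0 := hr 0 (Nat.zero_le _)
    simp only [CellRule.readCell, Nat.zero_mul, Nat.zero_add] at h0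
    simp only [CellRule.value, wire, Wire.val, Bool.false_eq_true, if_false, if_true, next,
      CellRule.readCell, Nat.zero_add, h0]
    rw [List.getD_append_right _ _ _ _ (by omega), List.getD_append_right _ _ _ _ (by omega), hl]
  · have hb : s + 2 ≤ acc.length := hb
    have h0 := hr 0 (Nat.zero_le _)
    have h1 := hr (s + 2) (by omega)
    have h2 := hr (s + 1) (by omega)
    have h3 := hr s (by omega)
    simp only [CellRule.readCell, Nat.zero_mul, Nat.zero_add] at h0 h1 h2 h3
    simp only [CellRule.value, wire, Wire.val, if_true, next, CellRule.readCell, Nat.zero_add, h0,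
      h1, h2, h3]

theorem Represents.gates {z vals : List Bool} {acc : List C} (h : R.Represents z vals acc)
    {s gi N : ℕ} {b : CellBlock C} (hb : R.BlockValid s gi N acc.length b) :
    R.Represents z (runGates (R.gates s gi b) vals) (R.next s gi z acc b :: acc) := by
  classical
  have hv := h.value hb
  obtain ⟨new, rfl, hl, hc⟩ := h
  obtain ⟨new', hl', hr, hc'⟩ := runGates_blockGates R.expr (R.wire s gi b) (cells C) [] (new ++ z)
  have hl'' : new'.length = R.width := hl'
  refine ⟨new' ++ new, ?_, ?_, ?_⟩
  · rw [List.append_assoc]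
    exact hr
  · rw [List.length_append, hl, hl'', List.length_cons, Nat.succ_mul, Nat.add_comm]
  · intro j hj c
    rcases j with _ | j
    · rw [Nat.zero_mul, Nat.zero_add, List.getD_append _ _ _ _ (hl''.symm ▸ R.pos_lt c)]
      have := hc' c (mem_cells c)
      rw [eval_expr, hv] at this
      exact this
    · rw [List.getD_append_right _ _ _ _ (by rw [hl'', Nat.succ_mul]; omega), hl'']
      have : (j + 1) * R.width + R.pos c - R.width = j * R.width + R.pos c := by
        rw [Nat.succ_mul]
        omega
      rw [this]
      exact hc j (by simpa using hj) c

theorem Represents.run {z vals : List Bool} {acc : List C} (h : R.Represents z vals acc)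
    {s gi N : ℕ} {bs : List (CellBlock C)} (hb : R.BlocksValid s gi N acc.length bs) :
    R.Represents z (runGates (bs.flatMap (R.gates s gi)) vals) (R.run s gi z bs acc) := by
  induction bs generalizing vals acc with
  | nil => exact h
  | cons b bs ih =>
    rw [List.flatMap_cons, runGates_append]
    exact ih (h.gates hb.1) hb.2

variable (R)

theorem exists_outputExpr (f : C → Bool) :
    ∃ φ : BoolExpr C, ∀ x, φ.eval x = f (decodeCell x) :=
  BoolExpr.exists_eval_eq _

/-- An expression for a bit that depends on one cell. -/
noncomputable def outputExpr (f : C → Bool) : BoolExpr C := (exists_outputExpr f).choose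

theorem eval_outputExpr (f : C → Bool) (x : C → Bool) :
    (outputExpr f).eval x = f (decodeCell x) := (exists_outputExpr f).choose_spec x

/-- The gates for the output, which depends on the second cell of the last row. -/
noncomputable def outputGates (s : ℕ) (f : C → Bool) : List Gate :=
  (outputExpr f).gates (fun c => .node (s * R.width + R.pos c)) 0

/-- The co-nondeterministic circuit given by a list of blocks. -/
noncomputable def circuit {n : ℕ} (s gi g : ℕ) (bs : List (CellBlock C)) (f : C → Bool)
    (hg : R.width ≤ g) (hb : R.BlocksValid s gi (n + g) 0 bs) (hs : s ≤ bs.length) :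
    CoNondetCircuit n where
  guess := g
  gates := bs.flatMap (R.gates s gi) ++ R.outputGates s f
  gates_ne_nil h := by
    have := congrArg List.length (List.append_eq_nil_iff.1 h).2
    rw [outputGates, BoolExpr.length_gates] at this
    have := (outputExpr f).size_pos
    simp_all
  fit := by
    have h := R.gates_fit (N := n + g) (by omega) hb
    rw [Nat.zero_mul, Nat.add_zero] at h
    refine gatesFit_append h (BoolExpr.gates_fit (fun c => ?_) _ 0)
    have h₁ : (bs.flatMap (R.gates s gi)).length = bs.length * R.width := by
      simp [List.length_flatMap, R.length_gates]
    have h₂ := R.pos_lt c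
    have h₃ := Nat.mul_le_mul_right R.width hs
    rw [h₁]
    exact (by omega : s * R.width + R.pos c < n + g + bs.length * R.width)

theorem output_circuit {n : ℕ} {s gi g : ℕ} {bs : List (CellBlock C)} {f : C → Bool}
    {hg : R.width ≤ g} {hb : R.BlocksValid s gi (n + g) 0 bs} {hs : s ≤ bs.length} (z : List Bool) :
    (R.circuit (n := n) s gi g bs f hg hb hs).output z =
      f ((R.run s gi z bs []).getD s (R.readCell z 0)) := by
  have h₀ : R.Represents z z [] := ⟨[], rfl, by simp, by simp⟩
  have h := h₀.run hb
  have hlen : (R.run s gi z bs []).length = bs.length := by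
    simp [R.length_run]
  obtain ⟨new, h₁, h₂, h₃⟩ := (outputExpr f).runGates_gates
    (fun c => .node (s * R.width + R.pos c)) [] (runGates (bs.flatMap (R.gates s gi)) z)
  have : (R.circuit (n := n) s gi g bs f hg hb hs).output z =
      (runGates (bs.flatMap (R.gates s gi) ++ R.outputGates s f) z).headD false := rfl
  rw [this, runGates_append, outputGates]
  have h₂' : runGates ((outputExpr f).gates (fun c => .node (s * R.width + R.pos c)) 0)
    (runGates (bs.flatMap (R.gates s gi)) z) = new ++ runGates (bs.flatMap (R.gates s gi)) z := h₂
  rw [h₂']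
  have h₄ : (new ++ runGates (bs.flatMap (R.gates s gi)) z).headD false = new.getD 0 false := by
    have := (outputExpr f).size_pos
    rcases new with _ | ⟨a, new⟩
    · simp at h₁
      omega
    · rfl
  rw [h₄, h₃, eval_outputExpr]
  congr 1
  exact h.readCell (j := s) (by omega)

end Decode

end CellRule

/-! ### Circuits that simulate stack machines -/

namespace CellRule

variable {C : Type} [Nonempty C] [Finite C] (R : CellRule C) (s gi : ℕ) (z : List Bool)

theorem run_append (bs bs' : List (CellBlock C)) (acc : List C) :
    R.run s gi z (bs ++ bs') acc = R.run s gi z bs' (R.run s gi z bs acc) :=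
  List.foldl_append

theorem run_const (l acc : List C) : R.run s gi z (l.map .const) acc = l.reverse ++ acc := by
  induction l generalizing acc with
  | nil => rfl
  | cons a l ih =>
    refine (ih _).trans ?_
    simp [CellRule.next]

end CellRule

namespace StackSimulation

variable {K : Type} {Γ : K → Type} {Q : Type} [DecidableEq K]

/-- A cell of the table of a computation: a column of the stacks, together with the control state.
The first cell of each row has no symbols. -/
structure Cell (Γ : K → Type) (Q : Type) where
  first : Bool
  state : Q
  sym : ∀ k, Option (Γ k)

instance [Finite K] [∀ k, Finite (Γ k)] [Finite Q] : Finite (Cell Γ Q) :=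
  Finite.of_injective (β := Bool × Q × ∀ k, Option (Γ k)) (fun c => (c.first, c.state, c.sym)) <| by
    rintro ⟨a, b, c⟩ ⟨a', b', c'⟩ h
    simp_all

instance [Inhabited Q] : Nontrivial (Cell Γ Q) :=
  ⟨⟨true, default, fun _ => none⟩, ⟨false, default, fun _ => none⟩, by simp⟩

/-- The cell `i` of the row for a configuration. -/
def cellOf (c : Q × StackStore Γ) (i : ℕ) : Cell Γ Q where
  first := decide (i = 0)
  state := c.1
  sym := if i = 0 then fun _ => none else fun k => (c.2 k)[i - 1]?

/-- The next configuration; configurations that halt stay the same. -/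
def next (act : Q → StackAction Γ Q) (c : Q × StackStore Γ) : Q × StackStore Γ :=
  (stackStep act c).getD c

theorem iterate_next_of_reaches {act : Q → StackAction Γ Q} {t : ℕ} {c c' : Q × StackStore Γ}
    (h : StackReaches act t c c') : (next act)^[t] c = c' := by
  induction t generalizing c with
  | zero => exact h
  | succ t ih =>
    obtain ⟨c₁, h₁, h₂⟩ := h
    rw [Function.iterate_succ_apply, next, h₁]
    exact ih h₂

theorem iterate_next_of_halt {act : Q → StackAction Γ Q} {c : Q × StackStore Γ}
    (h : act c.1 = .halt) (t : ℕ) : (next act)^[t] c = c :=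
  Function.iterate_fixed (by simp [next, stackStep, h]) t

theorem length_next_le (act : Q → StackAction Γ Q) (c : Q × StackStore Γ) (k : K) :
    ((next act c).2 k).length ≤ (c.2 k).length + 1 := by
  simp only [next, stackStep]
  cases act c.1 with
  | push k' a q =>
    by_cases h : k = k'
    · subst h
      simp
    · simp [h]
  | pop k' f =>
    by_cases h : k = k'
    · subst h
      simp
      omega
    · simp [h]
  | halt => simp

theorem length_iterate_next_le (act : Q → StackAction Γ Q) (c : Q × StackStore Γ) (t : ℕ) (k : K) :
    (((next act)^[t] c).2 k).length ≤ (c.2 k).length + t := by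
  induction t with
  | zero => rfl
  | succ t ih =>
    rw [Function.iterate_succ_apply']
    have := length_next_le act ((next act)^[t] c) k
    omega

/-- The local rule of the table of a computation, for the cell before and for the cells on the
left, in the middle and on the right of the row before. -/
def stepCell (act : Q → StackAction Γ Q) (l ul u ur : Cell Γ Q) : Cell Γ Q where
  first := u.first
  state := if u.first then
      match act u.state with
      | .push _ _ q => q
      | .pop k f => f (ur.sym k)
      | .halt => u.state
    else l.state
  sym := if u.first then fun _ => none else
    match act u.state with
    | .push k a _ => Function.update u.sym k (if ul.first then some a else ul.sym k)
    | .pop k _ => Function.update u.sym k (if ur.first then none else ur.sym k)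
    | .halt => u.sym

/-- The tops of the stacks are in cell 1, the right neighbour of cell 0; so cell 0 can find the new
state, which the other cells then copy from their left neighbour in the new row. A push shifts a
stack to the right and a pop shifts it to the left, so three neighbours suffice. The hypotheses on
`l`, `ul` and `ur` are limited to positions where these neighbours exist; a right neighbour marked
`first` signals the end of the row. -/
theorem stepCell_eq (act : Q → StackAction Γ Q) (c : Q × StackStore Γ) {m i : ℕ} (hm : 1 ≤ m)
    (hc : ∀ k, (c.2 k).length ≤ m) (hi : i ≤ m) {l ul ur : Cell Γ Q}
    (hl : 0 < i → l = cellOf (next act c) (i - 1)) (hul : 0 < i → ul = cellOf c (i - 1))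
    (hur : i < m → ur = cellOf c (i + 1)) (hur' : i = m → ur.first = true) :
    stepCell act l ul (cellOf c i) ur = cellOf (next act c) i := by
  rcases i with _ | i
  · rw [hur (by omega)]
    simp only [stepCell, cellOf, next, stackStep]
    cases act c.1 <;> simp [List.head?_eq_getElem?]
  · rw [hl (by omega), hul (by omega)]
    have hstate : ∀ i, (cellOf (next act c) i).state = (next act c).1 := fun i => rfl
    have key : (stepCell act (cellOf (next act c) (i + 1 - 1)) (cellOf c (i + 1 - 1))
        (cellOf c (i + 1)) ur).sym = (cellOf (next act c) (i + 1)).sym := by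
      have hrs : ∀ k, (if ur.first then none else ur.sym k) = (c.2 k)[i + 1]? := by
        intro k
        rcases Nat.lt_or_ge (i + 1) m with h | h
        · rw [hur h]
          simp [cellOf]
        -- Beyond the last cell of the row all stacks are empty, by `hc`.
        · rw [hur' (by omega), if_pos rfl, List.getElem?_eq_none]
          have := hc k
          omega
      simp only [stepCell, hrs]
      simp only [cellOf, next, stackStep]
      cases act c.1 with
      | push k' a q =>
        funext k
        by_cases h : k = k'
        · subst h
          rcases i with _ | i <;> simp
        · simp [h]
      | pop k' f =>
        funext k
        by_cases h : k = k'
        · subst h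
          simp
        · simp [h]
      | halt => simp
    have h₁ : (stepCell act (cellOf (next act c) (i + 1 - 1)) (cellOf c (i + 1 - 1))
        (cellOf c (i + 1)) ur).first = (cellOf (next act c) (i + 1)).first := rfl
    have h₂ : (stepCell act (cellOf (next act c) (i + 1 - 1)) (cellOf c (i + 1 - 1))
        (cellOf c (i + 1)) ur).state = (cellOf (next act c) (i + 1)).state := rfl
    exact (Cell.mk.injEq ..).mpr ⟨h₁, h₂, key⟩

section Input

variable (q₀ : Q) (k₀ : K)

/-- The first cell of the first row. -/
def headCell : Cell Γ Q := ⟨true, q₀, fun _ => none⟩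

/-- A cell of the first row without symbols. -/
def blankCell : Cell Γ Q := ⟨false, q₀, fun _ => none⟩

/-- A cell of the first row with a symbol on the input stack. -/
def symCell (a : Γ k₀) : Cell Γ Q := ⟨false, q₀, Function.update (fun _ => none) k₀ (some a)⟩

/-- The cells of the first row for the input `u`. -/
theorem map_cellOf_range (u : List (Γ k₀)) (p : ℕ) :
    (List.range (u.length + p + 1)).map (cellOf (q₀, singleStack k₀ u)) =
      headCell q₀ :: (u.map (symCell q₀ k₀) ++ List.replicate p (blankCell q₀)) := by
  refine List.ext_getElem (by simp) fun i h₁ h₂ => ?_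
  rw [List.getElem_map, List.getElem_range]
  rcases i with _ | i
  · simp [cellOf, headCell]
  · rw [List.getElem_cons_succ]
    have hsym : (cellOf (q₀, singleStack k₀ u) (i + 1)).sym =
        Function.update (fun _ => none) k₀ u[i]? := by
      funext k
      by_cases h : k = k₀
      · subst h
        simp [cellOf]
      · simp [cellOf, h, singleStack]
    by_cases hi : i < u.length
    · rw [List.getElem_append_left (by simpa using hi), List.getElem_map]
      rw [List.getElem?_eq_getElem hi] at hsym
      exact (Cell.mk.injEq ..).mpr ⟨rfl, rfl, hsym⟩
    · rw [List.getElem_append_right (by simpa using hi), List.getElem_replicate]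
      rw [List.getElem?_eq_none (by omega)] at hsym
      refine (Cell.mk.injEq ..).mpr ⟨rfl, rfl, hsym.trans ?_⟩
      simp

/-- The rule for the guessed cells of the first row: after a cell with a symbol, the first bit
decides whether there is another symbol, and the second bit which one. -/
def guessCell (enc : Bool → Γ k₀) (l : Cell Γ Q) (v b : Bool) : Cell Γ Q :=
  if (l.sym k₀).isSome && v then symCell q₀ k₀ (enc b) else blankCell q₀

/-- The string given by guessed bits. -/
def guessed (bits : ℕ → Bool × Bool) : ℕ → ℕ → List Bool
  | _, 0 => []
  | a, m + 1 => if (bits a).1 then (bits a).2 :: guessed bits (a + 1) m else []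

theorem length_guessed_le (bits : ℕ → Bool × Bool) (a m : ℕ) : (guessed bits a m).length ≤ m := by
  induction m generalizing a with
  | zero => rfl
  | succ m ih =>
    simp only [guessed]
    split_ifs
    · simpa using ih (a + 1)
    · simp

theorem guessed_eq (bits : ℕ → Bool × Bool) (a m : ℕ) (y : List Bool) (hy : y.length ≤ m)
    (h : ∀ i < m, bits (a + i) = (decide (i < y.length), y.getD i false)) :
    guessed bits a m = y := by
  induction m generalizing a y with
  | zero => exact (List.length_eq_zero_iff.1 (by omega)).symm
  | succ m ih =>
    have h₀ := h 0 (by omega)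
    rw [Nat.add_zero] at h₀
    rcases y with _ | ⟨b, y⟩
    · simp [guessed, h₀]
    · simp only [guessed, h₀]
      simp only [List.length_cons, Nat.zero_lt_succ, decide_true, if_true, List.getD_cons_zero]
      rw [ih (a + 1) y (by simpa using hy)]
      intro i hi
      have := h (i + 1) (by omega)
      rw [Nat.add_assoc, Nat.add_comm 1, this]
      simp

/-- The rules for the cells of a computation with a guessed input. -/
def rule (act : Q → StackAction Γ Q) (enc : Bool → Γ k₀) : CellRule (Cell Γ Q) where
  step := stepCell act
  guess := guessCell q₀ k₀ enc

variable [Finite K] [∀ k, Finite (Γ k)] [Finite Q] [Inhabited Q] (act : Q → StackAction Γ Q)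
  (enc : Bool → Γ k₀) (s gi : ℕ) (z : List Bool)

/-- The bits that are guessed for the cell number `a`. -/
def guessBits (B a : ℕ) : Bool × Bool :=
  (z.getD (gi - a * B) false, z.getD (gi + 1 - a * B) false)

/-- A blank forces all later guessed cells to be blank, whatever the guessed bits. So each
assignment to the universal variables describes some string without gaps. -/
theorem run_guess_blank (m : ℕ) (acc : List (Cell Γ Q)) (c : Cell Γ Q) (hc : c.sym k₀ = none) :
    (rule q₀ k₀ act enc).run s gi z (List.replicate m .guess) (c :: acc) =
      List.replicate m (blankCell q₀) ++ c :: acc := by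
  induction m generalizing c acc with
  | zero => rfl
  | succ m ih =>
    have h : (rule q₀ k₀ act enc).next s gi z (c :: acc) .guess = blankCell q₀ := by
      simp [CellRule.next, rule, guessCell, hc]
    rw [List.replicate_succ]
    refine (congrArg _ (congrArg (· :: c :: acc) h)).trans ((ih _ _ rfl).trans ?_)
    rw [List.append_cons, ← List.replicate_succ']

/-- Guessing has to start behind a cell that carries a symbol; in the application this is the comma
between the word and the witness. -/
theorem run_guess (m : ℕ) (acc : List (Cell Γ Q)) (a : Γ k₀) :
    (rule q₀ k₀ act enc).run s gi z (List.replicate m .guess) (symCell q₀ k₀ a :: acc) =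
      ((guessed (guessBits gi z (rule q₀ k₀ act enc).width) (acc.length + 1) m).map
        (fun b => symCell q₀ k₀ (enc b)) ++
        List.replicate (m - (guessed (guessBits gi z (rule q₀ k₀ act enc).width)
          (acc.length + 1) m).length) (blankCell q₀)).reverse ++ symCell q₀ k₀ a :: acc := by
  induction m generalizing a acc with
  | zero => rfl
  | succ m ih =>
    rw [List.replicate_succ]
    by_cases hv : (guessBits gi z (rule q₀ k₀ act enc).width (acc.length + 1)).1
    · have h : (rule q₀ k₀ act enc).next s gi z (symCell q₀ k₀ a :: acc) .guess =
          symCell q₀ k₀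
            (enc (guessBits gi z (rule q₀ k₀ act enc).width (acc.length + 1)).2) := by
        simp only [guessBits] at hv ⊢
        simp [CellRule.next, rule, guessCell, symCell] at hv ⊢
        simp [hv]
      refine (congrArg _ (congrArg (· :: symCell q₀ k₀ a :: acc) h)).trans ((ih _ _).trans ?_)
      simp only [guessed, hv, if_true, List.length_cons, List.map_cons]
      simp
    · have h : (rule q₀ k₀ act enc).next s gi z (symCell q₀ k₀ a :: acc) .guess = blankCell q₀ := by
        simp only [guessBits] at hv
        simp [CellRule.next, rule, guessCell, symCell] at hv ⊢
        simp [hv]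
      refine (congrArg _ (congrArg (· :: symCell q₀ k₀ a :: acc) h)).trans
        ((run_guess_blank q₀ k₀ act enc s gi z m _ _ rfl).trans ?_)
      simp only [guessed, hv]
      simp only [Bool.false_eq_true, if_false, List.map_nil, List.nil_append, List.length_nil,
        Nat.sub_zero, List.reverse_replicate]
      rw [List.append_cons, ← List.replicate_succ']

/-- The blocks for the first row: the fixed part `u` of the input, which ends with the symbol `a`,
at most `m` guessed symbols, and `p` blanks. -/
def firstRow (u : List (Γ k₀)) (a : Γ k₀) (m p : ℕ) : List (CellBlock (Cell Γ Q)) :=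
  (headCell q₀ :: (u ++ [a]).map (symCell q₀ k₀)).map .const ++
    (List.replicate m .guess ++ (List.replicate p (blankCell q₀)).map .const)

theorem run_firstRow (u : List (Γ k₀)) (a : Γ k₀) (m p : ℕ) :
    ∃ y : List Bool, y = guessed (guessBits gi z (rule q₀ k₀ act enc).width) (u.length + 2) m ∧
      (rule q₀ k₀ act enc).run s gi z (firstRow q₀ k₀ u a m p) [] =
        ((List.range (u.length + m + p + 2)).map
          (cellOf (q₀, singleStack k₀ (u ++ a :: y.map enc)))).reverse := by
  refine ⟨_, rfl, ?_⟩
  set y := guessed (guessBits gi z (rule q₀ k₀ act enc).width) (u.length + 2) m with hy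
  have hle := length_guessed_le (guessBits gi z (rule q₀ k₀ act enc).width) (u.length + 2) m
  rw [← hy] at hle
  have hlen : u.length + m + p + 2 = (u ++ a :: y.map enc).length + (m - y.length + p) + 1 := by
    simp
    omega
  rw [hlen, map_cellOf_range, firstRow, CellRule.run_append,
    CellRule.run_append, CellRule.run_const, CellRule.run_const]
  have h := run_guess q₀ k₀ act enc s gi z m ((u.map (symCell q₀ k₀)).reverse ++ [headCell q₀]) a
  have hl : ((u.map (symCell q₀ k₀)).reverse ++ [headCell q₀]).length + 1 = u.length + 2 := by
    simp
  rw [hl, ← hy] at h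
  have e : (headCell q₀ :: (u ++ [a]).map (symCell q₀ k₀)).reverse ++ [] =
      symCell q₀ k₀ a :: ((u.map (symCell q₀ k₀)).reverse ++ [headCell q₀]) := by
    simp
  rw [e, h, List.replicate_add]
  simp only [List.reverse_append, List.reverse_cons, List.map_append, List.map_cons, List.map_map,
    List.reverse_replicate, List.append_assoc, List.cons_append, List.nil_append,
    Function.comp_def]

/-- The rows are written one after the other in a single sequence, and cell number `j` is cell `j %
(s + 2)` at time `j / (s + 2)`. The neighbours in the row before are then always at the distances `s
+ 2`, `s + 1` and `s`. -/
theorem run_steps (c : Q × StackStore Γ) (N : ℕ)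
    (hN : ∀ t, ∀ k, t * (s + 2) < s + 2 + N → (((next act)^[t] c).2 k).length ≤ s + 1) :
    (rule q₀ k₀ act enc).run s gi z (List.replicate N .step)
      ((List.range (s + 2)).map (cellOf c)).reverse =
      ((List.range (s + 2 + N)).map fun j =>
        cellOf ((next act)^[j / (s + 2)] c) (j % (s + 2))).reverse := by
  induction N with
  | zero =>
    refine congrArg List.reverse (List.map_congr_left fun j hj => ?_)
    rw [List.mem_range] at hj
    rw [Nat.div_eq_of_lt hj, Nat.mod_eq_of_lt hj]
    rfl
  | succ N ih =>
    specialize ih fun t k h => hN t k (by omega)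
    rw [List.replicate_succ', CellRule.run_append, ih, ← Nat.add_assoc, List.range_succ, List.map_append,
      List.reverse_append]
    set cell : ℕ → Cell Γ Q := fun j => cellOf ((next act)^[j / (s + 2)] c) (j % (s + 2)) with hcell
    set acc := ((List.range (s + 2 + N)).map cell).reverse with hacc
    have hlen : acc.length = s + 2 + N := by simp [hacc]
    have hget : ∀ (p : ℕ) (d : Cell Γ Q), p < s + 2 + N → acc.getD p d = cell (s + 2 + N - 1 - p) := by
      intro p d hp
      rw [List.getD_eq_getElem _ _ (by omega)]
      simp [hacc]
    refine congrArg (· :: acc) ?_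
    change stepCell act (acc.getD 0 _) (acc.getD (s + 2) _) (acc.getD (s + 1) _) (acc.getD s _) = _
    rw [hget 0 _ (by omega), hget (s + 1) _ (by omega), hget s _ (by omega)]
    have e₁ : s + 2 + N - 1 - (s + 1) = N := by omega
    have e₂ : s + 2 + N - 1 - s = N + 1 := by omega
    have e₃ : s + 2 + N - 1 - 0 = s + 2 + N - 1 := by omega
    rw [e₁, e₂, e₃]
    have hdm := Nat.div_add_mod N (s + 2)
    have hmod := Nat.mod_lt N (show 0 < s + 2 by omega)
    set t := N / (s + 2) with ht
    set i := N % (s + 2) with hi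
    have hdiv : ∀ t i, i < s + 2 → ((s + 2) * t + i) / (s + 2) = t := by
      intro t i h
      rw [Nat.mul_add_div (by omega), Nat.div_eq_of_lt h, Nat.add_zero]
    have hmod' : ∀ t i, i < s + 2 → ((s + 2) * t + i) % (s + 2) = i := by
      intro t i h
      rw [Nat.mul_add_mod, Nat.mod_eq_of_lt h]
    have hcell' : ∀ t i, i < s + 2 → cell ((s + 2) * t + i) = cellOf ((next act)^[t] c) i := by
      intro t i h
      rw [hcell]
      simp only [hdiv t i h, hmod' t i h]
    have hnew : s + 2 + N = (s + 2) * (t + 1) + i := by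
      rw [Nat.mul_succ]
      omega
    have hgoal : cell (s + 2 + N) = cellOf (next act ((next act)^[t] c)) i := by
      rw [hnew, hcell' _ _ hmod, Function.iterate_succ_apply']
    have hu : cell N = cellOf ((next act)^[t] c) i := by
      conv_lhs => rw [← hdm]
      exact hcell' _ _ hmod
    change _ = cell (s + 2 + N)
    rw [hgoal, hu]
    refine stepCell_eq act ((next act)^[t] c) (m := s + 1) (by omega) (fun k => hN t k ?_)
      (by omega) (fun h0 => ?_) (fun h0 => ?_) (fun h1 => ?_) (fun h1 => ?_)
    · rw [Nat.mul_comm]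
      omega
    · rw [show s + 2 + N - 1 = (s + 2) * (t + 1) + (i - 1) by omega, hcell' _ _ (by omega),
        Function.iterate_succ_apply']
    -- For the very first computed cell the distance `s + 2` points outside the list; but that cell
    -- has `i = 0` and needs no upper left neighbour.
    · have : s + 2 < s + 2 + N := by
        rcases Nat.eq_zero_or_pos N with h | h
        · rw [h] at hi
          simp at hi
          omega
        · omega
      rw [hget _ _ this, show s + 2 + N - 1 - (s + 2) = (s + 2) * t + (i - 1) by omega,
        hcell' _ _ (by omega)]
    · rw [show N + 1 = (s + 2) * t + (i + 1) by omega, hcell' _ _ (by omega)]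
    -- At the end of a row, distance `s` leads to the first cell of the row under construction,
    -- which is marked `first`.
    · rw [show N + 1 = (s + 2) * (t + 1) + 0 by rw [Nat.mul_succ]; omega, hcell' _ _ (by omega)]
      rfl

end Input

end StackSimulation

/-! ### Co-nondeterministic circuits that refute a verifier -/

namespace CellRule

variable {C : Type} [Nonempty C] [Finite C] (R : CellRule C)

theorem blocksValid_const (s gi N j : ℕ)
    (l : List C) : R.BlocksValid s gi N j (l.map .const) := by
  induction l generalizing j with
  | nil => trivial
  | cons c l ih => exact ⟨trivial, ih _⟩

theorem blocksValid_replicate (s gi N j m : ℕ) (b : CellBlock C) (h : ∀ i < m, R.BlockValid s gi N (j + i) b) :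
    R.BlocksValid s gi N j (List.replicate m b) := by
  induction m generalizing j with
  | zero => trivial
  | succ m ih =>
    refine ⟨h 0 (by omega), ih _ fun i hi => ?_⟩
    rw [Nat.add_assoc, Nat.add_comm 1]
    exact h (i + 1) (by omega)

end CellRule

namespace StackSimulation

variable {K : Type} {Γ : K → Type} {Q : Type} [DecidableEq K] (q₀ : Q) (k₀ k₁ : K) (act : Q → StackAction Γ Q) (enc : Bool → Γ k₀)
  (yes : Γ k₁) (u : List (Γ k₀)) (a : Γ k₀) (m T : ℕ)

/-- The blocks for `T` steps of a computation with the input `u`, `a`, and at most `m` guessed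
symbols. -/
def blocks : List (CellBlock (Cell Γ Q)) :=
  firstRow q₀ k₀ u a m T ++ List.replicate (T * (u.length + m + T + 2)) .step

theorem length_firstRow (p : ℕ) : (firstRow q₀ k₀ u a m p).length = u.length + m + p + 2 := by
  simp [firstRow]
  omega

theorem length_blocks :
    (blocks q₀ k₀ u a m T).length = (T + 1) * (u.length + m + T + 2) := by
  rw [blocks, List.length_append, length_firstRow, List.length_replicate]
  ring

variable [Finite K] [∀ k, Finite (Γ k)] [Finite Q] [Inhabited Q]

/-- The `i`-th guessed cell is block number `|u| + 2 + i`, so the same distance leads each guessed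
cell to other variables: to those at `n + width * (m - i)` and at the next position. Spacing the
variables by the width of a block is wasteful, but it makes the guess blocks identical. The summand
`n` skips the input variables, which are never read as guesses. -/
theorem blocksValid_blocks (n : ℕ) :
    (rule q₀ k₀ act enc).BlocksValid (u.length + m + T)
      (n + (rule q₀ k₀ act enc).width * (u.length + 2 + m))
      (n + (rule q₀ k₀ act enc).width * (m + 1)) 0 (blocks q₀ k₀ u a m T) := by
  set R := rule q₀ k₀ act enc with hR
  have hw := R.two_le_width
  refine R.blocksValid_append (R.blocksValid_append (R.blocksValid_const _ _ _ _ _)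
    (R.blocksValid_append (R.blocksValid_replicate _ _ _ _ _ _ fun i hi => ?_)
      (R.blocksValid_const _ _ _ _ _))) (R.blocksValid_replicate _ _ _ _ _ _ fun i hi => ?_)
  · simp only [CellRule.BlockValid, List.length_map, List.length_cons, List.length_append,
      List.length_nil]
    have e : 0 + (u.length + (0 + 1) + 1) + i = u.length + 2 + i := by omega
    rw [e, Nat.mul_comm _ R.width]
    constructor
    · exact le_add_left (Nat.mul_le_mul_left _ (by omega))
    · rw [Nat.mul_add _ _ m, Nat.mul_add _ _ i, Nat.mul_succ _ m]
      omega
  · simp only [CellRule.BlockValid, length_firstRow]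
    omega

/-- The circuit that rejects if some guessed string makes the computation output `yes`. -/
noncomputable def refuter (n : ℕ) : CoNondetCircuit n :=
  open Classical in
  (rule q₀ k₀ act enc).circuit (u.length + m + T)
    (n + (rule q₀ k₀ act enc).width * (u.length + 2 + m)) ((rule q₀ k₀ act enc).width * (m + 1))
    (blocks q₀ k₀ u a m T) (fun c => decide (c.sym k₁ ≠ some yes))
    (Nat.le_mul_of_pos_right _ m.succ_pos) (blocksValid_blocks q₀ k₀ act enc u a m T n)
    (by rw [length_blocks, Nat.succ_mul]; omega)

/-- The last row is the configuration after `T` steps, and rows of `|u| + m + T + 2` cells are wide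
enough because a stack grows by at most one symbol per step. -/
theorem output_refuter (n : ℕ) (z : List Bool) :
    ∃ y, y = guessed (guessBits (n + (rule q₀ k₀ act enc).width * (u.length + 2 + m)) z
        (rule q₀ k₀ act enc).width) (u.length + 2) m ∧
      ((refuter q₀ k₀ k₁ act enc yes u a m T n).output z = true ↔
        (((next act)^[T] (q₀, singleStack k₀ (u ++ a :: y.map enc))).2 k₁).head? ≠ some yes) := by
  classical
  set gi := n + (rule q₀ k₀ act enc).width * (u.length + 2 + m) with hgi
  obtain ⟨y, hy, hrun⟩ := run_firstRow q₀ k₀ act enc (u.length + m + T) gi z u a m T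
  refine ⟨y, hy, ?_⟩
  have hyl : y.length ≤ m := hy ▸ length_guessed_le _ _ _
  rw [refuter, CellRule.output_circuit, blocks, CellRule.run_append, hrun, run_steps]
  · set s := u.length + m + T
    set cell : ℕ → Cell Γ Q := fun j => cellOf ((next act)^[j / (s + 2)]
      (q₀, singleStack k₀ (u ++ a :: y.map enc))) (j % (s + 2)) with hcell
    have hlt : s < ((List.range (s + 2 + T * (s + 2))).map cell).reverse.length := by
      simp
      omega
    rw [List.getD_eq_getElem _ _ hlt, List.getElem_reverse, List.getElem_map, List.getElem_range]
    -- Counted from the end, position `s` is cell 1 of row `T`, which holds the tops of the stacks.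
    have hi : ((List.range (s + 2 + T * (s + 2))).map cell).length - 1 - s = (s + 2) * T + 1 := by
      rw [List.length_map, List.length_range, Nat.mul_comm]
      omega
    rw [hi, hcell, decide_eq_true_iff]
    simp only
    rw [Nat.mul_add_div (by omega), Nat.mul_add_mod, Nat.div_eq_of_lt (by omega),
      Nat.mod_eq_of_lt (by omega)]
    simp [cellOf, List.head?_eq_getElem?]
  · intro t k ht
    refine (length_iterate_next_le _ _ _ _).trans ?_
    have hk : (singleStack k₀ (u ++ a :: y.map enc) k).length ≤ u.length + 1 + m := by
      by_cases h : k = k₀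
      · subst h
        simp [singleStack]
        omega
      · simp [singleStack, h]
    have : t ≤ T := by
      by_contra! h
      have := Nat.mul_le_mul_right (u.length + m + T + 2) h
      rw [Nat.succ_mul] at this
      omega
    simp only
    omega

/-- Because `2 ≤ B`, the pairs of variables read by different cells are disjoint, so they can be set
independently. -/
theorem exists_guessed (n : ℕ) (w : List Bool) (hw : w.length = n) (B b₀ : ℕ) (hB : 2 ≤ B)
    (y : List Bool) (hy : y.length ≤ m) :
    ∃ z : List Bool, z.length = B * (m + 1) ∧
      guessed (guessBits (n + B * (b₀ + m)) (w ++ z) B) b₀ m = y := by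
  -- Group `m - i` of `B` variables belongs to symbol `i`: its first variable says whether the
  -- symbol exists, the second one which it is. The others are never read.
  refine ⟨(List.range (B * (m + 1))).map fun p =>
    if p % B = 0 then decide (m - p / B < y.length) else y.getD (m - p / B) false, by simp,
    guessed_eq _ _ _ _ hy fun i hi => ?_⟩
  have key : ∀ k < 2, n + B * (b₀ + m) + k - (b₀ + i) * B = n + (B * (m - i) + k) := by
    intro k hk
    have e : B * (b₀ + m) = (b₀ + i) * B + B * (m - i) := by
      rw [Nat.mul_comm _ B, ← Nat.mul_add]
      congr 1
      omega
    rw [e]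
    omega
  have hlt : ∀ k < 2, B * (m - i) + k < B * (m + 1) := by
    intro k hk
    have := Nat.mul_le_mul_left B (Nat.sub_le m i)
    rw [Nat.mul_succ]
    omega
  have hdiv : ∀ k < 2, (B * (m - i) + k) / B = m - i ∧ (B * (m - i) + k) % B = k := by
    intro k hk
    rw [Nat.mul_add_div (by omega), Nat.mul_add_mod, Nat.div_eq_of_lt (by omega),
      Nat.mod_eq_of_lt (by omega)]
    simp
  have hget : ∀ k < 2, (w ++ (List.range (B * (m + 1))).map fun p =>
      if p % B = 0 then decide (m - p / B < y.length) else y.getD (m - p / B) false).getD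
      (n + B * (b₀ + m) + k - (b₀ + i) * B) false =
      if k = 0 then decide (i < y.length) else y.getD i false := by
    intro k hk
    rw [key k hk, List.getD_append_right _ _ _ _ (by omega), hw, Nat.add_sub_cancel_left,
      List.getD_eq_getElem _ _ (by simpa using hlt k hk)]
    have e : m - (m - i) = i := by omega
    simp [hdiv k hk, e]
  exact Prod.ext (hget 0 (by omega)) (hget 1 (by omega))

/-- Halting configurations are repeated, so row `T` shows the result even if the computation ends
earlier. Every assignment yields a string of length at most `m` and every such string arises, so the
universal variables range over all witnesses, independently of `w`. -/
theorem accepts_refuter {f : List Bool → Bool} {out : Bool → Γ k₁}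
    (hout : ∀ b, out b = yes ↔ b = true)
    (h : ∀ y : List Bool, y.length ≤ m → ∃ t ≤ T, ∃ q, act q = .halt ∧
      StackReaches act t (q₀, singleStack k₀ (u ++ a :: y.map enc)) (q, singleStack k₁ [out (f y)]))
    {n : ℕ} {w : List Bool} (hw : w.length = n) :
    (refuter q₀ k₀ k₁ act enc yes u a m T n).Accepts w ↔
      ¬ ∃ y : List Bool, y.length ≤ m ∧ f y = true := by
  have key : ∀ y : List Bool, y.length ≤ m →
      ((((next act)^[T] (q₀, singleStack k₀ (u ++ a :: y.map enc))).2 k₁).head? ≠ some yes ↔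
        ¬ f y = true) := by
    intro y hy
    obtain ⟨t, ht, q, hq, hr⟩ := h y hy
    obtain ⟨t', rfl⟩ := Nat.exists_eq_add_of_le ht
    rw [Nat.add_comm, Function.iterate_add_apply, iterate_next_of_reaches hr,
      iterate_next_of_halt hq]
    simp [singleStack, hout]
  constructor
  · rintro hacc ⟨y, hy, hfy⟩
    obtain ⟨z, hz, hzy⟩ := exists_guessed m n w hw _ (u.length + 2)
      (rule q₀ k₀ act enc).two_le_width y hy
    obtain ⟨y', hy', ho⟩ := output_refuter q₀ k₀ k₁ act enc yes u a m T n (w ++ z)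
    rw [hzy] at hy'
    subst hy'
    exact (key y' hy).1 (ho.1 (hacc z hz)) hfy
  · intro hno z _
    obtain ⟨y, hy, ho⟩ := output_refuter q₀ k₀ k₁ act enc yes u a m T n (w ++ z)
    have hyl : y.length ≤ m := hy ▸ length_guessed_le _ _ _
    exact ho.2 ((key y hyl).2 fun hf => hno ⟨y, hyl, hf⟩)

theorem size_refuter (n : ℕ) : (refuter q₀ k₀ k₁ act enc yes u a m T n).size =
    n + (rule q₀ k₀ act enc).width * (m + 1) +
      ((T + 1) * (u.length + m + T + 2) * (rule q₀ k₀ act enc).width +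
        (open Classical in CellRule.outputExpr
          fun c : Cell Γ Q => decide (c.sym k₁ ≠ some yes)).size) := by
  have h : ((blocks q₀ k₀ u a m T).flatMap ((rule q₀ k₀ act enc).gates (u.length + m + T)
      (n + (rule q₀ k₀ act enc).width * (u.length + 2 + m)))).length =
      (T + 1) * (u.length + m + T + 2) * (rule q₀ k₀ act enc).width := by
    rw [← length_blocks q₀ k₀ u a m T]
    simp [List.length_flatMap, CellRule.length_gates]
  rw [← h, ← BoolExpr.length_gates, ← List.length_append]
  rfl

end StackSimulation

/-- Every machine is simulated by a structured program. -/
theorem TuringMachine.exists_program {A B : Type} (M : TuringMachine A B) :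
    ∃ (K : Type) (_ : DecidableEq K) (_ : Finite K) (Γ : K → Type) (_ : ∀ k, Finite (Γ k))
      (p : StackProgram Γ) (k₀ k₁ : K) (i : A ≃ Γ k₀) (o : B ≃ Γ k₁),
      ∀ u v t, M.OutputsInTime u v t →
        p.Runs (singleStack k₀ (u.map i)) (singleStack k₁ (v.map o)) ((M.stmtCost + 1) * t + 2) := by
  classical
  have := M.tm.kFin
  have := M.tm.ΛFin
  have := M.tm.σFin
  have := M.finite_alphabet
  let Γ : M.tm.K ⊕ Unit → Type := Sum.elim M.tm.Γ fun _ => M.tm.Λ × M.tm.σ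
  have hΓ : ∀ k, Finite (Γ k) := by
    rintro (k | k)
    · exact M.finite_alphabet k
    · exact (inferInstance : Finite (M.tm.Λ × M.tm.σ))
  refine ⟨M.tm.K ⊕ Unit, inferInstance, inferInstance, Γ, hΓ,
    StackProgram.call Sum.inl (Sum.inr ()) (Γ := Γ) (Λ := M.tm.Λ) (σ := M.tm.σ) id id M.tm.m
      M.tm.main M.tm.initialState, .inl M.tm.k₀, .inl M.tm.k₁, M.inputAlphabet.symm,
    M.outputAlphabet.symm, fun u v t h => ?_⟩
  obtain ⟨t', ht', hit⟩ := h.exists_iterate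
  refine ((StackProgram.runs_call (Γ := Γ) (e := Sum.inl) (c := Sum.inr ()) (enc := id) (dec := id)
    Sum.inl_injective (by simp) (fun _ => rfl) M.le_stmtCost hit
    (S := singleStack (.inl M.tm.k₀) (u.map M.inputAlphabet.symm)) (singleStack_self _ _)
    (fun k hk => singleStack_of_ne _ (by simpa using hk))
    (singleStack_of_ne _ (by simp))).mono ?_).of_eq ?_
  · gcongr
  · exact update_update_singleStack _ _ _ _

/-! ### Strings produced by loops -/

section Generable

variable {α A : Type} (src : α → List A)

/-- The strings `F a` are given by one expression for the sources `src a`. -/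
def Generable {B : Type} (F : α → List B) : Prop :=
  ∃ g : LoopExpr A B, ∀ a, g.out (src a) = F a

/-- Strings can be repeated `N a` times. -/
def LoopCount (N : α → ℕ) : Prop :=
  ∀ (B : Type) (F : α → List B), Generable src F →
    Generable src fun a => (List.replicate (N a) (F a)).flatten

variable {src}

theorem Generable.append {B : Type} {F G : α → List B} (hF : Generable src F)
    (hG : Generable src G) : Generable src fun a => F a ++ G a := by
  obtain ⟨f, hf⟩ := hF
  obtain ⟨g, hg⟩ := hG
  exact ⟨f.append g, fun a => by rw [LoopExpr.out, hf, hg]⟩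

theorem generable_const {B : Type} (l : List B) : Generable src fun _ => l := by
  induction l with
  | nil => exact ⟨.nil, fun _ => rfl⟩
  | cons b l ih => exact Generable.append ⟨.sym b, fun _ => rfl⟩ ih

theorem generable_flatMap {B : Type} {F : A → α → List B} (h : ∀ s, Generable src (F s)) :
    Generable src fun a => (src a).flatMap fun s => F s a := by
  choose g hg using h
  exact ⟨.forEach g, fun a => by simp only [LoopExpr.out, hg]⟩

theorem loopCount_const (k : ℕ) : LoopCount src fun _ => k := by
  intro B F hF
  induction k with
  | zero => exact generable_const []
  | succ k ih =>
    simp only [List.replicate_succ, List.flatten_cons]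
    exact hF.append ih

theorem LoopCount.add {M N : α → ℕ} (hM : LoopCount src M) (hN : LoopCount src N) :
    LoopCount src fun a => M a + N a := by
  intro B F hF
  simp only [List.replicate_add, List.flatten_append]
  exact (hM B F hF).append (hN B F hF)

theorem flatten_replicate_mul {B : Type} (l : List B) (m n : ℕ) :
    (List.replicate (m * n) l).flatten =
      (List.replicate m (List.replicate n l).flatten).flatten := by
  induction m with
  | zero => simp
  | succ m ih =>
    rw [Nat.succ_mul, Nat.add_comm, List.replicate_add, List.flatten_append, ih,
      List.replicate_succ, List.flatten_cons]

theorem LoopCount.mul {M N : α → ℕ} (hM : LoopCount src M) (hN : LoopCount src N) :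
    LoopCount src fun a => M a * N a := by
  intro B F hF
  simp only [flatten_replicate_mul]
  exact hM B _ (hN B F hF)

/-- Loop over the source, and do nothing at the letters that do not satisfy `p`. This recovers the
two parts of a source `1ⁿ x` as separate counters. -/
theorem loopCount_countP (p : A → Bool) : LoopCount src fun a => (src a).countP p := by
  intro B F hF
  have h : ∀ s, Generable src fun a => if p s then F a else [] := by
    intro s
    by_cases hs : p s
    · simpa [hs] using hF
    · simpa [hs] using generable_const []
  convert generable_flatMap h using 2 with a
  change (List.replicate ((src a).countP p) (F a)).flatten = _
  generalize src a = l
  induction l with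
  | nil => rfl
  | cons s l ih =>
    rw [List.flatMap_cons, ← ih]
    by_cases hs : p s
    · simp [hs, List.replicate_succ]
    · simp [hs]

/-- Sums of counters are loops in succession, products are nested loops. -/
theorem LoopCount.eval {N : α → ℕ} (hN : LoopCount src N) (p : Polynomial ℕ) :
    LoopCount src fun a => p.eval (N a) := by
  induction p using Polynomial.induction_on' with
  | add p q hp hq =>
    simp only [Polynomial.eval_add]
    exact hp.add hq
  | monomial k c =>
    simp only [Polynomial.eval_monomial]
    refine (loopCount_const c).mul ?_
    induction k with
    | zero => exact loopCount_const 1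
    | succ k ih =>
      simp only [pow_succ]
      exact ih.mul hN

theorem LoopCount.replicate {B : Type} {N : α → ℕ} (hN : LoopCount src N) (b : B) :
    Generable src fun a => List.replicate (N a) b := by
  have h := hN B (fun _ => [b]) (generable_const [b])
  simpa using h

end Generable

/-! ### Descriptions of circuits produced by loops -/

section Circuits

variable {α A : Type} {src : α → List A}

theorem LoopCount.encodeUnary {N : α → ℕ} (hN : LoopCount src N) :
    Generable src fun a => encodeUnary (N a) := hN.replicate _

/-- A wire that depends on the source. -/
def WireGenerable (src : α → List A) (w : α → Wire) : Prop :=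
  (∃ b, w = fun _ => .const b) ∨ ∃ N, LoopCount src N ∧ w = fun a => .node (N a)

theorem WireGenerable.gate {w : α → Wire} (h : WireGenerable src w) (off : ℕ) :
    Generable src fun a => ((w a).gate off).encode := by
  rcases h with ⟨b, rfl⟩ | ⟨N, hN, rfl⟩
  · exact generable_const _
  · have h := (hN.add (loopCount_const off)).encodeUnary
    exact ((((generable_const _).append h).append (generable_const _)).append h).append
      (generable_const _)

/-- Distances inside the expression do not depend on the source; only the wires do, and they are
written in unary. -/
theorem BoolExpr.generable_gates {V : Type} {ℓ : α → V → Wire}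
    (h : ∀ v, WireGenerable src fun a => ℓ a v) (φ : BoolExpr V) (off : ℕ) :
    Generable src fun a => (φ.gates (ℓ a) off).flatMap Gate.encode := by
  induction φ generalizing off with
  | const b => exact generable_const _
  | var v =>
    simp only [gates, List.flatMap_singleton]
    exact (h v).gate off
  | neg φ ih =>
    simp only [gates, List.flatMap_append]
    exact (ih off).append (generable_const _)
  | and φ ψ ihφ ihψ =>
    simp only [gates, List.flatMap_append]
    exact ((ihφ off).append (ihψ _)).append (generable_const _)
  | or φ ψ ihφ ihψ =>
    simp only [gates, List.flatMap_append]
    exact ((ihφ off).append (ihψ _)).append (generable_const _)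

theorem generable_blockGates {V ι : Type} (φ : ι → BoolExpr V) {ℓ : α → V → Wire}
    (h : ∀ v, WireGenerable src fun a => ℓ a v) (off : ℕ) (l : List ι) :
    Generable src fun a => (blockGates φ (ℓ a) off l).flatMap Gate.encode := by
  induction l generalizing off with
  | nil => exact generable_const []
  | cons i l ih =>
    simp only [blockGates, List.flatMap_append]
    exact ((φ i).generable_gates h off).append (ih _)

namespace CellRule

variable {C : Type} [Nonempty C] [Finite C] (R : CellRule C)

theorem wireGenerable {s gi : α → ℕ} (hs : LoopCount src s) (hgi : LoopCount src gi)
    (b : CellBlock C) (v : CellVar C) : WireGenerable src fun a => R.wire (s a) (gi a) b v := by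
  have hc : ∀ k, LoopCount src fun _ => k := loopCount_const
  cases b with
  | const c => cases v <;> exact .inl ⟨_, rfl⟩
  | guess =>
    rcases v with _ | _ | c | ⟨k, c⟩ | (_ | _)
    · exact .inl ⟨_, rfl⟩
    · exact .inl ⟨_, rfl⟩
    · exact .inl ⟨_, rfl⟩
    · match k with
      | 0 => exact .inr ⟨_, hc (R.pos c), rfl⟩
      | 1 => exact .inl ⟨_, rfl⟩
      | 2 => exact .inl ⟨_, rfl⟩
      | 3 => exact .inl ⟨_, rfl⟩
    · exact .inr ⟨_, hgi, rfl⟩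
    · exact .inr ⟨_, hgi.add (hc 1), rfl⟩
  | step =>
    rcases v with _ | _ | c | ⟨k, c⟩ | (_ | _)
    · exact .inl ⟨_, rfl⟩
    · exact .inl ⟨_, rfl⟩
    · exact .inl ⟨_, rfl⟩
    · match k with
      | 0 => exact .inr ⟨_, hc (R.pos c), rfl⟩
      | 1 => exact .inr ⟨_, ((hs.add (hc 2)).mul (hc R.width)).add (hc (R.pos c)), rfl⟩
      | 2 => exact .inr ⟨_, ((hs.add (hc 1)).mul (hc R.width)).add (hc (R.pos c)), rfl⟩
      | 3 => exact .inr ⟨_, (hs.mul (hc R.width)).add (hc (R.pos c)), rfl⟩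
    · exact .inl ⟨_, rfl⟩
    · exact .inl ⟨_, rfl⟩

theorem generable_gates {s gi : α → ℕ} (hs : LoopCount src s) (hgi : LoopCount src gi)
    (b : CellBlock C) :
    Generable src fun a => (R.gates (s a) (gi a) b).flatMap Gate.encode :=
  generable_blockGates _ (R.wireGenerable hs hgi b) 0 _

theorem generable_outputGates {s : α → ℕ} (hs : LoopCount src s) (f : C → Bool) :
    Generable src fun a => (R.outputGates (s a) f).flatMap Gate.encode :=
  BoolExpr.generable_gates (fun c => .inr ⟨_,
    (hs.mul (loopCount_const R.width)).add (loopCount_const (R.pos c)), rfl⟩) _ 0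

end CellRule

theorem StackSimulation.generable_refuter {K : Type} {Γ : K → Type} {Q : Type} [DecidableEq K]
    [Finite K] [∀ k, Finite (Γ k)] [Finite Q] [Inhabited Q] (q₀ : Q) (k₀ k₁ : K)
    (act : Q → StackAction Γ Q) (enc : Bool → Γ k₀) (yes : Γ k₁) {u : α → List (Γ k₀)}
    (hu : ∀ (B : Type) (F : Γ k₀ → List B), Generable src fun x => (u x).flatMap F)
    (hul : LoopCount src fun x => (u x).length) (a : Γ k₀) {m T n : α → ℕ} (hm : LoopCount src m)
    (hT : LoopCount src T) (hn : LoopCount src n) :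
    Generable src fun x => (refuter q₀ k₀ k₁ act enc yes (u x) a (m x) (T x) (n x)).encode := by
  classical
  set R := rule q₀ k₀ act enc with hR
  have hc : ∀ k, LoopCount src fun _ => k := loopCount_const
  have hs := (hul.add hm).add hT
  have hgi := hn.add ((hc R.width).mul ((hul.add (hc 2)).add hm))
  have hgates := fun b => R.generable_gates hs hgi b
  -- Constant blocks contain no distance that varies with the source. So the text for a letter of
  -- `u` is a fixed string, as `hu` requires.
  have hconst : ∀ (c : Cell Γ Q) (s gi : ℕ), R.gates s gi (.const c) = R.gates 0 0 (.const c) := by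
    intro c s gi
    have : R.wire s gi (.const c) = R.wire 0 0 (.const c) := by
      funext v
      cases v <;> rfl
    rw [CellRule.gates, this, CellRule.gates]
  have hrep : ∀ {N : α → ℕ}, LoopCount src N → ∀ b : CellBlock (Cell Γ Q),
      Generable src fun x => (List.replicate (N x) b).flatMap fun b =>
        (R.gates ((u x).length + m x + T x)
          (n x + R.width * ((u x).length + 2 + m x)) b).flatMap Gate.encode := by
    intro N hN b
    have h := hN _ _ (hgates b)
    simpa only [List.flatMap_def, List.map_replicate] using h
  have henc : ∀ x, (refuter q₀ k₀ k₁ act enc yes (u x) a (m x) (T x) (n x)).encode =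
      encodeUnary (n x) ++ [Computability.Γ'.comma] ++ encodeUnary (R.width * (m x + 1)) ++
      [Computability.Γ'.comma] ++ ((blocks q₀ k₀ (u x) a (m x) (T x)).flatMap
        (R.gates ((u x).length + m x + T x) (n x + R.width * ((u x).length + 2 + m x))) ++
        R.outputGates ((u x).length + m x + T x)
          fun c => decide (c.sym k₁ ≠ some yes)).flatMap Gate.encode := fun x => rfl
  simp only [henc, List.flatMap_append, List.flatMap_assoc, blocks, firstRow, List.map_cons,
    List.map_append, List.map_nil, List.flatMap_cons, List.flatMap_nil, List.map_replicate,
    List.flatMap_map, List.append_nil, List.cons_append]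
  refine Generable.append (Generable.append (Generable.append (Generable.append hn.encodeUnary
    (generable_const _)) ((hc R.width).mul (hm.add (hc 1))).encodeUnary) (generable_const _)) ?_
  refine Generable.append (Generable.append (hgates _) (Generable.append (Generable.append
    (Generable.append ?_ (hgates _)) (Generable.append (hrep hm _) (hrep hT _)))
    (hrep (hT.mul (((hul.add hm).add hT).add (hc 2))) _))) (R.generable_outputGates hs _)
  simp only [hconst]
  exact hu _ _

end Circuits

/-! ### Polynomial bounds -/

theorem Polynomial.monotone_eval_nat (p : Polynomial ℕ) : Monotone fun k => p.eval k := by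
  intro a b h
  induction p using Polynomial.induction_on' with
  | add p q hp hq =>
    simp only [Polynomial.eval_add] at hp hq ⊢
    exact add_le_add hp hq
  | monomial k c =>
    simp only [Polynomial.eval_monomial]
    gcongr

theorem Polynomial.exists_eval_le_mul_pow (p : Polynomial ℕ) :
    ∃ A e : ℕ, ∀ k : ℕ, p.eval k ≤ A * (k + 1) ^ e := by
  induction p using Polynomial.induction_on' with
  | add p q hp hq =>
    obtain ⟨A, e, hp⟩ := hp
    obtain ⟨B, f, hq⟩ := hq
    refine ⟨A + B, e + f, fun k => ?_⟩
    have h₁ : (k + 1) ^ e ≤ (k + 1) ^ (e + f) := Nat.pow_le_pow_right (by omega) (by omega)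
    have h₂ : (k + 1) ^ f ≤ (k + 1) ^ (e + f) := Nat.pow_le_pow_right (by omega) (by omega)
    rw [Polynomial.eval_add, Nat.add_mul]
    exact add_le_add ((hp k).trans (Nat.mul_le_mul_left A h₁))
      ((hq k).trans (Nat.mul_le_mul_left B h₂))
  | monomial d c =>
    refine ⟨c, d, fun k => ?_⟩
    rw [Polynomial.eval_monomial]
    gcongr
    omega

/-! ### Consequences of membership in NP -/

/-- The complement of a language in NP is recognized by co-nondeterministic circuits of polynomial
size that have the word built in, whose descriptions are produced by loops. -/
theorem InNP.exists_circuits {L : Language Bool} (hL : InNP L) :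
    ∃ (D : (n : ℕ) → List Bool → CoNondetCircuit n)
      (g : LoopExpr (Option Bool) Computability.Γ') (A e : ℕ),
      (∀ n x, g.out (List.replicate n none ++ x.map some) = (D n x).encode) ∧
      (∀ n x (w : List Bool), w.length = n → ((D n x).Accepts w ↔ x ∉ L)) ∧
      ∀ n x, (D n x).size ≤ n + A * (x.length + 1) ^ e := by
  obtain ⟨V, f, p, q, hV, hf⟩ := hL
  obtain ⟨K, _, _, Γ, _, P, k₀, k₁, i, o, hP⟩ := V.exists_program
  have := P.finite_label
  -- A pair of a word of length `k` and a witness has length at most `k + 1 + p(k)`. The rest is the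
  -- overhead of simulating the verifier by a program.
  let T : Polynomial ℕ := Polynomial.C (V.stmtCost + 1) * q.comp (Polynomial.X + 1 + p) + 2
  have hT : ∀ k, T.eval k = (V.stmtCost + 1) * q.eval (k + 1 + p.eval k) + 2 := by
    intro k
    simp [T]
  let enc : Bool → Γ k₀ := fun b => i (.bit b)
  let q₀ := P.entry some none
  -- The letter `none` is the unary mark for `n`, so that `n` and `|x|` are both letter counts of
  -- the source.
  let src : ℕ × List Bool → List (Option Bool) := fun a =>
    List.replicate a.1 none ++ a.2.map some
  have hn : LoopCount src fun a => a.1 := by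
    convert loopCount_countP (src := src) (fun s => s.isNone) using 2 with a
    simp [src, List.countP_replicate, List.countP_map, Function.comp_def]
  have hx : LoopCount src fun a => a.2.length := by
    convert loopCount_countP (src := src) (fun s => s.isSome) using 2 with a
    simp [src, List.countP_replicate, List.countP_map, Function.comp_def]
  have hu : ∀ (B : Type) (F : Γ k₀ → List B),
      Generable src fun a => (a.2.map enc).flatMap F := by
    intro B F
    convert generable_flatMap (src := src)
      (F := fun s _ => (s.map fun b => F (enc b)).getD []) (fun s => generable_const _) using 2 with a
    simp [src, List.flatMap_map]
  obtain ⟨g, hg⟩ := StackSimulation.generable_refuter q₀ k₀ k₁ P.control enc (o true) hu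
    (by simpa using hx) (i .comma) (hx.eval p) (hx.eval T) hn
  let width := (StackSimulation.rule q₀ k₀ P.control enc).width
  let c := (open Classical in CellRule.outputExpr fun c : StackSimulation.Cell Γ (Option P.Label) =>
    decide (c.sym k₁ ≠ some (o true))).size
  obtain ⟨A, e, hA⟩ := Polynomial.exists_eval_le_mul_pow
    (Polynomial.C width * (p + 1) +
      ((T + 1) * (Polynomial.X + p + T + 2) * Polynomial.C width + Polynomial.C c))
  refine ⟨fun n x => StackSimulation.refuter q₀ k₀ k₁ P.control enc (o true) (x.map enc) (i .comma)
    (p.eval x.length) (T.eval x.length) n, g, A, e, fun n x => hg (n, x), fun n x w hw => ?_,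
    fun n x => ?_⟩
  · refine (StackSimulation.accepts_refuter q₀ k₀ k₁ P.control enc (o true) _ _ _ _
      (f := f x) (out := o) (fun b => o.apply_eq_iff_eq) (fun y hy => ?_) hw).trans
      (not_congr (hf x).symm)
    have h := hP _ _ _ (hV x y)
    obtain ⟨t, ht, hr⟩ := h _ P.control some none fun l => rfl
    refine ⟨t, ht.trans ?_, none, rfl, ?_⟩
    · rw [hT]
      gcongr
      refine q.monotone_eval_nat ?_
      simp only [encodePair, List.length_append, List.length_cons, List.length_map]
      omega
    · simpa [encodePair, enc, Function.comp_def] using hr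
  · rw [StackSimulation.size_refuter]
    have := hA x.length
    simp only [Polynomial.eval_add, Polynomial.eval_mul, Polynomial.eval_C, Polynomial.eval_one,
      Polynomial.eval_X, Polynomial.eval_ofNat] at this
    rw [List.length_map, Nat.add_assoc]
    exact Nat.add_le_add_left this n

/-- Languages in NP are decidable in exponential time. -/
theorem InNP.exists_exponential_time {L : Language Bool} (hL : InNP L) :
    ∃ (M : TuringMachine Bool Bool) (C e : ℕ), ∀ w : List Bool, ∃ b : Bool,
      M.OutputsInTime w [b] (2 ^ (C * (w.length + 1) ^ e)) ∧ (b = true ↔ w ∈ L) := by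
  classical
  obtain ⟨V, f, p, q, hV, hf⟩ := hL
  have hlen : LoopCount (fun w : List Bool => w) fun w => w.length := by
    simpa using loopCount_countP (src := fun w : List Bool => w) fun _ => true
  have hmap : Generable (fun w : List Bool => w) fun w => w.map some := by
    convert generable_flatMap (src := fun w : List Bool => w) (F := fun s _ => [some s])
      (fun s => generable_const _) using 2 with w
    exact (List.flatMap_pure_eq_map some w).symm
  obtain ⟨g, hg⟩ := hmap.append ((hlen.eval p).replicate none)
  obtain ⟨G, C₀, d, hG⟩ := g.exists_machine
  let S := ExhaustiveSearch.machine V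
  let T : Polynomial ℕ := q.comp (Polynomial.X + 1 + p)
  let X : Polynomial ℕ := Polynomial.X
  -- The exponent adds up `2 * p`, because of `3 ^ m ≤ 2 ^ (2 * m)`, and the polynomial factor `N`
  -- of the running time, because of `N ≤ 2 ^ N`.
  obtain ⟨C, e, hC⟩ := Polynomial.exists_eval_le_mul_pow (2 * p +
    (Polynomial.C ((G.stmtCost + 1) * C₀) * (X + 1) ^ d +
      Polynomial.C (S.stmtCost + 1) * (Polynomial.C (V.stmtCost + 1) * T + 15 * p + 5 * X + 26 +
        (5 * (X + p) + 21)) + 4 * (X + p) + 7))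
  refine ⟨G.comp S, C, e, fun w => ⟨decide (∃ y : List Bool, y.length ≤ p.eval w.length ∧
    f w y = true), ?_, ?_⟩⟩
  · set m := p.eval w.length with hm
    have h₁ := (hG w).2
    rw [hg] at h₁
    have h₂ := ExhaustiveSearch.machine_outputsInTime (V := V) w (f w)
      (q.eval (w.length + 1 + m)) m fun y hy => (hV w y).mono (q.monotone_eval_nat (by
        simp only [encodePair, List.length_append, List.length_cons, List.length_map]
        omega))
    refine (h₁.comp h₂).mono ?_
    refine le_trans ?_ (Nat.pow_le_pow_right (by omega) (hC w.length))
    simp only [Polynomial.eval_add, Polynomial.eval_mul, Polynomial.eval_C, Polynomial.eval_one,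
      Polynomial.eval_X, Polynomial.eval_ofNat, Polynomial.eval_pow, Polynomial.eval_comp, T, X]
    rw [← hm, List.length_append, List.length_map, List.length_replicate]
    set t := q.eval (w.length + 1 + m)
    set a := (V.stmtCost + 1) * t + 15 * m + 5 * w.length + 26
    set N := (G.stmtCost + 1) * C₀ * (w.length + 1) ^ d +
      (S.stmtCost + 1) * (a + (5 * (w.length + m) + 21)) + 4 * (w.length + m) + 7
    have h3 : 1 ≤ 3 ^ m := Nat.one_le_pow _ _ (by omega)
    have key : ∀ z x s a b c : ℕ, 1 ≤ z →
        x + s * (z * a + b) + c + 7 ≤ z * (x + s * (a + b) + c + 7) := by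
      intro z x s a b c hz
      obtain ⟨z, rfl⟩ := Nat.exists_eq_add_of_le' hz
      have : (z + 1) * (x + s * (a + b) + c + 7) =
        x + s * ((z + 1) * a + b) + c + 7 + z * (x + s * b + c + 7) := by ring
      omega
    calc _ ≤ 3 ^ m * N := by
          refine le_trans (le_of_eq ?_) (key (3 ^ m) _ _ _ _ _ h3)
          simp only [a, t, Nat.mul_assoc, Nat.add_assoc]
          rfl
      _ ≤ 2 ^ (2 * m) * 2 ^ N := by
          refine Nat.mul_le_mul ?_ Nat.lt_two_pow_self.le
          rw [pow_mul]
          exact Nat.pow_le_pow_left (by norm_num) m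
      _ = _ := (pow_add _ _ _).symm
  · rw [decide_eq_true_iff, hf w]

/-! ### Growth of the running time -/

open Asymptotics Filter in
-- In the exponent, `log (k + 1)` is at most `(k + 1)^(ε/2)` eventually, so everything is a constant
-- times `k^(ε/2)`; the second factor `k^(ε/2)` of `k^ε` outgrows the constant.
theorem isBigO_pow_mul_two_rpow (D : ℕ) (B : ℝ) (hB : 0 ≤ B) {ε : ℝ} (hε : 0 < ε) :
    (fun k : ℕ => ((k : ℝ) + 1) ^ D * (2 : ℝ) ^ (B * ((k : ℝ) + 1) ^ (ε / 2))) =O[atTop]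
      fun k : ℕ => (2 : ℝ) ^ ((k : ℝ) ^ ε) := by
  have hε2 : 0 < ε / 2 := by linarith
  have hl2 : 0 < Real.log 2 := Real.log_pos (by norm_num)
  have h₁ : ∀ᶠ k : ℕ in atTop, Real.log ((k : ℝ) + 1) ≤ ((k : ℝ) + 1) ^ (ε / 2) := by
    have h : Tendsto (fun k : ℕ => (k : ℝ) + 1) atTop atTop :=
      tendsto_atTop_add_const_right _ _ tendsto_natCast_atTop_atTop
    filter_upwards [h.eventually ((isLittleO_log_rpow_atTop hε2).bound one_pos),
      h.eventually (eventually_ge_atTop 1)] with k hk hk1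
    rw [one_mul, Real.norm_of_nonneg (Real.log_nonneg hk1),
      Real.norm_of_nonneg (by positivity)] at hk
    exact hk
  have h₂ : ∀ᶠ k : ℕ in atTop,
      2 ^ (ε / 2) * ((D + B * Real.log 2) / Real.log 2) ≤ (k : ℝ) ^ (ε / 2) :=
    ((tendsto_rpow_atTop hε2).comp tendsto_natCast_atTop_atTop).eventually_ge_atTop _
  refine IsBigO.of_bound 1 ?_
  filter_upwards [h₁, h₂, eventually_ge_atTop 1] with k hk₁ hk₂ hk
  have hk' : (1 : ℝ) ≤ k := by exact_mod_cast hk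
  rw [one_mul, Real.norm_of_nonneg (by positivity), Real.norm_of_nonneg (by positivity)]
  have hy : ((k : ℝ) + 1) ^ (ε / 2) ≤ 2 ^ (ε / 2) * (k : ℝ) ^ (ε / 2) := by
    rw [← Real.mul_rpow (by norm_num) (by positivity)]
    exact Real.rpow_le_rpow (by positivity) (by linarith) hε2.le
  have hp : ((k : ℝ) + 1) ^ D = Real.exp (D * Real.log (k + 1)) := by
    rw [Real.exp_nat_mul, Real.exp_log (show (0 : ℝ) < (k : ℝ) + 1 by positivity)]
  rw [hp, Real.rpow_def_of_pos (show (0 : ℝ) < 2 by norm_num),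
    Real.rpow_def_of_pos (show (0 : ℝ) < 2 by norm_num), ← Real.exp_add]
  refine Real.exp_le_exp.2 ?_
  have hsplit : (k : ℝ) ^ ε = (k : ℝ) ^ (ε / 2) * (k : ℝ) ^ (ε / 2) := by
    rw [← Real.rpow_add (by positivity), add_halves]
  calc D * Real.log (k + 1) + Real.log 2 * (B * ((k : ℝ) + 1) ^ (ε / 2))
      ≤ D * ((k : ℝ) + 1) ^ (ε / 2) + Real.log 2 * (B * ((k : ℝ) + 1) ^ (ε / 2)) := by gcongr
    _ = (D + B * Real.log 2) * ((k : ℝ) + 1) ^ (ε / 2) := by ring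
    _ ≤ (D + B * Real.log 2) * (2 ^ (ε / 2) * (k : ℝ) ^ (ε / 2)) := by gcongr
    _ = Real.log 2 * ((2 ^ (ε / 2) * ((D + B * Real.log 2) / Real.log 2)) *
        (k : ℝ) ^ (ε / 2)) := by field_simp
    _ ≤ Real.log 2 * ((k : ℝ) ^ (ε / 2) * (k : ℝ) ^ (ε / 2)) := by gcongr
    _ = Real.log 2 * (k : ℝ) ^ ε := by rw [hsplit]

/-- The shift `b` makes `n ≥ A + 1`, which absorbs the coefficient into one more power of `n`, and
`n ≥ 2 ^ (E + 2)`, so that `log n` is at least the exponent `E + 2`. -/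
theorem add_mul_pow_le_rpow_logb {n r b A E : ℕ} (hn : n = r + b) (hb : A + 1 + 2 ^ (E + 2) ≤ b) :
    ((n + A * r ^ E : ℕ) : ℝ) ≤ (n : ℝ) ^ Real.logb 2 n := by
  have h2 : 0 < 2 ^ (E + 2) := by positivity
  have h₁ : n + A * r ^ E ≤ n ^ (E + 2) := by
    calc n + A * r ^ E ≤ n ^ (E + 1) + A * n ^ (E + 1) :=
          add_le_add (Nat.le_self_pow (by omega) n) (Nat.mul_le_mul_left A
            ((Nat.pow_le_pow_left (by omega) E).trans (Nat.pow_le_pow_right (by omega) (by omega))))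
      _ = (A + 1) * n ^ (E + 1) := by ring
      _ ≤ n * n ^ (E + 1) := Nat.mul_le_mul_right _ (by omega)
      _ = n ^ (E + 2) := by ring
  have h₂ : (2 : ℝ) ^ (E + 2) ≤ n := by exact_mod_cast (show 2 ^ (E + 2) ≤ n by omega)
  have hn0 : (1 : ℝ) ≤ n := by exact_mod_cast (show 1 ≤ n by omega)
  calc ((n + A * r ^ E : ℕ) : ℝ) ≤ ((n ^ (E + 2) : ℕ) : ℝ) := by exact_mod_cast h₁
    _ = (n : ℝ) ^ ((E + 2 : ℕ) : ℝ) := by rw [Real.rpow_natCast, Nat.cast_pow]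
    _ ≤ (n : ℝ) ^ Real.logb 2 n := by
      refine Real.rpow_le_rpow_of_exponent_le hn0 ?_
      rw [Real.le_logb_iff_rpow_le (by norm_num) (by linarith), Real.rpow_natCast]
      exact h₂

/-- The total running time of the algorithm for words of length `k`. -/
theorem exists_time_bound (b d e B : ℕ) (hd : 1 ≤ d) (P D : ℕ) {ε : ℝ} (hε : 0 < ε)
    (he : (e : ℝ) ≤ d * (ε / 2)) :
    ∃ C : ℕ, ∀ k r t : ℕ, r ^ d ≤ 4 ^ d * (k + 1) →
      t ≤ P * (r + b + k + 1) ^ D * 2 ^ (B * (r + b + 1) ^ e) →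
      (t : ℝ) ≤ C * (2 : ℝ) ^ ((k : ℝ) ^ ε) := by
  have hO := isBigO_pow_mul_two_rpow D (B * ((b + 5 : ℕ) : ℝ) ^ e) (by positivity) hε
  -- The comparison function never vanishes, so one constant serves for all `k`, small ones
  -- included.
  obtain ⟨C, hC⟩ := (Asymptotics.isBigO_nat_atTop_iff fun k hk =>
    absurd hk (by positivity)).1 hO
  refine ⟨⌈P * ((4 ^ d + b + 1 : ℕ) : ℝ) ^ D * C⌉₊, fun k r t hr ht => ?_⟩
  have hk : (1 : ℝ) ≤ (k : ℝ) + 1 := by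
    have := k.cast_nonneg (α := ℝ)
    linarith
  have h₁ : r + b + k + 1 ≤ (4 ^ d + b + 1) * (k + 1) := by
    have : r ≤ r ^ d := Nat.le_self_pow (by omega) r
    nlinarith [Nat.zero_le (b * k)]
  have h₂ : (r : ℝ) ≤ 4 * ((k : ℝ) + 1) ^ (1 / d : ℝ) := by
    have hd' : (d : ℝ) ≠ 0 := by positivity
    refine le_of_pow_le_pow_left₀ (n := d) (by omega) (by positivity) ?_
    rw [mul_pow, ← Real.rpow_natCast (_ ^ (_ : ℝ)), ← Real.rpow_mul (by positivity),
      one_div_mul_cancel hd', Real.rpow_one]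
    exact_mod_cast hr
  have h₃ : (r + b + 1 : ℝ) ≤ ((b + 5 : ℕ) : ℝ) * ((k : ℝ) + 1) ^ (1 / d : ℝ) := by
    have : (1 : ℝ) ≤ ((k : ℝ) + 1) ^ (1 / d : ℝ) := Real.one_le_rpow hk (by positivity)
    push_cast
    nlinarith [b.cast_nonneg (α := ℝ)]
  have h₄ : (r + b + 1 : ℝ) ^ e ≤ ((b + 5 : ℕ) : ℝ) ^ e * ((k : ℝ) + 1) ^ (ε / 2) := by
    refine (pow_le_pow_left₀ (by positivity) h₃ e).trans ?_
    rw [mul_pow, ← Real.rpow_natCast (_ ^ (_ : ℝ)), ← Real.rpow_mul (by positivity)]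
    refine mul_le_mul_of_nonneg_left (Real.rpow_le_rpow_of_exponent_le hk ?_) (by positivity)
    have hd' : (0 : ℝ) < d := by positivity
    rw [one_div_mul_eq_div, div_le_iff₀ hd']
    linarith
  have hCk := hC k
  rw [Real.norm_of_nonneg (by positivity), Real.norm_of_nonneg (by positivity)] at hCk
  calc (t : ℝ) ≤ ((P * (r + b + k + 1) ^ D * 2 ^ (B * (r + b + 1) ^ e) : ℕ) : ℝ) := by
        exact_mod_cast ht
    _ = P * ((r + b + k + 1 : ℕ) : ℝ) ^ D * (2 : ℝ) ^ (B * (r + b + 1 : ℝ) ^ e) := by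
        rw [Nat.cast_mul, Nat.cast_mul, Nat.cast_pow, Nat.cast_pow, Nat.cast_ofNat,
          ← Real.rpow_natCast 2]
        push_cast
        rfl
    _ ≤ P * (((4 ^ d + b + 1) * (k + 1) : ℕ) : ℝ) ^ D *
        (2 : ℝ) ^ (B * (((b + 5 : ℕ) : ℝ) ^ e * ((k : ℝ) + 1) ^ (ε / 2))) := by
        gcongr
        norm_num
    _ = P * ((4 ^ d + b + 1 : ℕ) : ℝ) ^ D * (((k : ℝ) + 1) ^ D *
        (2 : ℝ) ^ (B * ((b + 5 : ℕ) : ℝ) ^ e * ((k : ℝ) + 1) ^ (ε / 2))) := by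
        rw [Nat.cast_mul, mul_pow, mul_assoc (B : ℝ)]
        push_cast
        ring
    _ ≤ P * ((4 ^ d + b + 1 : ℕ) : ℝ) ^ D * (C * (2 : ℝ) ^ ((k : ℝ) ^ ε)) := by gcongr
    _ = P * ((4 ^ d + b + 1 : ℕ) : ℝ) ^ D * C * (2 : ℝ) ^ ((k : ℝ) ^ ε) := by ring
    _ ≤ _ := by
        gcongr
        exact Nat.le_ceil _

/-- The left side is the time that `OutputsInTime.comp` gives for four machines nested to the right;
it is linear in the times and lengths, which are all bounded by multiples of `Z`. -/
theorem pipeline_bound {s₀ s₁ s₂ s₃ s₄ s₅ C₂ C₃ t₀ t₁ t₂ t₃ n l k Z : ℕ} (h₀ : t₀ ≤ Z)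
    (h₁ : t₁ ≤ Z) (h₂ : t₂ ≤ Z) (h₃ : t₃ ≤ Z) (hn : n ≤ Z) (hl : l ≤ C₂ * Z) (hk : k ≤ Z)
    (hZ : 1 ≤ Z) :
    s₀ * (C₃ * t₀) + s₁ * (s₂ * (C₂ * t₁) + s₃ * (s₄ * t₂ + s₅ * t₃ + 4 * n + 7) + 4 * l + 7) +
      4 * k + 7 ≤
      (s₀ * C₃ + s₁ * (s₂ * C₂ + s₃ * (s₄ + s₅ + 4 + 7) + 4 * C₂ + 7) + 4 + 7) * Z := by
  calc _ ≤ s₀ * (C₃ * Z) + s₁ * (s₂ * (C₂ * Z) + s₃ * (s₄ * Z + s₅ * Z + 4 * Z + 7 * Z) +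
        4 * (C₂ * Z) + 7 * Z) + 4 * Z + 7 * Z := by
        gcongr <;> omega
    _ = _ := by ring

/-! ### The compression of instances by `R`, assembled -/

theorem mainTheorem5 (L : Language Bool) (hL : InNP L)
    (R : TuringMachine Computability.Γ' Bool) (c n₀ : ℕ)
    (hR : ∀ n : ℕ, n₀ ≤ n → ∀ D : CoNondetCircuit n,
      (D.size : ℝ) ≤ (n : ℝ) ^ Real.logb 2 n →
        ∃ w : List Bool, w.length = n ∧ R.OutputsInTime D.encode w (2 ^ (c * n)) ∧
          ¬ (D.Accepts w ↔ w ∈ L))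
    (L' : Language Bool) (hL' : InNP L') (ε : ℝ) (hε : 0 < ε) :
    InDTIME (fun n => (2 : ℝ) ^ ((n : ℝ) ^ ε)) L' := by
  obtain ⟨D, g, A, E, hg, hD, hsize⟩ := hL'.exists_circuits
  obtain ⟨S, C₁, e, hS⟩ := hL.exists_exponential_time
  obtain ⟨G, C₂, d₂, hG⟩ := g.exists_machine
  -- With `n` of order `k^(1/d)` this gives `n ^ (e + 1) = O(k^(ε/2))`. The exponent is `e + 1`
  -- rather than `e` so that it also covers the time `2 ^ (c * n)` of `R` when `e = 0`.
  obtain ⟨d, hd⟩ := exists_nat_ge (((e + 1 : ℕ) : ℝ) / (ε / 2))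
  have hd1 : 1 ≤ d := by
    refine Nat.one_le_iff_ne_zero.2 fun h => ?_
    rw [h, Nat.cast_zero] at hd
    exact absurd hd (not_le.2 (by positivity))
  rw [div_le_iff₀ (by linarith)] at hd
  -- The padding `b` makes `n = r + b` large enough for `R` and for the size bound whatever the
  -- length of `x`, so no finite set of exceptional inputs remains.
  set b := n₀ + (A + 1 + 2 ^ (d * E + 2)) with hb
  obtain ⟨N, C₃, hN⟩ := UnaryRoot.exists_machine d b hd1
  obtain ⟨C, hC⟩ := exists_time_bound b d (e + 1) (c + C₁ + 1) hd1
    ((N.stmtCost + 1) * C₃ + ((G.comp (R.comp S)).stmtCost + 1) *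
      ((G.stmtCost + 1) * C₂ + ((R.comp S).stmtCost + 1) *
        (R.stmtCost + 1 + (S.stmtCost + 1) + 4 + 7) + 4 * C₂ + 7) + 4 + 7)
    (d₂ + 2) hε hd
  refine ⟨N.comp (G.comp (R.comp S)), C, fun x => ?_⟩
  obtain ⟨r, hr₁, hr₂, hr⟩ := hN x
  have h2 : 0 < 2 ^ (d * E + 2) := by positivity
  have hn₀ : n₀ ≤ r + b := by omega
  have hsz : (((D (r + b) x).size : ℕ) : ℝ) ≤ ((r + b : ℕ) : ℝ) ^ Real.logb 2 (r + b : ℕ) := by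
    refine le_trans ?_ (add_mul_pow_le_rpow_logb (A := A) (E := d * E) (r := r) (b := b) rfl
      (by omega))
    refine Nat.cast_le.2 ((hsize _ _).trans ?_)
    -- Since `|x| + 1 ≤ r ^ d`, a circuit of size polynomial in `|x|` has size polynomial in `r`,
    -- with exponent `d * E`.
    rw [pow_mul]
    gcongr
  obtain ⟨w, hw, hRw, hne⟩ := hR (r + b) hn₀ (D (r + b) x) hsz
  obtain ⟨β, hβ, hβL⟩ := hS w
  rw [hD _ _ _ hw] at hne
  have hGx := hG (List.replicate (r + b) none ++ x.map some)
  rw [hg] at hGx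
  -- The circuit accepts `w` iff `x ∉ L'`, and `R` makes it disagree with `L` on `w`.
  have hLL : w ∈ L ↔ x ∈ L' := by
    by_cases h₁ : w ∈ L <;> by_cases h₂ : x ∈ L' <;> simp_all
  refine ⟨β, _, hr.comp (hGx.2.comp (hRw.comp hβ)), ?_, hβL.trans hLL⟩
  refine hC x.length r _ hr₂ ?_
  have hen := hGx.1
  generalize (D (r + b) x).encode.length = l at hen ⊢
  rw [hw]
  rw [List.length_append, List.length_replicate, List.length_map] at hen ⊢
  set n := r + b with hn
  -- `X` bounds the exponential quantities, namely the times of `R` and of the search, and also `n`,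
  -- for which the summand 1 is there; `P` bounds the polynomial ones. All of them are then at most
  -- `P * X`, up to constants.
  set X := 2 ^ ((c + C₁ + 1) * (n + 1) ^ (e + 1)) with hX
  set P := (n + x.length + 1) ^ (d₂ + 2) with hP
  have hP1 : 1 ≤ P := Nat.one_le_pow _ _ (by omega)
  have hX1 : 1 ≤ X := Nat.one_le_pow _ _ (by omega)
  have hexp : ∀ i j, i ≤ c + C₁ + 1 → j ≤ (n + 1) ^ (e + 1) → 2 ^ (i * j) ≤ X := fun i j hi hj =>
    Nat.pow_le_pow_right (by omega) (Nat.mul_le_mul hi hj)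
  have hnp : n + 1 ≤ (n + 1) ^ (e + 1) := Nat.le_self_pow (by omega) _
  have h₁ : 2 ^ (c * n) ≤ X := hexp _ _ (by omega) (by omega)
  have h₂ : 2 ^ (C₁ * (n + 1) ^ e) ≤ X :=
    hexp _ _ (by omega) (Nat.pow_le_pow_right (by omega) (by omega))
  have h₃ : n ≤ X := by
    refine le_trans ?_ (hexp 1 n (by omega) (by omega))
    rw [Nat.one_mul]
    exact Nat.lt_two_pow_self.le
  have h₄ : (n + x.length + 1) ^ d₂ ≤ P := Nat.pow_le_pow_right (by omega) (by omega)
  have h₅ : (x.length + 1) ^ 2 ≤ P :=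
    (Nat.pow_le_pow_left (by omega) 2).trans (Nat.pow_le_pow_right (by omega) (by omega))
  have h₆ : n + x.length ≤ P := by
    refine le_trans ?_ (Nat.le_self_pow (n := d₂ + 2) (by omega) _)
    omega
  have h₇ : l ≤ C₂ * P := hen.trans (Nat.mul_le_mul_left _ h₄)
  have hPX : P ≤ P * X := Nat.le_mul_of_pos_right _ hX1
  have hXP : X ≤ P * X := Nat.le_mul_of_pos_left _ hP1
  rw [Nat.mul_assoc]
  exact pipeline_bound (h₅.trans hPX) (h₄.trans hPX) (h₁.trans hXP) (h₂.trans hXP) (h₃.trans hXP)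
    (h₇.trans (Nat.mul_le_mul_left _ hPX)) (h₆.trans hPX) (hP1.trans hPX)
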